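/- **Setting.** Let $a_1<\dots<a_n$ be distinct real numbers, $v_i=(a_i,1)\in\mathbb R^2$, let $\pi:\mathbb R^n\to\mathbb R^2$ be the linear map with $\pi(e_i)=v_i$, and let $k\ge 0$ be an integer with $k\le n-2$. *Tilings.* For disjoint $A,B\subseteq[n]$ let $F_{A,B}$ be the face of $[0,1]^n$ given by $x_i=1$ for $i\in A$ and $x_i=0$ for $i\notin A\cup B$, and $\Pi_{A,B}=\pi(F_{A,B})$. A *fine zonotopal tiling* $\mathcal T$ is a collection of faces $F_{A,B}$ with $|B|=2$ whose images form a polyhedral subdivision of the zonotope $\pi([0,1]^n)$ and satisfy $\pi(F\cap F')=\pi(F)\cap\pi(F')$ for all $F,F'\in\mathcal T$. Its *vertices* are the sets $S$ with $A\subseteq S\subseteq A\cup B$ for some $F_{A,B}\in\mathcal T$. *Flips.* A circuit is a pair $C=(C^+,C^-)$ of disjoint sets, not both empty, such that every proper subset of $\{v_i : i\in C^+\cup C^-\}$ is independent and some linear relation $\sum_i\alpha_iv_i=0$ has $\alpha_i>0$ exactly on $C^+$ and $\alpha_i<0$ exactly on $C^-$. A tiling orients $C$ positively if some vertex $S$ satisfies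 $C^+\subseteq S$, $C^-\cap S=\emptyset$ and no vertex $S$ satisfies $C^-\subseteq S$, $C^+\cap S=\emptyset$; it orients $C$ negatively if it orients $-C=(C^-,C^+)$ positively. Two tilings are connected by a *flip* along $C$ if they orient $\pm C$ oppositely and every other circuit equally. After replacing $C$ by $-C$ if necessary, with $\underline C=C^+\cup C^-$, the flip from $\mathcal T_1$ to $\mathcal T_2$ replaces the tiles $\Pi_{A\cup\{j\},\underline C\setminus\{j\}}$ $(j\in C^+)$ and $\Pi_{A,\underline C\setminus\{j\}}$ $(j\in C^-)$ by $\Pi_{A,\underline C\setminus\{j\}}$ $(j\in C^+)$ and $\Pi_{A\cup\{j\},\underline C\setminus\{j\}}$ $(j\in C^-)$ for a set $A\subseteq[n]\setminus\underline C$; its *level* is $|A|+1$. Two tilings are *$k$-equivalent* if they are connected by a sequence of flips none of which has level $k$. There is a flip between two $k$-equivalence classes if some flip of level $k$ connects a tiling in one with a tiling in the other. *Hypertriangulations.* A hypertriangulation at level $K$ is a chain of $K$-element subsets of $[n]$ from $\{1,\dots,K\}$ to $\{n-K+1,\dots,n\}$ with steps $I\cup\{i\}\to I\cup\{j\}$,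 $i<j$, $i,j\notin I$. It is *lifting* if it is the cross-section at level $K$ of a fine zonotopal tiling, that is, its vertices are the $K$-element vertices of the tiling and its edges are $A\cup\{i\}\to A\cup\{j\}$, $i<j$, for the tiles $\Pi_{A,\{i,j\}}$ with $|A|=K-1$. It is *reduced* if $|A_1\cap A_2\cap A_3|=K-2$ for any three consecutive vertices. A lifting hypertriangulation is reduced by successively throwing away the middle vertex of a consecutive triple that violates this equality, until none is left. Flips between lifting hypertriangulations at level $K$ may be understood in either of two ways: (a) two different lifting hypertriangulations that are cross-sections of two tilings connected by a flip of any level; (b) two lifting hypertriangulations one of which arises from the other by inserting one set. For either notion, there is a flip between reduced lifting hypertriangulations $R\neq R'$ if some $H,H'$ that reduce to $R,R'$, respectively, are connected by a flip. **Proposition.** There is a bijection $\Phi$ from the set of $k$-equivalence classes of fine zonotopal tilings onto the set of reduced lifting hypertriangulations at level $k+1$ such that: 1. for every tiling $\mathcal T$, the cross-section of $\mathcal T$ at level $k+1$ exists, and $\Phi([\mathcal T])$ is the one and only reduced lifting hypertriangulation to which it reduces; 2. for all classes $c,c'$, there is a flip between the reduced lifting hypertriangulations $\Phi(c)$ and $\Phi(c')$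 if and only if there is a flip (necessarily of level $k$) between $c$ and $c'$; this holds for each of the notions (a) and (b). -/

import Mathlib

/-!
Fine zonotopal tilings of the planar zonotope of a generic one-dimensional point configuration,
their flips and the levels of flips, `k`-equivalence, and (reduced) lifting hypertriangulations.

Throughout, `a : Fin n → ℝ` lists the points of the configuration in increasing order, so that
the element `i` of `[n]` is the element `i - 1` of `Fin n`.
-/

namespace HigherSecondary

variable {n : ℕ}

/-! ### Fine zonotopal tilings -/

/-- The lift `v_i = (a_i, 1)` of the `i`-th point. -/
def liftVec (a : Fin n → ℝ) (i : Fin n) : ℝ × ℝ := (a i, 1)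

/-- The linear projection `π` with `π(e_i) = v_i`. -/
noncomputable def proj (a : Fin n → ℝ) : (Fin n → ℝ) →ₗ[ℝ] ℝ × ℝ :=
  Fintype.linearCombination ℝ (liftVec a)

/-- The unit cube `[0,1]^n`. -/
def cube (n : ℕ) : Set (Fin n → ℝ) := {x | ∀ i, 0 ≤ x i ∧ x i ≤ 1}

/-- The face `F_{A,B}` of the unit cube: `x_i = 1` on `A` and `x_i = 0` outside `A ∪ B`. -/
def cubeFace (A B : Finset (Fin n)) : Set (Fin n → ℝ) :=
  {x | x ∈ cube n ∧ (∀ i ∈ A, x i = 1) ∧ ∀ i, i ∉ A ∪ B → x i = 0}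

/-- The zonotope `Z_V = π([0,1]^n)`. -/
noncomputable def zonotope (a : Fin n → ℝ) : Set (ℝ × ℝ) := proj a '' cube n

/-- The parallelogram `Π_{A,B} = π(F_{A,B})`. -/
noncomputable def tile (a : Fin n → ℝ) (A B : Finset (Fin n)) : Set (ℝ × ℝ) :=
  proj a '' cubeFace A B

/-- A fine zonotopal tiling of the zonotope of `a`: a collection of two-dimensional faces
`F_{A,B}` of the cube, recorded as pairs `(A, B)`, whose images cover the zonotope and satisfy
`π(F ∩ F') = π(F) ∩ π(F')`. For distinct points `π` is injective on every two-dimensional face, so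
each image is a parallelogram and the last condition says that two of them meet in a common
(possibly empty) face, that is, that they form a polyhedral subdivision. -/
@[ext]
structure Tiling (a : Fin n → ℝ) where
  tiles : Finset (Finset (Fin n) × Finset (Fin n))
  disjoint : ∀ t ∈ tiles, Disjoint t.1 t.2
  card_eq_two : ∀ t ∈ tiles, t.2.card = 2
  cover : (⋃ t ∈ tiles, tile a t.1 t.2) = zonotope a
  inter : ∀ s ∈ tiles, ∀ t ∈ tiles,
    proj a '' (cubeFace s.1 s.2 ∩ cubeFace t.1 t.2) = tile a s.1 s.2 ∩ tile a t.1 t.2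

/-- The vertices of a tiling: the sets `S` with `A ⊆ S ⊆ A ∪ B` for some tile `Π_{A,B}`. -/
def Tiling.vertices {a : Fin n → ℝ} (T : Tiling a) : Set (Finset (Fin n)) :=
  {S | ∃ t ∈ T.tiles, t.1 ⊆ S ∧ S ⊆ t.1 ∪ t.2}

/-! ### Circuits, orientations and flips -/

/-- `C = (C⁺, C⁻)` is a circuit of the vectors `v_i`: the (nonempty) signed support of a linear
relation, every proper subset of the support being independent. -/
def IsCircuit (a : Fin n → ℝ) (C : Finset (Fin n) × Finset (Fin n)) : Prop :=
  Disjoint C.1 C.2 ∧ (C.1 ∪ C.2).Nonempty ∧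
  (∀ i ∈ C.1 ∪ C.2, LinearIndependent ℝ
    (fun j : {j : Fin n // j ∈ (C.1 ∪ C.2).erase i} => liftVec a j)) ∧
  ∃ α : Fin n → ℝ, (∀ i ∈ C.1, 0 < α i) ∧ (∀ i ∈ C.2, α i < 0) ∧
    (∀ i, i ∉ C.1 ∪ C.2 → α i = 0) ∧ ∑ i, α i • liftVec a i = 0

/-- The set `S` orients `C` positively. It orients `C` negatively when it orients
`-C = C.swap` positively. -/
def SetOrientsPos (S : Finset (Fin n)) (C : Finset (Fin n) × Finset (Fin n)) : Prop :=
  C.1 ⊆ S ∧ Disjoint C.2 S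

/-- The vertex set of `T` orients `C` positively: some vertex orients `C` positively and
none orients it negatively. -/
def Tiling.OrientsPos {a : Fin n → ℝ} (T : Tiling a)
    (C : Finset (Fin n) × Finset (Fin n)) : Prop :=
  (∃ S ∈ T.vertices, SetOrientsPos S C) ∧ ∀ S ∈ T.vertices, ¬ SetOrientsPos S C.swap

open Classical in
/-- The orientation `σ_T(C)`: `1` if `T` orients `C` positively and `-1` if it orients `C`
negatively (the value `0` is a placeholder for the remaining case). -/
noncomputable def Tiling.sign {a : Fin n → ℝ} (T : Tiling a)
    (C : Finset (Fin n) × Finset (Fin n)) : ℤ :=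
  if T.OrientsPos C then 1 else if T.OrientsPos C.swap then -1 else 0

/-- `T₁` and `T₂` are connected by a flip along the circuit `C`, the translation of the flipped
hexagon being given by the set `A = A(F)`. The tilings orient `C` in opposite ways and all circuits
other than `± C` in the same way, and `A` describes the tiles that are exchanged. -/
structure IsFlip {a : Fin n → ℝ} (T₁ T₂ : Tiling a)
    (C : Finset (Fin n) × Finset (Fin n)) (A : Finset (Fin n)) : Prop where
  circuit : IsCircuit a C
  sign_neg : T₁.sign C = - T₂.sign C
  sign_eq : ∀ C', IsCircuit a C' → C' ≠ C → C' ≠ C.swap → T₁.sign C' = T₂.sign C'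
  disjoint : Disjoint A (C.1 ∪ C.2)
  diff₁₂ : T₁.tiles \ T₂.tiles =
    C.1.image (fun j => (insert j A, (C.1 ∪ C.2).erase j)) ∪
    C.2.image (fun j => (A, (C.1 ∪ C.2).erase j))
  diff₂₁ : T₂.tiles \ T₁.tiles =
    C.1.image (fun j => (A, (C.1 ∪ C.2).erase j)) ∪
    C.2.image (fun j => (insert j A, (C.1 ∪ C.2).erase j))

/-- `T₁` and `T₂` are connected by a flip `F` of level `l = |A(F)| + 1`. -/
def FlipAtLevel {a : Fin n → ℝ} (l : ℕ) (T₁ T₂ : Tiling a) : Prop :=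
  ∃ C A, IsFlip T₁ T₂ C A ∧ l = A.card + 1

/-- `k`-equivalence: being connected by a sequence of flips none of which has level `k`. -/
def kEquivalence (a : Fin n → ℝ) (k : ℕ) : Setoid (Tiling a) :=
  Relation.EqvGen.setoid fun T₁ T₂ => ∃ l, l ≠ k ∧ FlipAtLevel l T₁ T₂

/-- There is a flip between two `k`-equivalence classes: some flip of level `k` goes from a
tiling in the first class to a tiling in the second. -/
def ClassFlip {a : Fin n → ℝ} {k : ℕ} (c₁ c₂ : Quotient (kEquivalence a k)) : Prop :=
  ∃ T₁ T₂ : Tiling a, Quotient.mk (kEquivalence a k) T₁ = c₁ ∧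
    Quotient.mk (kEquivalence a k) T₂ = c₂ ∧ FlipAtLevel k T₁ T₂

/-! ### Hypertriangulations -/

/-- A step `I ∪ {i} → I ∪ {j}` with `i < j` and `i, j ∉ I`. -/
def MonotoneStep (S S' : Finset (Fin n)) : Prop :=
  ∃ (I : Finset (Fin n)) (i j : Fin n), i < j ∧ i ∉ I ∧ j ∉ I ∧ S = insert i I ∧ S' = insert j I

/-- A hypertriangulation at level `K`: a monotone path on the hypersimplex, that is, a chain of
`K`-element subsets from the `K` smallest elements to the `K` largest ones. -/
def IsHypertriangulation (K : ℕ) (H : List (Finset (Fin n))) : Prop :=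
  (∀ S ∈ H, S.card = K) ∧ H.IsChain MonotoneStep ∧
  H.head? = some (Finset.univ.filter fun i : Fin n => (i : ℕ) < K) ∧
  H.getLast? = some (Finset.univ.filter fun i : Fin n => n ≤ (i : ℕ) + K)

/-- `H` is the cross-section of the tiling `T` at level `K`. The hyperplane `x_1 + ⋯ + x_n = K`
meets a face `F_{A,B}` with `B = {i, j}` in the segment from `A ∪ {i}` to `A ∪ {j}` if
`|A| = K - 1`, in a vertex if `|A|` is `K` or `K - 2`, and not at all otherwise; so the vertices of
the cross-section are the `K`-element vertices of `T`, and its edges are these segments. -/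
structure IsCrossSection {a : Fin n → ℝ} (T : Tiling a) (K : ℕ)
    (H : List (Finset (Fin n))) : Prop where
  hyper : IsHypertriangulation K H
  vertices : ∀ S, S ∈ H ↔ S ∈ T.vertices ∧ S.card = K
  edges : ∀ S S', [S, S'] <:+: H ↔ ∃ (A : Finset (Fin n)) (i j : Fin n), i < j ∧
    (A, {i, j}) ∈ T.tiles ∧ A.card + 1 = K ∧ S = insert i A ∧ S' = insert j A

/-- A lifting hypertriangulation: a hypertriangulation that is a cross-section of a tiling. -/
def IsLifting (a : Fin n → ℝ) (K : ℕ) (H : List (Finset (Fin n))) : Prop :=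
  IsHypertriangulation K H ∧ ∃ T : Tiling a, IsCrossSection T K H

/-- `|A₁ ∩ A₂ ∩ A₃| = K - 2` for any three consecutive vertices. -/
def IsReduced (K : ℕ) (H : List (Finset (Fin n))) : Prop :=
  ∀ A₁ A₂ A₃, [A₁, A₂, A₃] <:+: H → (A₁ ∩ A₂ ∩ A₃).card + 2 = K

/-- The reduced lifting hypertriangulations at level `K`. -/
def ReducedLifting (a : Fin n → ℝ) (K : ℕ) : Type :=
  {H : List (Finset (Fin n)) // IsLifting a K H ∧ IsReduced K H}

/-- `H'` arises from `H` by throwing away one vertex `A₂` that violates reducedness. -/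
def ReductionStep (K : ℕ) (H H' : List (Finset (Fin n))) : Prop :=
  ∃ (L R : List (Finset (Fin n))) (A₁ A₂ A₃ : Finset (Fin n)),
    H = L ++ A₁ :: A₂ :: A₃ :: R ∧ H' = L ++ A₁ :: A₃ :: R ∧ (A₁ ∩ A₂ ∩ A₃).card + 2 ≠ K

/-- `R` is a reduced lifting hypertriangulation corresponding to `H`: it arises from `H` by
throwing away, one after another, vertices that violate reducedness. -/
def ReducesTo {a : Fin n → ℝ} {K : ℕ} (H : List (Finset (Fin n))) (R : ReducedLifting a K) : Prop :=
  Relation.ReflTransGen (ReductionStep K) H R.1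

/-! ### Flips of hypertriangulations -/

/-- `H'` arises from `H` by inserting one set. -/
def InsertsOne (H H' : List (Finset (Fin n))) : Prop :=
  ∃ (L R : List (Finset (Fin n))) (S : Finset (Fin n)), H = L ++ R ∧ H' = L ++ S :: R

/-- Two lifting hypertriangulations that differ by inserting or removing one set. -/
def InsertionFlip (a : Fin n → ℝ) (K : ℕ) (H H' : List (Finset (Fin n))) : Prop :=
  IsLifting a K H ∧ IsLifting a K H' ∧ (InsertsOne H H' ∨ InsertsOne H' H)

/-- Two different lifting hypertriangulations that are cross-sections of two tilings connected
by a flip (of any level). -/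
def InducedFlip (a : Fin n → ℝ) (K : ℕ) (H H' : List (Finset (Fin n))) : Prop :=
  H ≠ H' ∧ ∃ (T T' : Tiling a) (l : ℕ), FlipAtLevel l T T' ∧
    IsCrossSection T K H ∧ IsCrossSection T' K H'

/-- The flips between reduced lifting hypertriangulations that come from a given notion `flip` of
flips between lifting hypertriangulations: `R ≠ R'` are the reductions of two lifting
hypertriangulations that are connected by a flip. -/
def ReducedFlip {a : Fin n → ℝ} {K : ℕ}
    (flip : List (Finset (Fin n)) → List (Finset (Fin n)) → Prop)
    (R R' : ReducedLifting a K) : Prop :=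
  R ≠ R' ∧ ∃ H H', flip H H' ∧ ReducesTo H R ∧ ReducesTo H' R'

end HigherSecondary

namespace HigherSecondary

variable {n k : ℕ} {a : Fin n → ℝ}

/-! ### Lifts of points of the zonotope -/

/-! A tiling is a section of `π`: every point of the zonotope has exactly one lift to the chosen
faces (`Tiling.exists_lift`, `Tiling.lift_unique`). Hence moving a lift slightly in a direction `e_q
- e_p`, which projects to a horizontal vector, leads into exactly one tile. From this local fact
comes the pseudoline picture. The vertices of a given size form a path, which is the cross-section.
The tiles with a fixed free index `x` form a strip from the left boundary to the right one. Two
strips share at most one tile (`Tiling.tile_unique`). A flip is the exchange of the three lower and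
the three upper facets of a cube over a hexagon; it is possible as soon as the three facets of one
side are tiles (`Tiling.exists_raisingFlip`), and the sign conditions are then automatic
(`RaisingFlip.isFlip`).

Call `I` the base of a step `I ∪ {i} → I ∪ {j}`. Reduction merges consecutive steps with equal base,
and a merged step keeps its base, so the order of the reductions is irrelevant. A raising flip
translated by `A` affects two cross-sections only. At level `|A| + 1` it removes `A ∪ {j}`, where
both steps have base `A`; this is a reduction. At level `|A| + 2` it inserts `A ∪ {i, l}`, where the
base changes from `A ∪ {i}` to `A ∪ {l}`; such a vertex survives every reduction. So at level `k +
1` exactly the flips of level `k` change the reduced path.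

The converse rests on `Tiling.exists_raises_raisingFlip`: two neighbouring tiles above the same set
`A` can be merged by a raising flip, after flips with larger translations. Therefore every reduction
step is realised within a `k`-equivalence class. Moreover, two tilings with the same tiles
translated by `k`-element sets can be made equal above these tiles by bringing one level after
another to a normal form without such neighbours, and below them by the central symmetry of the
zonotope (`kEquivalence_of_agree`). Hence the reduced path determines the class. Finally, inserting
a set that changes the reduction creates two upper facets of one hexagon, and the same merging lemma
in the complementary tiling produces a flip of level `k` (`exists_flip_of_insertion`). -/

theorem proj_apply (x : Fin n → ℝ) : proj a x = (∑ i, x i * a i, ∑ i, x i) := by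
  simp [proj, Fintype.linearCombination_apply, liftVec, Prod.ext_iff, Prod.fst_sum, Prod.snd_sum]

theorem proj_eq_iff {x y : Fin n → ℝ} :
    proj a x = proj a y ↔ ∑ i, x i * a i = ∑ i, y i * a i ∧ ∑ i, x i = ∑ i, y i := by
  rw [proj_apply, proj_apply, Prod.mk.injEq]

theorem eq_off_of_mem_cubeFace {A B : Finset (Fin n)} {x y : Fin n → ℝ} (hx : x ∈ cubeFace A B)
    (hy : y ∈ cubeFace A B) {m : Fin n} (hm : m ∉ B) : x m = y m := by
  by_cases h : m ∈ A
  · rw [hx.2.1 m h, hy.2.1 m h]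
  · rw [hx.2.2 m (by simp [h, hm]), hy.2.2 m (by simp [h, hm])]

theorem sum_sub_eq_of_support_pair {x y : Fin n → ℝ} {p q : Fin n} (hpq : p ≠ q)
    (h : ∀ m, m ≠ p → m ≠ q → x m = y m) (f : Fin n → ℝ) :
    ∑ i, x i * f i - ∑ i, y i * f i = (x p - y p) * f p + (x q - y q) * f q := by
  rw [← Finset.sum_sub_distrib, ← Finset.sum_pair (f := fun i => (x i - y i) * f i) hpq]
  symm
  rw [Finset.sum_congr rfl (fun i _ => sub_mul (x i) (y i) (f i))]
  apply Finset.sum_subset (Finset.subset_univ _)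
  intro m _ hm
  simp only [Finset.mem_insert, Finset.mem_singleton, not_or] at hm
  rw [h m hm.1 hm.2, sub_self]

theorem proj_sub_of_support_pair {x y : Fin n → ℝ} {p q : Fin n} (hpq : p ≠ q)
    (h : ∀ m, m ≠ p → m ≠ q → x m = y m) :
    proj a x - proj a y =
      ((x p - y p) * a p + (x q - y q) * a q, (x p - y p) + (x q - y q)) := by
  rw [proj_apply, proj_apply, Prod.mk_sub_mk]
  have h1 := sum_sub_eq_of_support_pair hpq h a
  have h2 := sum_sub_eq_of_support_pair hpq h (fun _ => 1)
  simp only [mul_one] at h2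
  rw [h1, h2]

theorem injOn_cubeFace (ha : StrictMono a) {A B : Finset (Fin n)} (hB : B.card = 2)
    {x y : Fin n → ℝ} (hx : x ∈ cubeFace A B) (hy : y ∈ cubeFace A B)
    (h : proj a x = proj a y) : x = y := by
  obtain ⟨p, q, hpq, rfl⟩ := Finset.card_eq_two.1 hB
  have hoff : ∀ m, m ≠ p → m ≠ q → x m = y m := fun m h1 h2 =>
    eq_off_of_mem_cubeFace hx hy (by simp [h1, h2])
  have h1 := proj_sub_of_support_pair (a := a) hpq hoff
  rw [h, sub_self, eq_comm, Prod.mk_eq_zero] at h1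
  obtain ⟨h1, h2⟩ := h1
  have hne : a p - a q ≠ 0 := sub_ne_zero.2 (ha.injective.ne hpq)
  have h3 : (x p - y p) * (a p - a q) = 0 := by linear_combination h1 - a q * h2
  have h4 : x p - y p = 0 := (mul_eq_zero.1 h3).resolve_right hne
  funext m
  by_cases hp : m = p
  · subst hp; linarith
  by_cases hq : m = q
  · subst hq; linarith
  exact hoff m hp hq

/-- The intersection condition supplies a common point of the two faces over the given point, and
injectivity on each face identifies both lifts with it. Later arguments use `cover` and `inter` only
through this lemma and `Tiling.exists_lift`. -/
theorem Tiling.lift_unique (ha : StrictMono a) (T : Tiling a) {s t} (hs : s ∈ T.tiles)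
    (ht : t ∈ T.tiles) {x y : Fin n → ℝ} (hx : x ∈ cubeFace s.1 s.2) (hy : y ∈ cubeFace t.1 t.2)
    (h : proj a x = proj a y) : x = y := by
  have hm : proj a x ∈ tile a s.1 s.2 ∩ tile a t.1 t.2 := ⟨⟨x, hx, rfl⟩, ⟨y, hy, h.symm⟩⟩
  rw [← T.inter s hs t ht] at hm
  obtain ⟨z, hz, hzx⟩ := hm
  rw [injOn_cubeFace ha (T.card_eq_two s hs) hx hz.1 hzx.symm]
  exact (injOn_cubeFace ha (T.card_eq_two t ht) hy hz.2 (h.symm.trans hzx.symm)).symm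

theorem Tiling.exists_lift (T : Tiling a) {x : Fin n → ℝ} (hx : x ∈ cube n) :
    ∃ t ∈ T.tiles, ∃ y ∈ cubeFace t.1 t.2, proj a y = proj a x := by
  have h : proj a x ∈ zonotope a := ⟨x, hx, rfl⟩
  rw [← T.cover] at h
  simpa [tile, Set.mem_iUnion] using h

/-- A collection of faces such that every point of the zonotope has exactly one lift to their
union is a tiling. -/
def Tiling.ofLift (a : Fin n → ℝ) (tiles : Finset (Finset (Fin n) × Finset (Fin n)))
    (disjoint : ∀ t ∈ tiles, Disjoint t.1 t.2) (card_eq_two : ∀ t ∈ tiles, t.2.card = 2)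
    (exists_lift : ∀ x ∈ cube n, ∃ t ∈ tiles, ∃ y ∈ cubeFace t.1 t.2, proj a y = proj a x)
    (lift_unique : ∀ s ∈ tiles, ∀ t ∈ tiles, ∀ x ∈ cubeFace s.1 s.2, ∀ y ∈ cubeFace t.1 t.2,
      proj a x = proj a y → x = y) : Tiling a where
  tiles := tiles
  disjoint := disjoint
  card_eq_two := card_eq_two
  cover := by
    ext p
    simp only [Set.mem_iUnion]
    constructor
    · rintro ⟨t, _, x, hx, rfl⟩
      exact ⟨x, hx.1, rfl⟩
    · rintro ⟨x, hx, rfl⟩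
      obtain ⟨t, ht, y, hy, h⟩ := exists_lift x hx
      exact ⟨t, ht, y, hy, h⟩
  inter := by
    intro s hs t ht
    apply subset_antisymm (Set.image_inter_subset _ _ _)
    rintro _ ⟨⟨x, hx, rfl⟩, ⟨y, hy, h⟩⟩
    obtain rfl := lift_unique s hs t ht x hx y hy h.symm
    exact ⟨x, ⟨hx, hy⟩, rfl⟩

/-! ### Tiles that continue a lift in a horizontal direction -/

theorem isCompact_cubeFace (A B : Finset (Fin n)) : IsCompact (cubeFace A B) := by
  have h : cubeFace A B = Set.univ.pi (fun _ : Fin n => Set.Icc (0 : ℝ) 1) ∩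
      ((⋂ i ∈ A, {x | x i = 1}) ∩ ⋂ i, ⋂ (_ : i ∉ A ∪ B), {x : Fin n → ℝ | x i = 0}) := by
    ext x
    simp only [cubeFace, cube, Set.mem_ofPred_eq, Set.mem_inter_iff, Set.mem_pi, Set.mem_univ,
      true_implies, Set.mem_Icc, Set.mem_iInter]
  rw [h]
  apply (isCompact_univ_pi fun _ => isCompact_Icc).inter_right
  apply IsClosed.inter
  · exact isClosed_biInter fun i _ => isClosed_eq (continuous_apply i) continuous_const
  · exact isClosed_iInter fun i => isClosed_iInter fun _ =>
      isClosed_eq (continuous_apply i) continuous_const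

theorem continuous_proj : Continuous (proj a) := LinearMap.continuous_of_finiteDimensional _

theorem isClosed_tile (A B : Finset (Fin n)) : IsClosed (tile a A B) :=
  ((isCompact_cubeFace A B).image continuous_proj).isClosed

/-- The point `y` moved by `δ` in the direction `e_q - e_p`. -/
def shift (y : Fin n → ℝ) (p q : Fin n) (δ : ℝ) : Fin n → ℝ :=
  fun m => y m + δ * ((if m = q then 1 else 0) - (if m = p then 1 else 0))

theorem shift_left {y : Fin n → ℝ} {p q : Fin n} (h : p ≠ q) (δ : ℝ) :
    shift y p q δ p = y p - δ := by simp [shift, h]; ring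

theorem shift_right {y : Fin n → ℝ} {p q : Fin n} (h : p ≠ q) (δ : ℝ) :
    shift y p q δ q = y q + δ := by simp [shift, h.symm]

theorem shift_of_ne {y : Fin n → ℝ} {p q m : Fin n} (hp : m ≠ p) (hq : m ≠ q) (δ : ℝ) :
    shift y p q δ m = y m := by simp [shift, hp, hq]

theorem proj_shift {y : Fin n → ℝ} {p q : Fin n} (h : p ≠ q) (δ : ℝ) :
    proj a (shift y p q δ) = proj a y + (δ * (a q - a p), 0) := by
  rw [← sub_eq_iff_eq_add', proj_sub_of_support_pair h fun m h1 h2 => shift_of_ne h1 h2 δ,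
    shift_left h, shift_right h]
  ext
  · simp only []; ring
  · simp only []; ring

theorem shift_mem_cube {y : Fin n → ℝ} (hy : y ∈ cube n) {p q : Fin n} (h : p ≠ q) {δ : ℝ}
    (h0 : 0 ≤ δ) (hp : δ ≤ y p) (hq : δ ≤ 1 - y q) : shift y p q δ ∈ cube n := by
  intro m
  have := hy m
  by_cases h1 : m = p
  · subst h1; rw [shift_left h]; constructor <;> linarith
  by_cases h2 : m = q
  · subst h2; rw [shift_right h]; constructor <;> linarith
  rwa [shift_of_ne h1 h2]

theorem shift_mem_cubeFace {A B : Finset (Fin n)} {y : Fin n → ℝ} (hAB : Disjoint A B)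
    (hy : y ∈ cubeFace A B) {p q : Fin n} (h : p ≠ q) (hpB : p ∈ B) (hqB : q ∈ B) {δ : ℝ}
    (h0 : 0 ≤ δ) (hp : δ ≤ y p) (hq : δ ≤ 1 - y q) : shift y p q δ ∈ cubeFace A B := by
  refine ⟨shift_mem_cube hy.1 h h0 hp hq, fun m hm => ?_, fun m hm => ?_⟩
  · have hmB := Finset.disjoint_left.1 hAB hm
    rw [shift_of_ne (by rintro rfl; exact hmB hpB) (by rintro rfl; exact hmB hqB), hy.2.1 m hm]
  · simp only [Finset.mem_union, not_or] at hm
    rw [shift_of_ne (by rintro rfl; exact hm.2 hpB) (by rintro rfl; exact hm.2 hqB),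
      hy.2.2 m (by simp [hm])]

/-- The lift `y` can be continued in the tile `t` in the direction `e_j - e_i`. -/
structure Continues (t : Finset (Fin n) × Finset (Fin n)) (y : Fin n → ℝ) (i j : Fin n) :
    Prop where
  mem : y ∈ cubeFace t.1 t.2
  eq : t.2 = {i, j}
  ne : i ≠ j
  pos : 0 < y i
  lt_one : y j < 1

/-- The tiles that avoid `π(y)` have a closed union, so a short move from `π(y)` ends in a tile that
contains `π(y)`. By uniqueness of lifts `y` lies in the face of that tile, and the move can be read
off in its two free coordinates. -/
theorem Tiling.exists_continues (ha : StrictMono a) (T : Tiling a) {t₀} (ht₀ : t₀ ∈ T.tiles)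
    {y : Fin n → ℝ} (hy : y ∈ cubeFace t₀.1 t₀.2) {p q : Fin n} (hpq : p ≠ q) (hp : 0 < y p)
    (hq : y q < 1) :
    ∃ t ∈ T.tiles, ∃ i j, Continues t y i j ∧ 0 < (a j - a i) * (a q - a p) := by
  classical
  have hcl : IsClosed (⋃ t ∈ T.tiles.filter (fun t => proj a y ∉ tile a t.1 t.2),
      tile a t.1 t.2) := Set.Finite.isClosed_biUnion (Finset.finite_toSet _)
        fun t _ => isClosed_tile _ _
  have hcont : Continuous fun δ : ℝ => proj a (shift y p q δ) := by
    apply continuous_proj.comp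
    unfold shift
    fun_prop
  have hev : ∀ᶠ δ in nhdsWithin (0 : ℝ) (Set.Ioi 0), proj a (shift y p q δ) ∉
      ⋃ t ∈ T.tiles.filter (fun t => proj a y ∉ tile a t.1 t.2), tile a t.1 t.2 := by
    apply nhdsWithin_le_nhds
    refine hcont.continuousAt.eventually_mem (?_ : _ᶜ ∈ _)
    apply hcl.isOpen_compl.mem_nhds
    have : shift y p q 0 = y := by funext m; simp [shift]
    rw [this]
    simp only [Set.mem_compl_iff, Set.mem_iUnion, Finset.mem_filter, not_exists]
    rintro t ⟨_, h⟩
    exact h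
  have hsm : ∀ᶠ δ in nhdsWithin (0 : ℝ) (Set.Ioi 0), δ < min (y p) (1 - y q) := by
    apply nhdsWithin_le_nhds
    exact Iio_mem_nhds (lt_min hp (by linarith))
  obtain ⟨δ, ⟨h1, h2⟩, h3⟩ := ((hev.and hsm).and self_mem_nhdsWithin).exists
  have h3 : 0 < δ := h3
  obtain ⟨h2, h2'⟩ := lt_min_iff.1 h2
  obtain ⟨t, ht, x, hx, hxy⟩ := T.exists_lift (shift_mem_cube hy.1 hpq h3.le h2.le h2'.le)
  have hyt : proj a y ∈ tile a t.1 t.2 := by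
    by_contra hcon
    apply h1
    simp only [Set.mem_iUnion]
    exact ⟨t, Finset.mem_filter.2 ⟨ht, hcon⟩, x, hx, hxy⟩
  obtain ⟨y', hy', hyy⟩ := hyt
  obtain rfl := T.lift_unique ha ht ht₀ hy' hy hyy
  obtain ⟨i, j, hij, hB⟩ := Finset.card_eq_two.1 (T.card_eq_two t ht)
  have hoff : ∀ m, m ≠ i → m ≠ j → x m = y' m := fun m h1 h2 =>
    eq_off_of_mem_cubeFace hx hy' (by simp [hB, h1, h2])
  have hd := proj_sub_of_support_pair (a := a) hij hoff
  rw [hxy, proj_shift hpq, add_sub_cancel_left, Prod.mk.injEq] at hd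
  obtain ⟨hd1, hd2⟩ := hd
  have hx1 := hx.1
  -- The displacement is horizontal, so the coordinate sum is unchanged and the coordinates `i` and
  -- `j` move by opposite amounts. The sign of the change in `j` decides which of the two plays the
  -- role of the target.
  have key : (x j - y' j) * (a j - a i) = δ * (a q - a p) := by
    linear_combination -hd1 - a i * (-hd2)
  have hpq' : 0 < (a q - a p) * (a q - a p) :=
    mul_self_pos.2 (sub_ne_zero.2 (ha.injective.ne hpq.symm))
  have key2 : 0 < (x j - y' j) * ((a j - a i) * (a q - a p)) := by
    calc 0 < δ * ((a q - a p) * (a q - a p)) := mul_pos h3 hpq'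
      _ = _ := by linear_combination (-(a q - a p)) * key
  rcases lt_trichotomy (x j) (y' j) with h | h | h
  · refine ⟨t, ht, j, i, ⟨hy', by rw [hB, Finset.pair_comm], hij.symm, ?_, ?_⟩, ?_⟩
    · linarith [(hx1 j).1]
    · linarith [(hx1 i).2]
    · have := neg_of_mul_pos_right key2 (by linarith)
      linarith
  · rw [h] at key2; simp at key2
  · refine ⟨t, ht, i, j, ⟨hy', hB, hij, ?_, ?_⟩, ?_⟩
    · linarith [(hx1 i).1]
    · linarith [(hx1 j).2]
    · exact pos_of_mul_pos_right key2 (by linarith)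

theorem fst_eq_filter {A B : Finset (Fin n)} {y : Fin n → ℝ} (hAB : Disjoint A B)
    (hy : y ∈ cubeFace A B) (m : Fin n) : m ∈ A ↔ m ∉ B ∧ y m = 1 := by
  constructor
  · exact fun h => ⟨Finset.disjoint_left.1 hAB h, hy.2.1 m h⟩
  · rintro ⟨h1, h2⟩
    by_contra h
    rw [hy.2.2 m (by simp [h, h1])] at h2
    norm_num at h2

/-- Moves of the same horizontal length in the two tiles give two lifts of one point, which must
coincide; so the same coordinate decreases and the same one increases. -/
theorem Tiling.continues_unique (ha : StrictMono a) (T : Tiling a) {t t'} (ht : t ∈ T.tiles)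
    (ht' : t' ∈ T.tiles) {y : Fin n → ℝ} {i j i' j' : Fin n} (h : Continues t y i j)
    (h' : Continues t' y i' j') (hpos : 0 < (a j - a i) * (a j' - a i')) :
    t = t' ∧ i = i' ∧ j = j' := by
  -- The factor `c` rescales the move in `t'` so that both moves have the same projection.
  obtain ⟨c, hc0, hc⟩ : ∃ c : ℝ, 0 < c ∧ c * (a j' - a i') = a j - a i := by
    have h0 : a j' - a i' ≠ 0 := by rintro h0; rw [h0] at hpos; simp at hpos
    refine ⟨(a j - a i) / (a j' - a i'), ?_, by field_simp⟩
    rw [div_eq_mul_inv]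
    have : 0 < (a j - a i) * (a j' - a i') * ((a j' - a i')⁻¹ * (a j' - a i')⁻¹) :=
      mul_pos hpos (mul_self_pos.2 (inv_ne_zero h0))
    calc 0 < _ := this
      _ = _ := by field_simp
  obtain ⟨δ, hδ0, hδ⟩ := exists_between (lt_min (lt_min h.pos (sub_pos.2 h.lt_one))
    (lt_min (div_pos h'.pos hc0) (div_pos (sub_pos.2 h'.lt_one) hc0)))
  simp only [lt_min_iff] at hδ
  obtain ⟨⟨h1, h2⟩, h3, h4⟩ := hδ
  rw [lt_div_iff₀ hc0] at h3 h4
  have e := T.lift_unique ha ht ht'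
    (shift_mem_cubeFace (T.disjoint t ht) h.mem h.ne (by simp [h.eq]) (by simp [h.eq]) hδ0.le
      h1.le h2.le)
    (shift_mem_cubeFace (T.disjoint t' ht') h'.mem h'.ne (by simp [h'.eq]) (by simp [h'.eq])
      (mul_pos hδ0 hc0).le h3.le h4.le)
    (by rw [proj_shift h.ne, proj_shift h'.ne, ← hc]; ring_nf)
  have hpos' := mul_pos hδ0 hc0
  have ej : j = j' := by
    have e1 := congrFun e j
    rw [shift_right h.ne] at e1
    by_contra hne
    by_cases hi : j = i'
    · subst hi
      rw [shift_left h'.ne] at e1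
      linarith
    · rw [shift_of_ne hi hne] at e1
      linarith
  have ei : i = i' := by
    have e1 := congrFun e i
    rw [shift_left h.ne] at e1
    by_contra hne
    by_cases hi : i = j'
    · subst hi
      rw [shift_right h'.ne] at e1
      linarith
    · rw [shift_of_ne hne hi] at e1
      linarith
  refine ⟨?_, ei, ej⟩
  have hB : t.2 = t'.2 := by rw [h.eq, h'.eq, ei, ej]
  refine Prod.ext ?_ hB
  ext m
  rw [fst_eq_filter (T.disjoint t ht) h.mem, fst_eq_filter (T.disjoint t' ht') h'.mem, hB]

/-! ### Boundary points -/

/-- Such an `x` maximises `∑ x_m · s(a_m - c)` over the cube, and the value depends only on `π(x)`.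
A second lift is also a maximiser, hence agrees with `x` wherever `a_m ≠ c`; the coordinate sum
settles the one remaining index. This forces the boundary of the zonotope into every tiling. -/
theorem eq_of_threshold (ha : StrictMono a) {x y : Fin n → ℝ} (hy : y ∈ cube n)
    (h : proj a y = proj a x) (s c : ℝ) (h1 : ∀ m, 0 < s * (a m - c) → x m = 1)
    (h0 : ∀ m, s * (a m - c) < 0 → x m = 0) (hs : s ≠ 0) : y = x := by
  obtain ⟨e1, e2⟩ := proj_eq_iff.1 h
  have hnn : ∀ m ∈ Finset.univ, 0 ≤ (x m - y m) * (s * (a m - c)) := by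
    intro m _
    rcases lt_trichotomy 0 (s * (a m - c)) with hm | hm | hm
    · rw [h1 m hm]; exact mul_nonneg (by linarith [(hy m).2]) hm.le
    · rw [← hm]; simp
    · rw [h0 m hm]; exact mul_nonneg_of_nonpos_of_nonpos (by linarith [(hy m).1]) hm.le
  have hsum : ∑ m, (x m - y m) * (s * (a m - c)) = 0 := by
    have : ∀ m, (x m - y m) * (s * (a m - c)) =
        s * (x m * a m) - s * (y m * a m) - (s * c * x m - s * c * y m) := fun m => by ring
    simp only [this, Finset.sum_sub_distrib, ← Finset.mul_sum, e1, e2]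
    ring
  have hz := (Finset.sum_eq_zero_iff_of_nonneg hnn).1 hsum
  have hne : ∀ m, a m ≠ c → y m = x m := by
    intro m hm
    have := (mul_eq_zero.1 (hz m (Finset.mem_univ m))).resolve_right
      (mul_ne_zero hs (sub_ne_zero.2 hm))
    linarith
  funext m
  by_cases hm : a m = c
  · have e3 : ∑ i, (y i - x i) = y m - x m := by
      apply Finset.sum_eq_single m _ (by simp)
      intro b _ hb
      rw [hne b (by rw [← hm]; exact ha.injective.ne hb), sub_self]
    rw [Finset.sum_sub_distrib, e2, sub_self] at e3
    linarith
  · exact hne m hm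

/-! ### Vertices and edges of a tiling -/

/-- The vertex of the cube given by a set. -/
def vertexPt (S : Finset (Fin n)) : Fin n → ℝ := fun m => if m ∈ S then 1 else 0

/-- The midpoint of the edge of the cube from `S` to `S ∪ {x}`. -/
noncomputable def edgePt (S : Finset (Fin n)) (x : Fin n) : Fin n → ℝ :=
  fun m => if m = x then 1 / 2 else if m ∈ S then 1 else 0

theorem vertexPt_mem_cube (S : Finset (Fin n)) : vertexPt S ∈ cube n := by
  intro m
  unfold vertexPt
  split_ifs <;> norm_num

theorem edgePt_mem_cube (S : Finset (Fin n)) (x : Fin n) : edgePt S x ∈ cube n := by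
  intro m
  unfold edgePt
  split_ifs <;> norm_num

theorem vertexPt_mem_cubeFace {S A B : Finset (Fin n)} :
    vertexPt S ∈ cubeFace A B ↔ A ⊆ S ∧ S ⊆ A ∪ B := by
  constructor
  · rintro ⟨_, h1, h2⟩
    refine ⟨fun m hm => ?_, fun m hm => ?_⟩
    · by_contra h
      have := h1 m hm
      simp [vertexPt, h] at this
    · by_contra h
      have := h2 m h
      simp [vertexPt, hm] at this
  · rintro ⟨h1, h2⟩
    refine ⟨vertexPt_mem_cube S, fun m hm => ?_, fun m hm => ?_⟩
    · simp [vertexPt, h1 hm]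
    · have hmS : m ∉ S := fun h => hm (h2 h)
      simp [vertexPt, hmS]

theorem edgePt_mem_cubeFace {S A B : Finset (Fin n)} {x : Fin n}
    (hx : x ∉ S) : edgePt S x ∈ cubeFace A B ↔ x ∈ B ∧ A ⊆ S ∧ S ⊆ A ∪ B := by
  constructor
  · rintro ⟨_, h1, h2⟩
    have hxA : x ∉ A := by
      intro h
      have := h1 x h
      norm_num [edgePt] at this
    refine ⟨?_, fun m hm => ?_, fun m hm => ?_⟩
    · by_contra h
      have := h2 x (by simp [h, hxA])
      norm_num [edgePt] at this
    · have := h1 m hm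
      have hmx : m ≠ x := by rintro rfl; exact hxA hm
      by_contra h
      simp [edgePt, h, hmx] at this
    · by_contra h
      have := h2 m h
      have hmx : m ≠ x := by rintro rfl; exact hx hm
      simp [edgePt, hm, hmx] at this
  · rintro ⟨h0, h1, h2⟩
    refine ⟨edgePt_mem_cube S x, fun m hm => ?_, fun m hm => ?_⟩
    · have hmx : m ≠ x := by rintro rfl; exact hx (h1 hm)
      simp [edgePt, h1 hm, hmx]
    · have hmx : m ≠ x := by rintro rfl; exact hm (by simp [h0])
      have hmS : m ∉ S := fun h => hm (h2 h)
      simp [edgePt, hmS, hmx]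

/-- The segment from `S` to `S ∪ {x}` is an edge of the tiling `T`. -/
def Tiling.Edge (T : Tiling a) (S : Finset (Fin n)) (x : Fin n) : Prop :=
  x ∉ S ∧ ∃ t ∈ T.tiles, x ∈ t.2 ∧ t.1 ⊆ S ∧ S ⊆ t.1 ∪ t.2

theorem Tiling.notMem_of_tile (T : Tiling a) {A : Finset (Fin n)} {i j : Fin n}
    (h : (A, {i, j}) ∈ T.tiles) : i ∉ A ∧ j ∉ A := by
  have := T.disjoint _ h
  simp at this
  exact this

theorem Tiling.edge_of_tile (T : Tiling a) {A : Finset (Fin n)} {i j : Fin n}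
    (h : (A, {i, j}) ∈ T.tiles) : T.Edge A i ∧ T.Edge A j := by
  obtain ⟨h1, h2⟩ := T.notMem_of_tile h
  exact ⟨⟨h1, _, h, by simp, subset_rfl, Finset.subset_union_left⟩,
    ⟨h2, _, h, by simp, subset_rfl, Finset.subset_union_left⟩⟩

theorem Tiling.edge_insert_of_tile (T : Tiling a) {A : Finset (Fin n)} {i j : Fin n}
    (hij : i ≠ j) (h : (A, {i, j}) ∈ T.tiles) :
    T.Edge (insert j A) i ∧ T.Edge (insert i A) j := by
  obtain ⟨h1, h2⟩ := T.notMem_of_tile h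
  refine ⟨⟨by simp [h1, hij], _, h, by simp, by simp, ?_⟩,
    ⟨by simp [h2, hij.symm], _, h, by simp, by simp, ?_⟩⟩ <;>
  · intro m; simp; tauto

theorem Tiling.Edge.vertex {T : Tiling a} {S : Finset (Fin n)} {x : Fin n} (h : T.Edge S x) :
    S ∈ T.vertices ∧ insert x S ∈ T.vertices := by
  obtain ⟨_, t, ht, h1, h2, h3⟩ := h
  refine ⟨⟨t, ht, h2, h3⟩, ⟨t, ht, h2.trans (Finset.subset_insert _ _), ?_⟩⟩
  exact Finset.insert_subset (by simp [h1]) h3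

theorem Continues.vertexPt_iff {t : Finset (Fin n) × Finset (Fin n)} (hd : Disjoint t.1 t.2)
    {S : Finset (Fin n)} {i j : Fin n} :
    Continues t (vertexPt S) i j ↔ i ∈ S ∧ j ∉ S ∧ t = (S.erase i, {i, j}) := by
  obtain ⟨A, B⟩ := t
  constructor
  · rintro ⟨h1, h2, h3, h4, h5⟩
    have hi : i ∈ S := by by_contra h; simp [vertexPt, h] at h4
    have hj : j ∉ S := by intro h; simp [vertexPt, h] at h5
    obtain ⟨h6, h7⟩ := vertexPt_mem_cubeFace.1 h1
    simp only at h2 h6 h7 hd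
    subst h2
    refine ⟨hi, hj, Prod.ext ?_ rfl⟩
    ext m
    have e6 := @h6 m
    have e7 := @h7 m
    have e8 : m ∈ A → m ≠ i := by rintro h rfl; simp [h] at hd
    simp only [Finset.mem_union, Finset.mem_insert, Finset.mem_singleton, Finset.mem_erase] at *
    grind
  · rintro ⟨h1, h2, h3⟩
    simp only [Prod.mk.injEq] at h3
    obtain ⟨rfl, rfl⟩ := h3
    refine ⟨vertexPt_mem_cubeFace.2 ⟨Finset.erase_subset _ _, fun m hm => ?_⟩, rfl, ?_, ?_, ?_⟩
    · simp only [Finset.mem_union, Finset.mem_insert, Finset.mem_singleton, Finset.mem_erase]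
      tauto
    · rintro rfl; exact h2 h1
    · simp [vertexPt, h1]
    · simp [vertexPt, h2]

/-- The coordinate `x` equals `1/2`, so `x` is a free index of the tile. Whether the other free
index lies in `S` decides if the edge is an upper or a lower edge of it. -/
theorem Continues.edgePt_iff {t : Finset (Fin n) × Finset (Fin n)} (hd : Disjoint t.1 t.2)
    {S : Finset (Fin n)} {x i j : Fin n} (hx : x ∉ S) :
    Continues t (edgePt S x) i j ↔ i ≠ j ∧ ((i = x ∧ j ∉ S ∧ t = (S, {x, j})) ∨
      (j = x ∧ i ∈ S ∧ t = (S.erase i, {i, x}))) := by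
  obtain ⟨A, B⟩ := t
  constructor
  · rintro ⟨h1, h2, h3, h4, h5⟩
    refine ⟨h3, ?_⟩
    obtain ⟨h6, h7, h8⟩ := (edgePt_mem_cubeFace hx).1 h1
    simp only at h2 h6 h7 h8 hd
    subst h2
    simp only [Finset.mem_insert, Finset.mem_singleton] at h6
    rcases h6 with rfl | rfl
    · left
      have hj : j ∉ S := by intro h; simp [edgePt, h, h3.symm] at h5
      refine ⟨rfl, hj, Prod.ext ?_ rfl⟩
      ext m
      have e7 := @h7 m
      have e8 := @h8 m
      simp only [Finset.mem_union, Finset.mem_insert, Finset.mem_singleton] at *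
      grind
    · right
      have hi : i ∈ S := by by_contra h; simp [edgePt, h, h3] at h4
      refine ⟨rfl, hi, Prod.ext ?_ rfl⟩
      ext m
      have e7 := @h7 m
      have e8 := @h8 m
      have e9 : m ∈ A → m ≠ i := by rintro h rfl; simp [h] at hd
      simp only [Finset.mem_union, Finset.mem_insert, Finset.mem_singleton, Finset.mem_erase] at *
      grind
  · rintro ⟨h0, ⟨rfl, h2, h3⟩ | ⟨rfl, h2, h3⟩⟩
    · simp only [Prod.mk.injEq] at h3
      obtain ⟨rfl, rfl⟩ := h3
      refine ⟨(edgePt_mem_cubeFace hx).2 ⟨by simp, subset_rfl, Finset.subset_union_left⟩, rfl, h0, ?_, ?_⟩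
      · simp [edgePt]
      · simp [edgePt, h0.symm, h2]
    · simp only [Prod.mk.injEq] at h3
      obtain ⟨rfl, rfl⟩ := h3
      refine ⟨(edgePt_mem_cubeFace hx).2 ⟨by simp, Finset.erase_subset _ _, fun m hm => ?_⟩,
        rfl, h0, ?_, ?_⟩
      · simp only [Finset.mem_union, Finset.mem_insert, Finset.mem_singleton, Finset.mem_erase]
        tauto
      · simp [edgePt, h0, h2]
      · norm_num [edgePt]

theorem lt_of_mul_pos (ha : StrictMono a) {i j p q : Fin n} (hpq : p < q)
    (h : 0 < (a j - a i) * (a q - a p)) : i < j :=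
  ha.lt_iff_lt.1 (sub_pos.1 (pos_of_mul_pos_left h (sub_pos.2 (ha hpq)).le))

theorem gt_of_mul_pos (ha : StrictMono a) {i j p q : Fin n} (hpq : q < p)
    (h : 0 < (a j - a i) * (a q - a p)) : j < i := by
  apply lt_of_mul_pos ha hpq (a := a)
  linarith

theorem mul_pos_of_lt (ha : StrictMono a) {i j p q : Fin n} (hij : i < j) (hpq : p < q) :
    0 < (a j - a i) * (a q - a p) :=
  mul_pos (sub_pos.2 (ha hij)) (sub_pos.2 (ha hpq))

/-- Continuing a vertex to the right runs along the horizontal diagonal of a tile; this diagonal is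
a step of the cross-section. -/
theorem Tiling.exists_succ (ha : StrictMono a) (T : Tiling a) {S : Finset (Fin n)}
    (hS : S ∈ T.vertices) {p q : Fin n} (hpq : p < q) (hp : p ∈ S) (hq : q ∉ S) :
    ∃ A i j, i < j ∧ S = insert i A ∧ (A, {i, j}) ∈ T.tiles := by
  obtain ⟨t₀, ht₀, h⟩ := hS
  obtain ⟨t, ht, i, j, hc, hpos⟩ := T.exists_continues ha ht₀ (vertexPt_mem_cubeFace.2 h) hpq.ne
    (by simp [vertexPt, hp]) (by simp [vertexPt, hq])
  rw [Continues.vertexPt_iff (T.disjoint t ht)] at hc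
  obtain ⟨hi, hj, rfl⟩ := hc
  exact ⟨S.erase i, i, j, lt_of_mul_pos ha hpq hpos, (Finset.insert_erase hi).symm, ht⟩

theorem Tiling.exists_pred (ha : StrictMono a) (T : Tiling a) {S : Finset (Fin n)}
    (hS : S ∈ T.vertices) {p q : Fin n} (hpq : q < p) (hp : p ∈ S) (hq : q ∉ S) :
    ∃ A i j, i < j ∧ S = insert j A ∧ (A, {i, j}) ∈ T.tiles := by
  obtain ⟨t₀, ht₀, h⟩ := hS
  obtain ⟨t, ht, i, j, hc, hpos⟩ := T.exists_continues ha ht₀ (vertexPt_mem_cubeFace.2 h) hpq.ne'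
    (by simp [vertexPt, hp]) (by simp [vertexPt, hq])
  rw [Continues.vertexPt_iff (T.disjoint t ht)] at hc
  obtain ⟨hi, hj, rfl⟩ := hc
  refine ⟨S.erase i, j, i, gt_of_mul_pos ha hpq hpos, (Finset.insert_erase hi).symm, ?_⟩
  rwa [Finset.pair_comm]

theorem Tiling.continues_vertexPt (T : Tiling a) {A : Finset (Fin n)} {i j : Fin n}
    (hij : i ≠ j) (h : (A, {i, j}) ∈ T.tiles) :
    Continues (A, {i, j}) (vertexPt (insert i A)) i j := by
  obtain ⟨h1, h2⟩ := T.notMem_of_tile h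
  rw [Continues.vertexPt_iff (T.disjoint _ h)]
  simp [h1, h2, hij.symm]

theorem Tiling.succ_unique (ha : StrictMono a) (T : Tiling a) {A A' : Finset (Fin n)}
    {i j i' j' : Fin n} (h : (A, {i, j}) ∈ T.tiles) (h' : (A', {i', j'}) ∈ T.tiles) (hij : i < j)
    (hij' : i' < j') (hS : insert i A = insert i' A') : A = A' ∧ i = i' ∧ j = j' := by
  have c := T.continues_vertexPt hij.ne h
  have c' := T.continues_vertexPt hij'.ne h'
  rw [← hS] at c'
  obtain ⟨e, e1, e2⟩ := T.continues_unique ha h h' c c' (mul_pos_of_lt ha hij hij')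
  exact ⟨congrArg Prod.fst e, e1, e2⟩

/-! ### The two sides of an edge -/

theorem Tiling.Edge.edgePt_mem {T : Tiling a} {S : Finset (Fin n)} {x : Fin n} (h : T.Edge S x) :
    ∃ t ∈ T.tiles, edgePt S x ∈ cubeFace t.1 t.2 := by
  obtain ⟨hx, t, ht, h⟩ := h
  exact ⟨t, ht, (edgePt_mem_cubeFace hx).2 h⟩

theorem Tiling.edge_of_edgePt_mem {T : Tiling a} {S : Finset (Fin n)} {x : Fin n} (hx : x ∉ S)
    {t} (ht : t ∈ T.tiles) (h : edgePt S x ∈ cubeFace t.1 t.2) : T.Edge S x :=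
  ⟨hx, t, ht, (edgePt_mem_cubeFace hx).1 h⟩

theorem Tiling.Edge.exists_side (ha : StrictMono a) {T : Tiling a} {S : Finset (Fin n)}
    {x p q : Fin n} (h : T.Edge S x) (hpq : p ≠ q) (hp : p = x ∨ p ∈ S) (hq : q = x ∨ q ∉ S) :
    (∃ m, m ∉ S ∧ (S, {x, m}) ∈ T.tiles ∧ 0 < (a m - a x) * (a q - a p)) ∨
      ∃ m ∈ S, (S.erase m, {m, x}) ∈ T.tiles ∧ 0 < (a x - a m) * (a q - a p) := by
  obtain ⟨t₀, ht₀, hy⟩ := h.edgePt_mem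
  have hx := h.1
  obtain ⟨t, ht, i, j, hc, hpos⟩ := T.exists_continues ha ht₀ hy hpq
    (by rcases hp with rfl | hp
        · norm_num [edgePt]
        · unfold edgePt; split_ifs <;> norm_num)
    (by rcases hq with rfl | hq
        · norm_num [edgePt]
        · unfold edgePt; split_ifs; norm_num; norm_num)
  rw [Continues.edgePt_iff (T.disjoint t ht) hx] at hc
  rcases hc with ⟨_, ⟨rfl, h1, rfl⟩ | ⟨rfl, h1, rfl⟩⟩
  · exact Or.inl ⟨j, h1, ht, hpos⟩
  · exact Or.inr ⟨i, h1, ht, hpos⟩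

/-- On its right-hand side, the edge from `S` to `S ∪ {x}` has a tile in which it is an upper
edge, or it is on the boundary. -/
def Tiling.RightEnd (T : Tiling a) (S : Finset (Fin n)) (x : Fin n) : Prop :=
  (∃ c ∈ S, c < x ∧ (S.erase c, {c, x}) ∈ T.tiles) ∨ ∀ m, m ∈ S ↔ x < m

/-- On its left-hand side, the edge from `S` to `S ∪ {x}` has a tile in which it is an upper
edge, or it is on the boundary. -/
def Tiling.LeftEnd (T : Tiling a) (S : Finset (Fin n)) (x : Fin n) : Prop :=
  (∃ c ∈ S, x < c ∧ (S.erase c, {x, c}) ∈ T.tiles) ∨ ∀ m, m ∈ S ↔ m < x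

theorem Tiling.Edge.right (ha : StrictMono a) {T : Tiling a} {S : Finset (Fin n)} {x : Fin n}
    (h : T.Edge S x) : (∃ m, x < m ∧ (S, {x, m}) ∈ T.tiles) ∨ T.RightEnd S x := by
  by_cases hb : ∀ m, m ∈ S ↔ x < m
  · exact Or.inr (Or.inr hb)
  -- If `S` is not the set of all elements above `x`, the midpoint of the edge can be moved to the
  -- right, with `x` at one end of the exchange.
  have : ∃ p q, p < q ∧ (p = x ∨ p ∈ S) ∧ (q = x ∨ q ∉ S) := by
    push Not at hb
    obtain ⟨m, ⟨h1, h2⟩ | ⟨h1, h2⟩⟩ := hb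
    · exact ⟨m, x, lt_of_le_of_ne h2 (by rintro rfl; exact h.1 h1), Or.inr h1, Or.inl rfl⟩
    · exact ⟨x, m, h2, Or.inl rfl, Or.inr h1⟩
  obtain ⟨p, q, hpq, hp, hq⟩ := this
  rcases h.exists_side ha hpq.ne hp hq with ⟨m, _, h2, h3⟩ | ⟨m, h1, h2, h3⟩
  · exact Or.inl ⟨m, lt_of_mul_pos ha hpq h3, h2⟩
  · exact Or.inr (Or.inl ⟨m, h1, lt_of_mul_pos ha hpq h3, h2⟩)

theorem Tiling.Edge.left (ha : StrictMono a) {T : Tiling a} {S : Finset (Fin n)} {x : Fin n}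
    (h : T.Edge S x) : (∃ m, m < x ∧ (S, {m, x}) ∈ T.tiles) ∨ T.LeftEnd S x := by
  by_cases hb : ∀ m, m ∈ S ↔ m < x
  · exact Or.inr (Or.inr hb)
  have : ∃ p q, q < p ∧ (p = x ∨ p ∈ S) ∧ (q = x ∨ q ∉ S) := by
    push Not at hb
    obtain ⟨m, ⟨h1, h2⟩ | ⟨h1, h2⟩⟩ := hb
    · exact ⟨m, x, lt_of_le_of_ne h2 (by rintro rfl; exact h.1 h1), Or.inr h1, Or.inl rfl⟩
    · exact ⟨x, m, h2, Or.inl rfl, Or.inr h1⟩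
  obtain ⟨p, q, hpq, hp, hq⟩ := this
  rcases h.exists_side ha hpq.ne' hp hq with ⟨m, _, h2, h3⟩ | ⟨m, h1, h2, h3⟩
  · rw [Finset.pair_comm] at h2
    exact Or.inl ⟨m, gt_of_mul_pos ha hpq h3, h2⟩
  · rw [Finset.pair_comm] at h2
    exact Or.inr (Or.inl ⟨m, h1, gt_of_mul_pos ha hpq h3, h2⟩)

theorem Tiling.edge_of_threshold (ha : StrictMono a) (T : Tiling a) {S : Finset (Fin n)}
    {x : Fin n} (s : ℝ) (hs : s ≠ 0) (h1 : ∀ m, 0 < s * (a m - a x) → m ∈ S)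
    (h0 : ∀ m, s * (a m - a x) < 0 → m ∉ S) (hx : x ∉ S) : T.Edge S x := by
  obtain ⟨t, ht, y, hy, hyx⟩ := T.exists_lift (edgePt_mem_cube S x)
  have hne : ∀ m, s * (a m - a x) ≠ 0 → m ≠ x := by rintro m h rfl; simp at h
  rw [eq_of_threshold ha hy.1 hyx s (a x) (fun m hm => by simp [edgePt, h1 m hm, hne m hm.ne'])
    (fun m hm => by simp [edgePt, h0 m hm, hne m hm.ne]) hs] at hy
  exact T.edge_of_edgePt_mem hx ht hy

theorem Tiling.RightEnd.edge (ha : StrictMono a) {T : Tiling a} {S : Finset (Fin n)} {x : Fin n}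
    (h : T.RightEnd S x) : T.Edge S x := by
  rcases h with ⟨c, hc, hcx, h⟩ | h
  · have := (T.edge_insert_of_tile hcx.ne h).2
    rwa [Finset.insert_erase hc] at this
  · refine T.edge_of_threshold ha 1 one_ne_zero (fun m hm => (h m).2 ?_) (fun m hm => ?_)
      (by simp [h])
    · rw [one_mul, sub_pos, ha.lt_iff_lt] at hm
      exact hm
    · rw [one_mul, sub_neg, ha.lt_iff_lt] at hm
      rw [h]; exact hm.not_gt

theorem Tiling.LeftEnd.edge (ha : StrictMono a) {T : Tiling a} {S : Finset (Fin n)} {x : Fin n}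
    (h : T.LeftEnd S x) : T.Edge S x := by
  rcases h with ⟨c, hc, hcx, h⟩ | h
  · have := (T.edge_insert_of_tile hcx.ne h).1
    rwa [Finset.insert_erase hc] at this
  · refine T.edge_of_threshold ha (-1) (by norm_num) (fun m hm => (h m).2 ?_) (fun m hm => ?_)
      (by simp [h])
    · rw [neg_one_mul, neg_sub, sub_pos, ha.lt_iff_lt] at hm
      exact hm
    · rw [neg_one_mul, neg_sub, sub_neg, ha.lt_iff_lt] at hm
      rw [h]; exact hm.not_gt

/-- Among the edges going up from `S`, a right end is the last one on the right. It is dictated by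
the tile with left corner `S`, which is unique, or by the boundary. -/
theorem Tiling.RightEnd.unique (ha : StrictMono a) {T : Tiling a} {S : Finset (Fin n)}
    {x x' : Fin n} (h : T.RightEnd S x) (h' : T.RightEnd S x') : x = x' := by
  have hx := (h.edge ha).1
  have hx' := (h'.edge ha).1
  rcases h with ⟨c, hc, hcx, h⟩ | h <;> rcases h' with ⟨c', hc', hcx', h'⟩ | h'
  · exact (T.succ_unique ha h h' hcx hcx'
      (by rw [Finset.insert_erase hc, Finset.insert_erase hc'])).2.2
  · rw [h'] at hc hx
    exact absurd (hc.trans hcx) hx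
  · rw [h] at hc' hx'
    exact absurd (hc'.trans hcx') hx'
  · rw [h] at hx'
    rw [h'] at hx
    exact le_antisymm (not_lt.1 hx) (not_lt.1 hx') |>.symm ▸ rfl

/-! ### Zones -/

theorem Tiling.continues_edgePt_lower (T : Tiling a) {S : Finset (Fin n)} {x m : Fin n}
    (hxm : x ≠ m) (h : (S, {x, m}) ∈ T.tiles) :
    Continues (S, {x, m}) (edgePt S x) x m := by
  obtain ⟨h1, h2⟩ := T.notMem_of_tile h
  rw [Continues.edgePt_iff (T.disjoint _ h) h1]
  exact ⟨hxm, Or.inl ⟨rfl, h2, rfl⟩⟩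

theorem Tiling.continues_edgePt_upper (T : Tiling a) {S : Finset (Fin n)} {x c : Fin n}
    (hx : x ∉ S) (hc : c ∈ S) (h : (S.erase c, {c, x}) ∈ T.tiles) :
    Continues (S.erase c, {c, x}) (edgePt S x) c x := by
  rw [Continues.edgePt_iff (T.disjoint _ h) hx]
  exact ⟨by rintro rfl; exact hx hc, Or.inr ⟨rfl, hc, rfl⟩⟩

/-- Crossing the tile on the right-hand side of the edge from `S` to `S ∪ {x}` leads to the edge
from `S'` to `S' ∪ {x}`. -/
def Tiling.ZoneStep (T : Tiling a) (x : Fin n) (S S' : Finset (Fin n)) : Prop :=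
  (∃ m, x < m ∧ (S, {x, m}) ∈ T.tiles ∧ S' = insert m S) ∨
    ∃ c ∈ S, c < x ∧ x ∉ S ∧ (S.erase c, {c, x}) ∈ T.tiles ∧ S' = S.erase c

theorem Tiling.zoneStep_rightUnique (ha : StrictMono a) (T : Tiling a) (x : Fin n) :
    Relator.RightUnique (T.ZoneStep x) := by
  rintro S S₁ S₂ (⟨m, hm, h, rfl⟩ | ⟨c, hc, hcx, hx, h, rfl⟩)
    (⟨m', hm', h', rfl⟩ | ⟨c', hc', hcx', hx', h', rfl⟩)
  · obtain ⟨_, _, rfl⟩ := T.continues_unique ha h h' (T.continues_edgePt_lower hm.ne h)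
      (T.continues_edgePt_lower hm'.ne h') (mul_pos_of_lt ha hm hm')
    rfl
  · obtain ⟨_, rfl, _⟩ := T.continues_unique ha h h' (T.continues_edgePt_lower hm.ne h)
      (T.continues_edgePt_upper hx' hc' h') (mul_pos_of_lt ha hm hcx')
    exact absurd hcx' (lt_irrefl _)
  · obtain ⟨_, rfl, _⟩ := T.continues_unique ha h h' (T.continues_edgePt_upper hx hc h)
      (T.continues_edgePt_lower hm'.ne h') (mul_pos_of_lt ha hcx hm')
    exact absurd hcx (lt_irrefl _)
  · obtain ⟨_, rfl, _⟩ := T.continues_unique ha h h' (T.continues_edgePt_upper hx hc h)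
      (T.continues_edgePt_upper hx' hc' h') (mul_pos_of_lt ha hcx hcx')
    rfl

/-- The pseudolines still to be crossed on the way to the right boundary along the zone of `x`. -/
def crossAhead (x : Fin n) (S : Finset (Fin n)) : Finset (Fin n) :=
  Finset.univ.filter fun m => (x < m ∧ m ∉ S) ∨ (m < x ∧ m ∈ S)

/-- The pseudolines still to be crossed on the way to the left boundary along the zone of `x`. -/
def crossBehind (x : Fin n) (S : Finset (Fin n)) : Finset (Fin n) :=
  Finset.univ.filter fun m => (x < m ∧ m ∈ S) ∨ (m < x ∧ m ∉ S)

theorem mem_crossAhead {x m : Fin n} {S : Finset (Fin n)} :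
    m ∈ crossAhead x S ↔ (x < m ∧ m ∉ S) ∨ (m < x ∧ m ∈ S) := by simp [crossAhead]

theorem mem_crossBehind {x m : Fin n} {S : Finset (Fin n)} :
    m ∈ crossBehind x S ↔ (x < m ∧ m ∈ S) ∨ (m < x ∧ m ∉ S) := by simp [crossBehind]

/-- Walk to the right along the strip of `x`. Each tile removes exactly its other free index from
`crossAhead`, which is empty at the boundary, so `l` is crossed on the way. The index `j` is never
crossed, so its membership does not change. -/
theorem Tiling.Edge.exists_crossing_right (ha : StrictMono a) {T : Tiling a}
    {S : Finset (Fin n)} {x : Fin n} (h : T.Edge S x) {l j : Fin n} (hl : l ∈ crossAhead x S)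
    (hj : j ∉ crossAhead x S) (hjx : j ≠ x) :
    ∃ A, (A, {x, l}) ∈ T.tiles ∧ (j ∈ A ↔ j ∈ S) := by
  induction hN : (crossAhead x S).card using Nat.strong_induction_on generalizing S with
  | _ N ih =>
  have hx := h.1
  have hlx : l ≠ x := by
    rintro rfl
    simp [mem_crossAhead] at hl
  rcases h.right ha with ⟨m, hxm, hm⟩ | ⟨c, hc, hcx, hm⟩ | hend
  · by_cases hml : m = l
    · subst hml
      exact ⟨S, hm, Iff.rfl⟩
    have hjm : j ≠ m := by
      rintro rfl
      exact hj (mem_crossAhead.2 (Or.inl ⟨hxm, (T.notMem_of_tile hm).2⟩))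
    have hss : crossAhead x (insert m S) ⊂ crossAhead x S := by
      have h1 : m ∈ crossAhead x S := mem_crossAhead.2 (Or.inl ⟨hxm, (T.notMem_of_tile hm).2⟩)
      refine (Finset.ssubset_iff_of_subset fun y hy => ?_).2 ⟨m, h1, ?_⟩
      · rw [mem_crossAhead] at hy ⊢
        rcases hy with ⟨h2, h3⟩ | ⟨h2, h3⟩
        · simp only [Finset.mem_insert, not_or] at h3; exact Or.inl ⟨h2, h3.2⟩
        · refine Or.inr ⟨h2, (Finset.mem_insert.1 h3).resolve_left ?_⟩
          rintro rfl; exact absurd h2 hxm.not_gt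
      · simp [mem_crossAhead, hxm.le]
    obtain ⟨A, hA, hjA⟩ := ih _ (hN ▸ Finset.card_lt_card hss)
      ((T.edge_insert_of_tile hxm.ne hm).1)
      (by rw [mem_crossAhead] at hl ⊢; simpa [Ne.symm hml] using hl)
      (fun h1 => hj (hss.1 h1)) rfl
    exact ⟨A, hA, by rw [hjA]; simp [hjm]⟩
  · by_cases hcl : c = l
    · subst hcl
      refine ⟨S.erase c, by rwa [Finset.pair_comm], ?_⟩
      have : j ≠ c := by rintro rfl; exact hj (mem_crossAhead.2 (Or.inr ⟨hcx, hc⟩))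
      simp [this]
    have hjc : j ≠ c := by rintro rfl; exact hj (mem_crossAhead.2 (Or.inr ⟨hcx, hc⟩))
    have hss : crossAhead x (S.erase c) ⊂ crossAhead x S := by
      have h1 : c ∈ crossAhead x S := mem_crossAhead.2 (Or.inr ⟨hcx, hc⟩)
      refine (Finset.ssubset_iff_of_subset fun y hy => ?_).2 ⟨c, h1, ?_⟩
      · rw [mem_crossAhead] at hy ⊢
        rcases hy with ⟨h2, h3⟩ | ⟨h2, h3⟩
        · refine Or.inl ⟨h2, fun h4 => h3 (Finset.mem_erase.2 ⟨?_, h4⟩)⟩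
          rintro rfl; exact absurd h2 hcx.not_gt
        · exact Or.inr ⟨h2, Finset.mem_of_mem_erase h3⟩
      · simp [mem_crossAhead, hcx.le]
    obtain ⟨A, hA, hjA⟩ := ih _ (hN ▸ Finset.card_lt_card hss) ((T.edge_of_tile hm).2)
      (by rw [mem_crossAhead] at hl ⊢; simpa [Ne.symm hcl] using hl)
      (fun h1 => hj (hss.1 h1)) rfl
    exact ⟨A, hA, by rw [hjA]; simp [hjc]⟩
  · rw [mem_crossAhead, hend] at hl
    exact absurd hl (by simp; intro h; exact h.le)

theorem Tiling.Edge.exists_crossing_left (ha : StrictMono a) {T : Tiling a}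
    {S : Finset (Fin n)} {x : Fin n} (h : T.Edge S x) {l j : Fin n} (hl : l ∈ crossBehind x S)
    (hj : j ∉ crossBehind x S) (hjx : j ≠ x) :
    ∃ A, (A, {l, x}) ∈ T.tiles ∧ (j ∈ A ↔ j ∈ S) := by
  induction hN : (crossBehind x S).card using Nat.strong_induction_on generalizing S with
  | _ N ih =>
  have hx := h.1
  have hlx : l ≠ x := by
    rintro rfl
    simp [mem_crossBehind] at hl
  rcases h.left ha with ⟨m, hxm, hm⟩ | ⟨c, hc, hcx, hm⟩ | hend
  · by_cases hml : m = l
    · subst hml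
      exact ⟨S, hm, Iff.rfl⟩
    have h1 : m ∈ crossBehind x S := mem_crossBehind.2 (Or.inr ⟨hxm, (T.notMem_of_tile hm).1⟩)
    have hjm : j ≠ m := by rintro rfl; exact hj h1
    have hss : crossBehind x (insert m S) ⊂ crossBehind x S := by
      refine (Finset.ssubset_iff_of_subset fun y hy => ?_).2 ⟨m, h1, ?_⟩
      · rw [mem_crossBehind] at hy ⊢
        rcases hy with ⟨h2, h3⟩ | ⟨h2, h3⟩
        · refine Or.inl ⟨h2, (Finset.mem_insert.1 h3).resolve_left ?_⟩
          rintro rfl; exact absurd h2 hxm.not_gt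
        · simp only [Finset.mem_insert, not_or] at h3; exact Or.inr ⟨h2, h3.2⟩
      · simp [mem_crossBehind, hxm.le]
    obtain ⟨A, hA, hjA⟩ := ih _ (hN ▸ Finset.card_lt_card hss)
      ((T.edge_insert_of_tile hxm.ne hm).2)
      (by rw [mem_crossBehind] at hl ⊢; simpa [Ne.symm hml] using hl)
      (fun h1 => hj (hss.1 h1)) rfl
    exact ⟨A, hA, by rw [hjA]; simp [hjm]⟩
  · have h1 : c ∈ crossBehind x S := mem_crossBehind.2 (Or.inl ⟨hcx, hc⟩)
    have hjc : j ≠ c := by rintro rfl; exact hj h1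
    by_cases hcl : c = l
    · subst hcl
      exact ⟨S.erase c, by rwa [Finset.pair_comm], by simp [hjc]⟩
    have hss : crossBehind x (S.erase c) ⊂ crossBehind x S := by
      refine (Finset.ssubset_iff_of_subset fun y hy => ?_).2 ⟨c, h1, ?_⟩
      · rw [mem_crossBehind] at hy ⊢
        rcases hy with ⟨h2, h3⟩ | ⟨h2, h3⟩
        · exact Or.inl ⟨h2, Finset.mem_of_mem_erase h3⟩
        · refine Or.inr ⟨h2, fun h4 => h3 (Finset.mem_erase.2 ⟨?_, h4⟩)⟩
          rintro rfl; exact absurd h2 hcx.not_gt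
      · simp [mem_crossBehind, hcx.le]
    obtain ⟨A, hA, hjA⟩ := ih _ (hN ▸ Finset.card_lt_card hss) ((T.edge_of_tile hm).1)
      (by rw [mem_crossBehind] at hl ⊢; simpa [Ne.symm hcl] using hl)
      (fun h1 => hj (hss.1 h1)) rfl
    exact ⟨A, hA, by rw [hjA]; simp [hjc]⟩
  · rw [mem_crossBehind, hend] at hl
    exact absurd hl (by simp; intro h; exact h.le)

/-- Walking left from any edge of the strip of `x` ends at the left boundary edge, where `S`
consists of the elements below `x`. So the strip is a single path, which may be traversed from
there. -/
theorem Tiling.Edge.reachable (ha : StrictMono a) {T : Tiling a}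
    {S : Finset (Fin n)} {x : Fin n} (h : T.Edge S x) :
    Relation.ReflTransGen (T.ZoneStep x) (Finset.univ.filter (· < x)) S := by
  induction hN : (crossBehind x S).card using Nat.strong_induction_on generalizing S with
  | _ N ih =>
  have hx := h.1
  rcases h.left ha with ⟨m, hxm, hm⟩ | ⟨c, hc, hcx, hm⟩ | hend
  · have hmS := (T.notMem_of_tile hm).1
    have h1 : m ∈ crossBehind x S := mem_crossBehind.2 (Or.inr ⟨hxm, hmS⟩)
    have hss : crossBehind x (insert m S) ⊂ crossBehind x S := by
      refine (Finset.ssubset_iff_of_subset fun y hy => ?_).2 ⟨m, h1, ?_⟩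
      · rw [mem_crossBehind] at hy ⊢
        rcases hy with ⟨h2, h3⟩ | ⟨h2, h3⟩
        · refine Or.inl ⟨h2, (Finset.mem_insert.1 h3).resolve_left ?_⟩
          rintro rfl; exact absurd h2 hxm.not_gt
        · simp only [Finset.mem_insert, not_or] at h3; exact Or.inr ⟨h2, h3.2⟩
      · simp [mem_crossBehind, hxm.le]
    have he := (T.edge_insert_of_tile hxm.ne hm).2
    refine (ih _ (hN ▸ Finset.card_lt_card hss) he rfl).tail (Or.inr ⟨m, by simp, hxm, he.1, ?_, ?_⟩)
    · rwa [Finset.erase_insert hmS]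
    · rw [Finset.erase_insert hmS]
  · have h1 : c ∈ crossBehind x S := mem_crossBehind.2 (Or.inl ⟨hcx, hc⟩)
    have hss : crossBehind x (S.erase c) ⊂ crossBehind x S := by
      refine (Finset.ssubset_iff_of_subset fun y hy => ?_).2 ⟨c, h1, ?_⟩
      · rw [mem_crossBehind] at hy ⊢
        rcases hy with ⟨h2, h3⟩ | ⟨h2, h3⟩
        · exact Or.inl ⟨h2, Finset.mem_of_mem_erase h3⟩
        · refine Or.inr ⟨h2, fun h4 => h3 (Finset.mem_erase.2 ⟨?_, h4⟩)⟩
          rintro rfl; exact absurd h2 hcx.not_gt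
      · simp [mem_crossBehind, hcx.le]
    refine (ih _ (hN ▸ Finset.card_lt_card hss) ((T.edge_of_tile hm).1) rfl).tail
      (Or.inl ⟨c, hcx, hm, (Finset.insert_erase hc).symm⟩)
  · have : S = Finset.univ.filter (· < x) := by ext m; simp [hend]
    rw [this]

/-- On the way to the right, indices above `x` are only added and indices below `x` only removed. -/
theorem Tiling.ZoneStep.mem_of_mem {T : Tiling a} {x l : Fin n} (hl : x < l)
    {S S' : Finset (Fin n)} (h : Relation.ReflTransGen (T.ZoneStep x) S S') (hS : l ∈ S) :
    l ∈ S' := by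
  induction h with
  | refl => exact hS
  | tail _ hstep ih =>
    rcases hstep with ⟨m, _, _, rfl⟩ | ⟨c, _, hc, _, _, rfl⟩
    · exact Finset.mem_insert_of_mem ih
    · exact Finset.mem_erase.2 ⟨(hc.trans hl).ne', ih⟩

/-- Two pseudolines cross at most once. Both tiles lie on the one path through the strip of `i`;
after the first of them `l` belongs to the translation for good, so `l` cannot be free again. -/
theorem Tiling.tile_unique (ha : StrictMono a) (T : Tiling a) {A A' : Finset (Fin n)}
    {i l : Fin n} (hil : i < l) (h : (A, {i, l}) ∈ T.tiles) (h' : (A', {i, l}) ∈ T.tiles) :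
    A = A' := by
  have key : ∀ {A A'}, (A, {i, l}) ∈ T.tiles → (A', {i, l}) ∈ T.tiles →
      Relation.ReflTransGen (T.ZoneStep i) A A' → A = A' := by
    intro A A' h h' hr
    rcases hr.cases_head with rfl | ⟨S, hs, hr⟩
    · rfl
    obtain rfl := T.zoneStep_rightUnique ha i hs (Or.inl ⟨l, hil, h, rfl⟩)
    exact absurd (Tiling.ZoneStep.mem_of_mem hil hr (by simp)) (T.notMem_of_tile h').2
  rcases Relation.ReflTransGen.total_of_right_unique (T.zoneStep_rightUnique ha i)
    ((T.edge_of_tile h).1.reachable ha) ((T.edge_of_tile h').1.reachable ha) with hr | hr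
  · exact key h h' hr
  · exact (key h' h hr).symm

/-! ### Vertices orient triples consistently -/

/-- A vertex other than the empty and the full set is the left or right corner of some tile, and
both corners have an edge up and an edge down. -/
theorem Tiling.exists_edges_of_vertex (ha : StrictMono a) (T : Tiling a) {S : Finset (Fin n)}
    (hS : S ∈ T.vertices) :
    (S ≠ Finset.univ → ∃ x, T.Edge S x) ∧ (S ≠ ∅ → ∃ x ∈ S, T.Edge (S.erase x) x) := by
  have hmain : S ≠ Finset.univ → S ≠ ∅ → (∃ x, T.Edge S x) ∧ ∃ x ∈ S, T.Edge (S.erase x) x := by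
    intro h1 h0
    obtain ⟨p, hp⟩ := Finset.nonempty_iff_ne_empty.2 h0
    obtain ⟨q, hq⟩ : ∃ q, q ∉ S := by
      by_contra! hcon
      exact h1 (Finset.eq_univ_iff_forall.2 hcon)
    rcases lt_trichotomy p q with h | h | h
    · obtain ⟨A, i, j, hij, rfl, ht⟩ := T.exists_succ ha hS h hp hq
      refine ⟨⟨j, (T.edge_insert_of_tile hij.ne ht).2⟩, i, by simp, ?_⟩
      rw [Finset.erase_insert (T.notMem_of_tile ht).1]
      exact (T.edge_of_tile ht).1
    · exact absurd (h ▸ hp) hq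
    · obtain ⟨A, i, j, hij, rfl, ht⟩ := T.exists_pred ha hS h hp hq
      refine ⟨⟨i, (T.edge_insert_of_tile hij.ne ht).1⟩, j, by simp, ?_⟩
      rw [Finset.erase_insert (T.notMem_of_tile ht).2]
      exact (T.edge_of_tile ht).2
  obtain ⟨⟨A, B⟩, ht, h1, h2⟩ := id hS
  obtain ⟨i, j, hij, hB⟩ := Finset.card_eq_two.1 (T.card_eq_two _ ht)
  simp only at hB h1 h2
  subst hB
  constructor
  · intro h
    by_cases h0 : S = ∅
    · subst h0
      obtain rfl : A = ∅ := Finset.subset_empty.1 h1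
      exact ⟨i, (T.edge_of_tile ht).1⟩
    · exact (hmain h h0).1
  · intro h
    by_cases h0 : S = Finset.univ
    · subst h0
      refine ⟨i, by simp, ?_⟩
      have : Finset.univ.erase i = insert j A := by
        have hi := (T.notMem_of_tile ht).1
        ext m
        have := h2 (Finset.mem_univ m)
        simp only [Finset.mem_union, Finset.mem_insert, Finset.mem_singleton, Finset.mem_erase,
          Finset.mem_univ, and_true] at *
        grind
      rw [this]
      exact (T.edge_insert_of_tile hij ht).1
    · exact (hmain h0 h).2

/-- Climb along edges until `i` or `l` is about to be added. The strip of that index crosses the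
other one further on, without crossing `j`. With `Tiling.tile_unique` this shows that no two
vertices orient the triple oppositely. -/
theorem Tiling.exists_tile_of_middle_mem (ha : StrictMono a) (T : Tiling a) {S : Finset (Fin n)}
    (hS : S ∈ T.vertices) {i j l : Fin n} (hij : i < j) (hjl : j < l) (hi : i ∉ S) (hj : j ∈ S)
    (hl : l ∉ S) : ∃ A, (A, {i, l}) ∈ T.tiles ∧ j ∈ A := by
  induction hN : Sᶜ.card using Nat.strong_induction_on generalizing S with
  | _ N ih =>
  obtain ⟨x, hx⟩ := (T.exists_edges_of_vertex ha hS).1 (by rintro rfl; exact hi (by simp))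
  by_cases hxi : x = i
  · subst hxi
    obtain ⟨A, h1, h2⟩ := hx.exists_crossing_right ha (l := l) (j := j)
      (mem_crossAhead.2 (Or.inl ⟨hij.trans hjl, hl⟩))
      (by rw [mem_crossAhead]; simp [hj, hij.le]) hij.ne'
    exact ⟨A, h1, h2.2 hj⟩
  by_cases hxl : x = l
  · subst hxl
    obtain ⟨A, h1, h2⟩ := hx.exists_crossing_left ha (l := i) (j := j)
      (mem_crossBehind.2 (Or.inr ⟨hij.trans hjl, hi⟩))
      (by rw [mem_crossBehind]; simp [hj, hjl.le]) hjl.ne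
    exact ⟨A, h1, h2.2 hj⟩
  refine ih _ ?_ hx.vertex.2 (by simp [hi, Ne.symm hxi]) (by simp [hj])
    (by simp [hl, Ne.symm hxl]) rfl
  rw [← hN]
  apply Finset.card_lt_card
  rw [Finset.ssubset_iff_of_subset (Finset.compl_subset_compl.2 (Finset.subset_insert _ _))]
  exact ⟨x, by simp [hx.1], by simp⟩

theorem Tiling.exists_tile_of_middle_notMem (ha : StrictMono a) (T : Tiling a)
    {S : Finset (Fin n)} (hS : S ∈ T.vertices) {i j l : Fin n} (hij : i < j) (hjl : j < l)
    (hi : i ∈ S) (hj : j ∉ S) (hl : l ∈ S) : ∃ A, (A, {i, l}) ∈ T.tiles ∧ j ∉ A := by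
  induction hN : S.card using Nat.strong_induction_on generalizing S with
  | _ N ih =>
  obtain ⟨x, hxS, hx⟩ := (T.exists_edges_of_vertex ha hS).2 (by rintro rfl; simp at hi)
  by_cases hxi : x = i
  · subst hxi
    obtain ⟨A, h1, h2⟩ := hx.exists_crossing_left ha (l := l) (j := j)
      (mem_crossBehind.2 (Or.inl ⟨hij.trans hjl, by simp [hl, (hij.trans hjl).ne']⟩))
      (by rw [mem_crossBehind]; simp [hj, hij.le]) hij.ne'
    exact ⟨A, by rwa [Finset.pair_comm], fun h => hj (Finset.mem_of_mem_erase (h2.1 h))⟩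
  by_cases hxl : x = l
  · subst hxl
    obtain ⟨A, h1, h2⟩ := hx.exists_crossing_right ha (l := i) (j := j)
      (mem_crossAhead.2 (Or.inr ⟨hij.trans hjl, by simp [hi, (hij.trans hjl).ne]⟩))
      (by rw [mem_crossAhead]; simp [hj, hjl.le]) hjl.ne
    exact ⟨A, by rwa [Finset.pair_comm], fun h => hj (Finset.mem_of_mem_erase (h2.1 h))⟩
  refine ih _ ?_ hx.vertex.1 (by simp [hi, Ne.symm hxi]) (by simp [hj])
    (by simp [hl, Ne.symm hxl]) rfl
  rw [← hN]
  exact Finset.card_erase_lt_of_mem hxS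

/-! ### Hexagons -/

/-- The tiles of the tiling of a hexagon that has the interior vertex `A ∪ {j}`. -/
def lowerTiles (A : Finset (Fin n)) (i j l : Fin n) : Finset (Finset (Fin n) × Finset (Fin n)) :=
  {(A, {i, j}), (A, {j, l}), (insert j A, {i, l})}

/-- The tiles of the tiling of a hexagon that has the interior vertex `A ∪ {i, l}`. -/
def upperTiles (A : Finset (Fin n)) (i j l : Fin n) : Finset (Finset (Fin n) × Finset (Fin n)) :=
  {(insert i A, {j, l}), (insert l A, {i, j}), (A, {i, l})}

/-- The indices `i < j < l` span a hexagon that can be translated by `A`. -/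
structure IsHexagon (A : Finset (Fin n)) (i j l : Fin n) : Prop where
  lt₁ : i < j
  lt₂ : j < l
  notMem₁ : i ∉ A
  notMem₂ : j ∉ A
  notMem₃ : l ∉ A

/-- The linear relation between `v_i`, `v_j` and `v_l`, positive at `i` and `l`. -/
def relation (a : Fin n → ℝ) (i j l : Fin n) : Fin n → ℝ :=
  Pi.single i (a l - a j) + Pi.single j (a i - a l) + Pi.single l (a j - a i)

theorem relation_fst {i j l : Fin n} (hij : i < j) (hjl : j < l) :
    relation a i j l i = a l - a j := by
  simp [relation, hij.ne, (hij.trans hjl).ne]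

theorem relation_snd {i j l : Fin n} (hij : i < j) (hjl : j < l) :
    relation a i j l j = a i - a l := by
  simp [relation, hij.ne', hjl.ne]

theorem relation_trd {i j l : Fin n} (hij : i < j) (hjl : j < l) :
    relation a i j l l = a j - a i := by
  simp [relation, hjl.ne', (hij.trans hjl).ne']

theorem relation_of_ne {i j l m : Fin n} (hi : m ≠ i) (hj : m ≠ j) (hl : m ≠ l) :
    relation a i j l m = 0 := by
  simp [relation, hi, hj, hl]

theorem proj_relation (i j l : Fin n) : proj a (relation a i j l) = 0 := by
  rw [proj_apply, Prod.mk_eq_zero]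
  constructor
  · simp [relation, add_mul, Finset.sum_add_distrib, Pi.single_apply]
    ring
  · simp [relation, Finset.sum_add_distrib]

theorem proj_add_relation (x : Fin n → ℝ) (c : ℝ) (i j l : Fin n) :
    proj a (x + c • relation a i j l) = proj a x := by
  rw [map_add, map_smul, proj_relation, smul_zero, add_zero]

/-- On three coordinates the kernel of `π` is the line spanned by `relation`. The multiple is read
off at `i`, and independence of `v_j` and `v_l` does the rest. -/
theorem eq_add_relation (ha : StrictMono a) {i j l : Fin n} (hij : i < j) (hjl : j < l)
    {x y : Fin n → ℝ} (hoff : ∀ m, m ≠ i → m ≠ j → m ≠ l → y m = x m)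
    (h : proj a y = proj a x) : ∃ c : ℝ, y = x + c • relation a i j l := by
  have h0 : a l - a j ≠ 0 := (sub_pos.2 (ha hjl)).ne'
  obtain ⟨c, hc⟩ : ∃ c, c * (a l - a j) = y i - x i := ⟨(y i - x i) / (a l - a j), by field_simp⟩
  refine ⟨c, ?_⟩
  have hoff' : ∀ m, m ≠ j → m ≠ l → y m = (x + c • relation a i j l) m := by
    intro m hj hl
    by_cases hi : m = i
    · subst hi
      simp [relation_fst hij hjl, hc]
    · simp [relation_of_ne hi hj hl, hoff m hi hj hl]
  have hp := proj_sub_of_support_pair (a := a) hjl.ne hoff'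
  rw [proj_add_relation, h, sub_self, eq_comm, Prod.mk_eq_zero] at hp
  obtain ⟨h1, h2⟩ := hp
  have h3 : (y l - (x + c • relation a i j l) l) * (a l - a j) = 0 := by
    linear_combination h1 - a j * h2
  have h4 := (mul_eq_zero.1 h3).resolve_right h0
  funext m
  by_cases hj : m = j
  · subst hj; linarith
  by_cases hl : m = l
  · subst hl; linarith
  exact hoff' m hj hl

theorem add_relation_mem {A : Finset (Fin n)} {i j l : Fin n} (hH : IsHexagon A i j l)
    {x : Fin n → ℝ} (hx : x ∈ cubeFace A {i, j, l}) {c : ℝ}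
    (hi : 0 ≤ x i + c * (a l - a j) ∧ x i + c * (a l - a j) ≤ 1)
    (hj : 0 ≤ x j + c * (a i - a l) ∧ x j + c * (a i - a l) ≤ 1)
    (hl : 0 ≤ x l + c * (a j - a i) ∧ x l + c * (a j - a i) ≤ 1) :
    x + c • relation a i j l ∈ cubeFace A {i, j, l} := by
  have hoff : ∀ m, m ∉ ({i, j, l} : Finset (Fin n)) →
      (x + c • relation a i j l) m = x m := by
    intro m hm
    simp only [Finset.mem_insert, Finset.mem_singleton, not_or] at hm
    simp [relation_of_ne hm.1 hm.2.1 hm.2.2]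
  refine ⟨fun m => ?_, fun m hm => ?_, fun m hm => ?_⟩
  · by_cases hmi : m = i
    · subst hmi; simpa [relation_fst hH.lt₁ hH.lt₂] using hi
    by_cases hmj : m = j
    · subst hmj; simpa [relation_snd hH.lt₁ hH.lt₂] using hj
    by_cases hml : m = l
    · subst hml; simpa [relation_trd hH.lt₁ hH.lt₂] using hl
    rw [hoff m (by simp [hmi, hmj, hml])]
    exact hx.1 m
  · rw [hoff m, hx.2.1 m hm]
    simp only [Finset.mem_insert, Finset.mem_singleton, not_or]
    refine ⟨?_, ?_, ?_⟩ <;> rintro rfl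
    exacts [hH.notMem₁ hm, hH.notMem₂ hm, hH.notMem₃ hm]
  · rw [hoff m (fun h => hm (by simp only [Finset.mem_union, h, or_true])), hx.2.2 m hm]

/-- The fibre of the cube over a point of the hexagon is a segment in direction `relation`. At its
upper end a coordinate `i` or `l` has grown to `1`, or `j` has dropped to `0`. -/
theorem exists_upper_lift (ha : StrictMono a) {A : Finset (Fin n)} {i j l : Fin n}
    (hH : IsHexagon A i j l) {x : Fin n → ℝ} (hx : x ∈ cubeFace A {i, j, l}) :
    ∃ y ∈ cubeFace A {i, j, l}, proj a y = proj a x ∧ (y i = 1 ∨ y l = 1 ∨ y j = 0) := by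
  have h1 : 0 < a l - a j := sub_pos.2 (ha hH.lt₂)
  have h2 : 0 < a j - a i := sub_pos.2 (ha hH.lt₁)
  have h3 : 0 < a l - a i := by linarith
  have hc := hx.1
  obtain ⟨c, hc0, c1, c2, c3, hc4⟩ : ∃ c : ℝ, 0 ≤ c ∧ c * (a l - a j) ≤ 1 - x i ∧
      c * (a j - a i) ≤ 1 - x l ∧ c * (a l - a i) ≤ x j ∧ (c * (a l - a j) = 1 - x i ∨
      c * (a j - a i) = 1 - x l ∨ c * (a l - a i) = x j) := by
    -- The largest multiple permitted by the three coordinates.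
    refine ⟨min ((1 - x i) / (a l - a j)) (min ((1 - x l) / (a j - a i)) (x j / (a l - a i))),
      ?_, ?_, ?_, ?_, ?_⟩
    · exact le_min (div_nonneg (by linarith [(hc i).2]) h1.le)
        (le_min (div_nonneg (by linarith [(hc l).2]) h2.le) (div_nonneg (hc j).1 h3.le))
    · exact (le_div_iff₀ h1).1 (min_le_left _ _)
    · exact (le_div_iff₀ h2).1 ((min_le_right _ _).trans (min_le_left _ _))
    · exact (le_div_iff₀ h3).1 ((min_le_right _ _).trans (min_le_right _ _))
    · rcases min_choice ((1 - x i) / (a l - a j))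
        (min ((1 - x l) / (a j - a i)) (x j / (a l - a i))) with h | h
      · left; rw [h]; field_simp
      · rw [h]
        rcases min_choice ((1 - x l) / (a j - a i)) (x j / (a l - a i)) with h' | h'
        · right; left; rw [h']; field_simp
        · right; right; rw [h']; field_simp
  have p1 := mul_nonneg hc0 h1.le
  have p2 := mul_nonneg hc0 h2.le
  have p3 := mul_nonneg hc0 h3.le
  refine ⟨x + c • relation a i j l, add_relation_mem hH hx ?_ ?_ ?_, proj_add_relation _ _ _ _ _,
    ?_⟩
  · constructor <;> linarith [(hc i).1]
  · constructor <;> linarith [(hc j).2]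
  · constructor <;> linarith [(hc l).1]
  · simp only [Pi.add_apply, Pi.smul_apply, smul_eq_mul, relation_fst hH.lt₁ hH.lt₂,
      relation_snd hH.lt₁ hH.lt₂, relation_trd hH.lt₁ hH.lt₂]
    rcases hc4 with h | h | h
    · left; linarith
    · right; left; linarith
    · right; right; linarith

theorem exists_lower_lift (ha : StrictMono a) {A : Finset (Fin n)} {i j l : Fin n}
    (hH : IsHexagon A i j l) {x : Fin n → ℝ} (hx : x ∈ cubeFace A {i, j, l}) :
    ∃ y ∈ cubeFace A {i, j, l}, proj a y = proj a x ∧ (y i = 0 ∨ y l = 0 ∨ y j = 1) := by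
  have h1 : 0 < a l - a j := sub_pos.2 (ha hH.lt₂)
  have h2 : 0 < a j - a i := sub_pos.2 (ha hH.lt₁)
  have h3 : 0 < a l - a i := by linarith
  have hc := hx.1
  obtain ⟨c, hc0, c1, c2, c3, hc4⟩ : ∃ c : ℝ, 0 ≤ c ∧ c * (a l - a j) ≤ x i ∧
      c * (a j - a i) ≤ x l ∧ c * (a l - a i) ≤ 1 - x j ∧ (c * (a l - a j) = x i ∨
      c * (a j - a i) = x l ∨ c * (a l - a i) = 1 - x j) := by
    refine ⟨min (x i / (a l - a j)) (min (x l / (a j - a i)) ((1 - x j) / (a l - a i))),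
      ?_, ?_, ?_, ?_, ?_⟩
    · exact le_min (div_nonneg (hc i).1 h1.le)
        (le_min (div_nonneg (hc l).1 h2.le) (div_nonneg (by linarith [(hc j).2]) h3.le))
    · exact (le_div_iff₀ h1).1 (min_le_left _ _)
    · exact (le_div_iff₀ h2).1 ((min_le_right _ _).trans (min_le_left _ _))
    · exact (le_div_iff₀ h3).1 ((min_le_right _ _).trans (min_le_right _ _))
    · rcases min_choice (x i / (a l - a j))
        (min (x l / (a j - a i)) ((1 - x j) / (a l - a i))) with h | h
      · left; rw [h]; field_simp
      · rw [h]
        rcases min_choice (x l / (a j - a i)) ((1 - x j) / (a l - a i)) with h' | h'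
        · right; left; rw [h']; field_simp
        · right; right; rw [h']; field_simp
  have p1 := mul_nonneg hc0 h1.le
  have p2 := mul_nonneg hc0 h2.le
  have p3 := mul_nonneg hc0 h3.le
  refine ⟨x + (-c) • relation a i j l, add_relation_mem hH hx ?_ ?_ ?_,
    proj_add_relation _ _ _ _ _, ?_⟩
  · constructor <;> linarith [(hc i).2]
  · constructor <;> linarith [(hc j).1]
  · constructor <;> linarith [(hc l).2]
  · simp only [Pi.add_apply, Pi.smul_apply, smul_eq_mul, relation_fst hH.lt₁ hH.lt₂,
      relation_snd hH.lt₁ hH.lt₂, relation_trd hH.lt₁ hH.lt₂]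
    rcases hc4 with h | h | h
    · left; linarith
    · right; left; linarith
    · right; right; linarith

theorem upper_lift_unique (ha : StrictMono a) {A : Finset (Fin n)} {i j l : Fin n}
    (hH : IsHexagon A i j l) {x y : Fin n → ℝ} (hx : x ∈ cubeFace A {i, j, l})
    (hy : y ∈ cubeFace A {i, j, l}) (hx' : x i = 1 ∨ x l = 1 ∨ x j = 0)
    (hy' : y i = 1 ∨ y l = 1 ∨ y j = 0) (h : proj a x = proj a y) : x = y := by
  have h1 : 0 < a l - a j := sub_pos.2 (ha hH.lt₂)
  have h2 : 0 < a j - a i := sub_pos.2 (ha hH.lt₁)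
  have h3 : 0 < a l - a i := by linarith
  obtain ⟨c, rfl⟩ := eq_add_relation ha hH.lt₁ hH.lt₂ (y := x) (x := y) (fun m h1 h2 h3 =>
    eq_off_of_mem_cubeFace hx hy (by simp [h1, h2, h3])) h
  have cx := hx.1
  have cy := hy.1
  have ci := cx i
  have cj := cx j
  have cl := cx l
  simp only [Pi.add_apply, Pi.smul_apply, smul_eq_mul, relation_fst hH.lt₁ hH.lt₂,
    relation_snd hH.lt₁ hH.lt₂, relation_trd hH.lt₁ hH.lt₂] at hx' ci cj cl
  rcases lt_trichotomy c 0 with hc | hc | hc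
  · have p1 := mul_neg_of_neg_of_pos hc h1
    have p2 := mul_neg_of_neg_of_pos hc h2
    have p3 := mul_neg_of_neg_of_pos hc h3
    rcases hx' with h | h | h
    · linarith [(cy i).2]
    · linarith [(cy l).2]
    · linarith [(cy j).1]
  · simp [hc]
  · have p1 := mul_pos hc h1
    have p2 := mul_pos hc h2
    have p3 := mul_pos hc h3
    rcases hy' with h | h | h
    · linarith
    · linarith
    · linarith

theorem cubeFace_hexagon {A A' B' : Finset (Fin n)} {i j l : Fin n} (hA : A ⊆ A')
    (hB : A' ∪ B' ⊆ A ∪ {i, j, l}) {x : Fin n → ℝ} (hx : x ∈ cubeFace A' B') :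
    x ∈ cubeFace A {i, j, l} :=
  ⟨hx.1, fun m hm => hx.2.1 m (hA hm), fun m hm => hx.2.2 m fun h => hm (hB h)⟩

theorem mem_lower_iff {A : Finset (Fin n)} {i j l : Fin n} (hH : IsHexagon A i j l)
    {x : Fin n → ℝ} : (∃ t ∈ lowerTiles A i j l, x ∈ cubeFace t.1 t.2) ↔
      x ∈ cubeFace A {i, j, l} ∧ (x i = 0 ∨ x l = 0 ∨ x j = 1) := by
  obtain ⟨hij, hjl, hi, hj, hl⟩ := hH
  simp only [lowerTiles, Finset.mem_insert, Finset.mem_singleton, exists_eq_or_imp,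
    exists_eq_left]
  constructor
  · rintro (h | h | h)
    · refine ⟨cubeFace_hexagon subset_rfl (by grind) h, Or.inr (Or.inl (h.2.2 l ?_))⟩
      simp [hl, hjl.ne', (hij.trans hjl).ne']
    · refine ⟨cubeFace_hexagon subset_rfl (by grind) h, Or.inl (h.2.2 i ?_)⟩
      simp [hi, hij.ne, (hij.trans hjl).ne]
    · exact ⟨cubeFace_hexagon (by grind) (by grind) h, Or.inr (Or.inr (h.2.1 j (by simp)))⟩
  · rintro ⟨h, h' | h' | h'⟩
    · refine Or.inr (Or.inl ⟨h.1, h.2.1, fun m hm => ?_⟩)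
      by_cases hmi : m = i
      · rwa [hmi]
      · exact h.2.2 m (by grind)
    · refine Or.inl ⟨h.1, h.2.1, fun m hm => ?_⟩
      by_cases hmi : m = l
      · rwa [hmi]
      · exact h.2.2 m (by grind)
    · refine Or.inr (Or.inr ⟨h.1, fun m hm => ?_, fun m hm => h.2.2 m (by grind)⟩)
      rcases Finset.mem_insert.1 hm with rfl | hm
      exacts [h', h.2.1 m hm]

theorem mem_upper_iff {A : Finset (Fin n)} {i j l : Fin n} (hH : IsHexagon A i j l)
    {x : Fin n → ℝ} : (∃ t ∈ upperTiles A i j l, x ∈ cubeFace t.1 t.2) ↔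
      x ∈ cubeFace A {i, j, l} ∧ (x i = 1 ∨ x l = 1 ∨ x j = 0) := by
  obtain ⟨hij, hjl, hi, hj, hl⟩ := hH
  simp only [upperTiles, Finset.mem_insert, Finset.mem_singleton, exists_eq_or_imp,
    exists_eq_left]
  constructor
  · rintro (h | h | h)
    · exact ⟨cubeFace_hexagon (by grind) (by grind) h, Or.inl (h.2.1 i (by simp))⟩
    · exact ⟨cubeFace_hexagon (by grind) (by grind) h, Or.inr (Or.inl (h.2.1 l (by simp)))⟩
    · refine ⟨cubeFace_hexagon subset_rfl (by grind) h, Or.inr (Or.inr (h.2.2 j ?_))⟩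
      simp [hj, hjl.ne, hij.ne']
  · rintro ⟨h, h' | h' | h'⟩
    · refine Or.inl ⟨h.1, fun m hm => ?_, fun m hm => h.2.2 m (by grind)⟩
      rcases Finset.mem_insert.1 hm with rfl | hm
      exacts [h', h.2.1 m hm]
    · refine Or.inr (Or.inl ⟨h.1, fun m hm => ?_, fun m hm => h.2.2 m (by grind)⟩)
      rcases Finset.mem_insert.1 hm with rfl | hm
      exacts [h', h.2.1 m hm]
    · refine Or.inr (Or.inr ⟨h.1, h.2.1, fun m hm => ?_⟩)
      by_cases hmi : m = j
      · rwa [hmi]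
      · exact h.2.2 m (by grind)

/-! ### Existence of flips -/

theorem eq_of_generic_mem {s t : Finset (Fin n) × Finset (Fin n)} (hs : Disjoint s.1 s.2)
    (ht : Disjoint t.1 t.2) (hc : s.2.card = t.2.card) {x : Fin n → ℝ}
    (hxs : x ∈ cubeFace s.1 s.2) (hxt : x ∈ cubeFace t.1 t.2)
    (hgen : ∀ m ∈ t.2, 0 < x m ∧ x m < 1) : s = t := by
  have hB : t.2 = s.2 := by
    apply Finset.eq_of_subset_of_card_le _ hc.le
    intro m hm
    have := hgen m hm
    by_contra h
    by_cases hA : m ∈ s.1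
    · rw [hxs.2.1 m hA] at this; linarith
    · rw [hxs.2.2 m (by simp [h, hA])] at this; linarith
  refine Prod.ext ?_ hB.symm
  ext m
  rw [fst_eq_filter hs hxs, fst_eq_filter ht hxt, hB]

/-- A further tile can meet the cube over the hexagon only at upper ends of fibres. Otherwise nearby
generic points of that tile would still lie over the hexagon, so their lifts would lie in a lower
tile, and a generic point determines its face. -/
theorem Tiling.upper_of_mem_hexagon (ha : StrictMono a) (T : Tiling a) {A : Finset (Fin n)}
    {i j l : Fin n} (hH : IsHexagon A i j l) (hT : lowerTiles A i j l ⊆ T.tiles) {t}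
    (ht : t ∈ T.tiles) (htl : t ∉ lowerTiles A i j l) {y : Fin n → ℝ}
    (hyt : y ∈ cubeFace t.1 t.2) (hy : y ∈ cubeFace A {i, j, l}) :
    y i = 1 ∨ y l = 1 ∨ y j = 0 := by
  by_contra hcon
  push Not at hcon
  obtain ⟨y1, y2, y3⟩ := hcon
  have y1 : y i < 1 := lt_of_le_of_ne (hy.1 i).2 y1
  have y2 : y l < 1 := lt_of_le_of_ne (hy.1 l).2 y2
  have y3 : 0 < y j := lt_of_le_of_ne (hy.1 j).1 (Ne.symm y3)
  have hij := hH.lt₁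
  have hjl := hH.lt₂
  have h1 : 0 < a l - a j := sub_pos.2 (ha hjl)
  have h2 : 0 < a j - a i := sub_pos.2 (ha hij)
  have h3 : 0 < a l - a i := by linarith
  have hyc := hy.1
  -- Strictly below all three bounds, so that the raised point `z` has its coordinates `i`, `j`, `l`
  -- strictly between `0` and `1` and leaves room for a perturbation.
  obtain ⟨c, hc0, hc⟩ := exists_between (lt_min (div_pos (sub_pos.2 y1) h1)
    (lt_min (div_pos (sub_pos.2 y2) h2) (div_pos y3 h3)))
  simp only [lt_min_iff] at hc
  rw [lt_div_iff₀ h1, lt_div_iff₀ h2, lt_div_iff₀ h3] at hc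
  obtain ⟨c1, c2, c3⟩ := hc
  have p1 := mul_pos hc0 h1
  have p2 := mul_pos hc0 h2
  have p3 := mul_pos hc0 h3
  have ti := hyc i
  have tj := hyc j
  have tl := hyc l
  -- a direction in the tile `t` that leads to generic points
  set w : Fin n → ℝ := fun m => if m ∈ t.2 then 1 / 2 - y m else 0 with hw
  -- The vectors `v_i` and `v_j` span the plane, so the projection of `w` is also realised by a move
  -- in the coordinates `i` and `j` of the hexagon.
  obtain ⟨d, hdoff, hd⟩ : ∃ d : Fin n → ℝ, (∀ m, m ≠ i → m ≠ j → d m = 0) ∧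
      proj a d = proj a w := by
    set dj := ((proj a w).1 - (proj a w).2 * a i) / (a j - a i) with hdj
    refine ⟨Pi.single i ((proj a w).2 - dj) + Pi.single j dj, fun m h1 h2 => by simp [h1, h2], ?_⟩
    rw [proj_apply]
    ext
    · simp only [Pi.add_apply, add_mul, Finset.sum_add_distrib, Pi.single_apply, ite_mul, zero_mul,
        Finset.sum_ite_eq', Finset.mem_univ, if_true]
      rw [hdj]
      field_simp
      ring
    · simp [Finset.sum_add_distrib]
  set z : Fin n → ℝ := y + c • relation a i j l with hz
  have zi : z i = y i + c * (a l - a j) := by simp [hz, relation_fst hij hjl]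
  have zj : z j = y j + c * (a i - a l) := by simp [hz, relation_snd hij hjl]
  have zl : z l = y l + c * (a j - a i) := by simp [hz, relation_trd hij hjl]
  have hzmem : z ∈ cubeFace A {i, j, l} := add_relation_mem hH hy
    (by constructor <;> linarith) (by constructor <;> linarith) (by constructor <;> linarith)
  have hev : ∀ m, 0 < z m → z m < 1 →
      ∀ᶠ ε in nhdsWithin (0 : ℝ) (Set.Ioi 0), 0 < z m + ε * d m ∧ z m + ε * d m < 1 := by
    intro m hm0 hm1
    apply nhdsWithin_le_nhds
    have hcont : ContinuousAt (fun ε : ℝ => z m + ε * d m) 0 := by fun_prop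
    exact hcont.eventually_mem (Ioo_mem_nhds (by simpa using hm0) (by simpa using hm1))
  have hlt : ∀ᶠ ε in nhdsWithin (0 : ℝ) (Set.Ioi 0), ε < 1 :=
    nhdsWithin_le_nhds (Iio_mem_nhds one_pos)
  obtain ⟨ε, ⟨⟨⟨e1, e2⟩, e3⟩, e4⟩⟩ := ((((hev i (by linarith) (by linarith)).and
    (hev j (by linarith) (by linarith))).and hlt).and self_mem_nhdsWithin).exists
  have e4 : 0 < ε := e4
  have hx : z + ε • d ∈ cubeFace A {i, j, l} := by
    have hA : ∀ m, m ≠ i → m ≠ j → (z + ε • d) m = z m := by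
      intro m h1 h2
      simp [hdoff m h1 h2]
    refine ⟨fun m => ?_, fun m hm => ?_, fun m hm => ?_⟩
    · by_cases hmi : m = i
      · subst hmi; exact ⟨e1.1.le, e1.2.le⟩
      by_cases hmj : m = j
      · subst hmj; exact ⟨e2.1.le, e2.2.le⟩
      rw [hA m hmi hmj]
      exact hzmem.1 m
    · rw [hA m (by rintro rfl; exact hH.notMem₁ hm) (by rintro rfl; exact hH.notMem₂ hm)]
      exact hzmem.2.1 m hm
    · rw [hA m (by rintro rfl; simp at hm) (by rintro rfl; simp at hm)]
      exact hzmem.2.2 m hm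
  -- Lowering the perturbed point gives a lift in a lower tile over the same point as `y + ε • w`,
  -- which is a generic point of `t`.
  obtain ⟨x, hx, hxp, hxl⟩ := exists_lower_lift ha hH hx
  obtain ⟨u, hu, hxu⟩ := (mem_lower_iff hH).2 ⟨hx, hxl⟩
  have hyw : y + ε • w ∈ cubeFace t.1 t.2 := by
    refine ⟨fun m => ?_, fun m hm => ?_, fun m hm => ?_⟩
    · have := hyc m
      simp only [hw, Pi.add_apply, Pi.smul_apply, smul_eq_mul]
      split_ifs
      · constructor <;> nlinarith
      · simpa using this
    · have := Finset.disjoint_left.1 (T.disjoint t ht) hm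
      simp [hw, this, hyt.2.1 m hm]
    · have hm' : m ∉ t.2 := fun h => hm (by simp [h])
      simp [hw, hm', hyt.2.2 m hm]
  have hpe : proj a x = proj a (y + ε • w) := by
    rw [hxp, map_add, map_smul, hd, hz, proj_add_relation, map_add, map_smul]
  obtain rfl := T.lift_unique ha (hT hu) ht hxu hyw hpe
  refine htl (?_ : t ∈ _)
  rw [← eq_of_generic_mem (T.disjoint u (hT hu)) (T.disjoint t ht)
    ((T.card_eq_two u (hT hu)).trans (T.card_eq_two t ht).symm) hxu hyw ?_]
  · exact hu
  · intro m hm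
    have := hyc m
    simp only [hw, Pi.add_apply, Pi.smul_apply, smul_eq_mul, hm, if_true]
    constructor <;> nlinarith

/-- `T'` arises from `T` by exchanging the interior vertex `A ∪ {j}` of a hexagon for
`A ∪ {i, l}`. -/
structure RaisingFlip (T T' : Tiling a) (A : Finset (Fin n)) (i j l : Fin n) : Prop where
  hexagon : IsHexagon A i j l
  diff : T.tiles \ T'.tiles = lowerTiles A i j l
  diff' : T'.tiles \ T.tiles = upperTiles A i j l

theorem Tiling.exists_raisingFlip (ha : StrictMono a) (T : Tiling a) {A : Finset (Fin n)}
    {i j l : Fin n} (hij : i < j) (hjl : j < l) (h₁ : (A, {i, j}) ∈ T.tiles)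
    (h₂ : (A, {j, l}) ∈ T.tiles) (h₃ : (insert j A, {i, l}) ∈ T.tiles) :
    ∃ T' : Tiling a, RaisingFlip T T' A i j l := by
  classical
  obtain ⟨hi, hj⟩ := T.notMem_of_tile h₁
  have hl := (T.notMem_of_tile h₂).2
  have hil := hij.trans hjl
  have hH : IsHexagon A i j l := ⟨hij, hjl, hi, hj, hl⟩
  have hT : lowerTiles A i j l ⊆ T.tiles := by
    intro t ht
    simp only [lowerTiles, Finset.mem_insert, Finset.mem_singleton] at ht
    rcases ht with rfl | rfl | rfl <;> assumption
  -- The tiling already contains a tile with each of these pairs of free indices, with a different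
  -- translation.
  have hup : ∀ t ∈ upperTiles A i j l, t ∉ T.tiles := by
    intro t ht htT
    simp only [upperTiles, Finset.mem_insert, Finset.mem_singleton] at ht
    rcases ht with rfl | rfl | rfl
    · exact hi (by rw [T.tile_unique ha hjl h₂ htT]; simp)
    · exact hl (by rw [T.tile_unique ha hij h₁ htT]; simp)
    · exact hj (by rw [T.tile_unique ha hil htT h₃]; simp)
  have hmem : ∀ t, t ∈ (T.tiles \ lowerTiles A i j l) ∪ upperTiles A i j l ↔
      (t ∈ T.tiles ∧ t ∉ lowerTiles A i j l) ∨ t ∈ upperTiles A i j l := by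
    intro t; simp
  -- The lower lift of the point is its lift in `T`, hence equals `y`; by
  -- `Tiling.upper_of_mem_hexagon` it is an upper end as well, so the fibre is a single point.
  have hmix : ∀ t ∈ T.tiles, t ∉ lowerTiles A i j l → ∀ x y : Fin n → ℝ,
      y ∈ cubeFace t.1 t.2 → x ∈ cubeFace A {i, j, l} → (x i = 1 ∨ x l = 1 ∨ x j = 0) →
      proj a x = proj a y → x = y := by
    intro t ht htl x y hy hx hxu hxy
    obtain ⟨x', hx', hp, hlow⟩ := exists_lower_lift ha hH hx
    obtain ⟨u, hu, hxu'⟩ := (mem_lower_iff hH).2 ⟨hx', hlow⟩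
    obtain rfl := T.lift_unique ha (hT hu) ht hxu' hy (hp.trans hxy)
    exact upper_lift_unique ha hH hx hx' hxu (T.upper_of_mem_hexagon ha hH hT ht htl hy hx') hp.symm
  refine ⟨Tiling.ofLift a ((T.tiles \ lowerTiles A i j l) ∪ upperTiles A i j l) ?_ ?_ ?_ ?_, hH,
    ?_, ?_⟩
  · intro t ht
    rcases (hmem t).1 ht with ⟨h, _⟩ | h
    · exact T.disjoint t h
    · simp only [upperTiles, Finset.mem_insert, Finset.mem_singleton] at h
      rcases h with rfl | rfl | rfl <;> simp [hi, hj, hl, hij.ne', hjl.ne, hil.ne, hil.ne']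
  · intro t ht
    rcases (hmem t).1 ht with ⟨h, _⟩ | h
    · exact T.card_eq_two t h
    · simp only [upperTiles, Finset.mem_insert, Finset.mem_singleton] at h
      rcases h with rfl | rfl | rfl
      exacts [Finset.card_pair hjl.ne, Finset.card_pair hij.ne, Finset.card_pair hil.ne]
  · intro x hx
    obtain ⟨t, ht, y, hy, hyx⟩ := T.exists_lift hx
    by_cases htl : t ∈ lowerTiles A i j l
    · obtain ⟨z, hz, hzy, hzu⟩ := exists_upper_lift ha hH ((mem_lower_iff hH).1 ⟨t, htl, hy⟩).1
      obtain ⟨u, hu, hzu⟩ := (mem_upper_iff hH).2 ⟨hz, hzu⟩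
      exact ⟨u, (hmem u).2 (Or.inr hu), z, hzu, hzy.trans hyx⟩
    · exact ⟨t, (hmem t).2 (Or.inl ⟨ht, htl⟩), y, hy, hyx⟩
  · intro s hs t ht x hx y hy hxy
    rcases (hmem s).1 hs with ⟨hs, hsl⟩ | hs <;> rcases (hmem t).1 ht with ⟨ht, htl⟩ | ht
    · exact T.lift_unique ha hs ht hx hy hxy
    · obtain ⟨hy1, hy2⟩ := (mem_upper_iff hH).1 ⟨t, ht, hy⟩
      exact (hmix s hs hsl y x hx hy1 hy2 hxy.symm).symm
    · obtain ⟨hx1, hx2⟩ := (mem_upper_iff hH).1 ⟨s, hs, hx⟩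
      exact hmix t ht htl x y hy hx1 hx2 hxy
    · obtain ⟨hy1, hy2⟩ := (mem_upper_iff hH).1 ⟨t, ht, hy⟩
      obtain ⟨hx1, hx2⟩ := (mem_upper_iff hH).1 ⟨s, hs, hx⟩
      exact upper_lift_unique ha hH hx1 hy1 hx2 hy2 hxy
  · ext t
    have e1 := hup t
    have e2 := @hT t
    rw [Finset.mem_sdiff]
    change t ∈ T.tiles ∧ t ∉ (T.tiles \ lowerTiles A i j l) ∪ upperTiles A i j l ↔ _
    rw [hmem]
    tauto
  · ext t
    have e1 := hup t
    rw [Finset.mem_sdiff]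
    change t ∈ (T.tiles \ lowerTiles A i j l) ∪ upperTiles A i j l ∧ t ∉ T.tiles ↔ _
    rw [hmem]
    tauto

theorem RaisingFlip.mem_iff {T T' : Tiling a} {A : Finset (Fin n)} {i j l : Fin n}
    (h : RaisingFlip T T' A i j l) (t : Finset (Fin n) × Finset (Fin n)) :
    (t ∈ lowerTiles A i j l ∧ t ∈ T.tiles ∧ t ∉ T'.tiles) ∨
    (t ∈ upperTiles A i j l ∧ t ∉ T.tiles ∧ t ∈ T'.tiles) ∨
    (t ∉ lowerTiles A i j l ∧ t ∉ upperTiles A i j l ∧ (t ∈ T.tiles ↔ t ∈ T'.tiles)) := by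
  rw [← h.diff, ← h.diff', Finset.mem_sdiff, Finset.mem_sdiff]
  tauto

/-! ### The circuits of the configuration -/

theorem linearIndependent_liftVec_pair (ha : StrictMono a) {p q : Fin n} (hpq : p ≠ q)
    {s : Finset (Fin n)} (hs : s = {p, q}) :
    LinearIndependent ℝ (fun j : {j : Fin n // j ∈ s} => liftVec a j) := by
  have h : LinearIndepOn ℝ (liftVec a) (s : Set (Fin n)) := by
    rw [hs, Finset.coe_pair, LinearIndepOn.pair_iff _ hpq]
    intro c d h
    simp only [liftVec, Prod.smul_mk, smul_eq_mul, mul_one, Prod.mk_add_mk, Prod.mk_eq_zero] at h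
    obtain ⟨h1, h2⟩ := h
    have h3 : c * (a p - a q) = 0 := by linear_combination h1 - a q * h2
    have h4 : c = 0 := (mul_eq_zero.1 h3).resolve_right (sub_ne_zero.2 (ha.injective.ne hpq))
    exact ⟨h4, by linarith⟩
  exact h

theorem IsCircuit.swap {C : Finset (Fin n) × Finset (Fin n)} (h : IsCircuit a C) :
    IsCircuit a C.swap := by
  obtain ⟨h1, h2, h3, α, h4, h5, h6, h7⟩ := h
  refine ⟨h1.symm, ?_, ?_, -α, ?_, ?_, ?_, ?_⟩
  · simpa only [Prod.fst_swap, Prod.snd_swap, Finset.union_comm] using h2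
  · simp only [Prod.fst_swap, Prod.snd_swap]
    rw [Finset.union_comm]
    exact h3
  · intro i hi; have := h5 i hi; simpa using this
  · intro i hi; have := h4 i hi; simpa using this
  · intro i hi
    have := h6 i (by rwa [Finset.union_comm])
    simpa using this
  · simp only [Pi.neg_apply, neg_smul, Finset.sum_neg_distrib, h7, neg_zero]

theorem isCircuit_triple (ha : StrictMono a) {i j l : Fin n} (hij : i < j) (hjl : j < l) :
    IsCircuit a ({i, l}, {j}) := by
  have hil := hij.trans hjl
  have h1 : 0 < a l - a j := sub_pos.2 (ha hjl)
  have h2 : 0 < a j - a i := sub_pos.2 (ha hij)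
  have hU : ({i, l} ∪ {j} : Finset (Fin n)) = {i, j, l} := by grind
  refine ⟨by simp [hij.ne', hjl.ne], by simp, ?_, relation a i j l, ?_, ?_, ?_, ?_⟩
  · simp only [hU]
    intro x hx
    simp only [Finset.mem_insert, Finset.mem_singleton] at hx
    rcases hx with rfl | rfl | rfl
    · exact linearIndependent_liftVec_pair ha hjl.ne (by grind)
    · exact linearIndependent_liftVec_pair ha hil.ne (by grind)
    · exact linearIndependent_liftVec_pair ha hij.ne (by grind)
  · intro m hm
    simp only [Finset.mem_insert, Finset.mem_singleton] at hm
    rcases hm with rfl | rfl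
    · rwa [relation_fst hij hjl]
    · rwa [relation_trd hij hjl]
  · intro m hm
    simp only [Finset.mem_singleton] at hm
    subst hm
    rw [relation_snd hij hjl]
    linarith
  · intro m hm
    simp only [hU, Finset.mem_insert, Finset.mem_singleton, not_or] at hm
    exact relation_of_ne hm.1 hm.2.1 hm.2.2
  · have := proj_relation (a := a) i j l
    rwa [proj, Fintype.linearCombination_apply] at this

theorem exists_sorted_of_card_three {s : Finset (Fin n)} (h : s.card = 3) :
    ∃ i j l, i < j ∧ j < l ∧ s = {i, j, l} := by
  let e := s.orderEmbOfFin h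
  refine ⟨e 0, e 1, e 2, e.strictMono (by decide), e.strictMono (by decide), ?_⟩
  ext m
  have : m ∈ s ↔ m ∈ Set.range e := by
    rw [Finset.range_orderEmbOfFin]
    rfl
  rw [this]
  simp only [Set.mem_range, Finset.mem_insert, Finset.mem_singleton, Fin.exists_fin_succ]
  simp [eq_comm]

/-- The plane has dimension two, and at most two of the `v_i` are always independent, so the support
is a triple. Its middle element carries the sign opposite to the two outer ones. -/
theorem IsCircuit.exists_triple (ha : StrictMono a) {C : Finset (Fin n) × Finset (Fin n)}
    (h : IsCircuit a C) : ∃ i j l, i < j ∧ j < l ∧ (C = ({i, l}, {j}) ∨ C = ({j}, {i, l})) := by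
  obtain ⟨C₁, C₂⟩ := C
  obtain ⟨hd, ⟨x, hx⟩, hind, α, hpos, hneg, hzero, hsum⟩ := h
  simp only at *
  have hcard : (C₁ ∪ C₂).card ≤ 3 := by
    have h1 := (hind x hx).fintype_card_le_finrank
    simp only [Fintype.card_coe, Module.finrank_prod, Module.finrank_self,
      Finset.card_erase_of_mem hx] at h1
    omega
  have hrel : ∀ s : Finset (Fin n), C₁ ∪ C₂ = s →
      ∑ m ∈ s, α m * a m = 0 ∧ ∑ m ∈ s, α m = 0 := by
    rintro s rfl
    have h0 : proj a α = 0 := by rwa [proj, Fintype.linearCombination_apply]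
    rw [proj_apply, Prod.mk_eq_zero] at h0
    constructor
    · rw [← h0.1]
      exact Finset.sum_subset (Finset.subset_univ _) fun m _ hm => by rw [hzero m hm, zero_mul]
    · rw [← h0.2]
      exact Finset.sum_subset (Finset.subset_univ _) fun m _ hm => hzero m hm
  have hne : ∀ m ∈ C₁ ∪ C₂, α m ≠ 0 := by
    intro m hm
    rcases Finset.mem_union.1 hm with hm | hm
    exacts [(hpos m hm).ne', (hneg m hm).ne]
  have hpos' : ∀ m ∈ C₁ ∪ C₂, (m ∈ C₁ ↔ 0 < α m) := by
    intro m hm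
    refine ⟨hpos m, fun h => ?_⟩
    rcases Finset.mem_union.1 hm with hm | hm
    exacts [hm, absurd h (hneg m hm).not_gt]
  have hneg' : ∀ m ∈ C₁ ∪ C₂, (m ∈ C₂ ↔ α m < 0) := by
    intro m hm
    refine ⟨hneg m, fun h => ?_⟩
    rcases Finset.mem_union.1 hm with hm | hm
    exacts [absurd h (hpos m hm).not_gt, hm]
  have hcases : (C₁ ∪ C₂).card = 1 ∨ (C₁ ∪ C₂).card = 2 ∨ (C₁ ∪ C₂).card = 3 := by
    have := Finset.card_pos.2 ⟨x, hx⟩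
    omega
  rcases hcases with hc | hc | hc
  · obtain ⟨p, hp⟩ := Finset.card_eq_one.1 hc
    have := (hrel _ hp).2
    rw [Finset.sum_singleton] at this
    exact absurd this (hne p (by simp [hp]))
  · obtain ⟨p, q, hpq, hs⟩ := Finset.card_eq_two.1 hc
    obtain ⟨h1, h2⟩ := hrel _ hs
    rw [Finset.sum_pair hpq] at h1 h2
    have h3 : α p * (a p - a q) = 0 := by linear_combination h1 - a q * h2
    exact absurd ((mul_eq_zero.1 h3).resolve_right (sub_ne_zero.2 (ha.injective.ne hpq)))
      (hne p (by simp [hs]))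
  · obtain ⟨i, j, l, hij, hjl, hs⟩ := exists_sorted_of_card_three hc
    refine ⟨i, j, l, hij, hjl, ?_⟩
    obtain ⟨h1, h2⟩ := hrel _ hs
    have hil := hij.trans hjl
    rw [Finset.sum_insert (by simp [hij.ne, hil.ne]), Finset.sum_pair hjl.ne] at h1 h2
    have e1 : 0 < a l - a j := sub_pos.2 (ha hjl)
    have e2 : 0 < a j - a i := sub_pos.2 (ha hij)
    -- Eliminating `α j` shows that `α i` and `α l` have the same sign; the vanishing sum gives `α
    -- j` the other one.
    have h3 : α i * (a j - a i) = α l * (a l - a j) := by linear_combination -h1 + a j * h2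
    have hi : i ∈ C₁ ∪ C₂ := by simp [hs]
    have hj : j ∈ C₁ ∪ C₂ := by simp [hs]
    have hl : l ∈ C₁ ∪ C₂ := by simp [hs]
    have hsub : ∀ m, m ∈ C₁ ∨ m ∈ C₂ → m = i ∨ m = j ∨ m = l := by
      intro m hm
      have : m ∈ C₁ ∪ C₂ := Finset.mem_union.2 hm
      rw [hs] at this
      simpa using this
    have i1 := hpos' i hi
    have i2 := hneg' i hi
    have j1 := hpos' j hj
    have j2 := hneg' j hj
    have l1 := hpos' l hl
    have l2 := hneg' l hl
    rcases lt_or_gt_of_ne (hne i hi) with h | h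
    · right
      have p1 : α l < 0 := by
        have := mul_neg_of_neg_of_pos h e2
        rw [h3] at this
        exact neg_of_mul_neg_left this e1.le
      have p2 : 0 < α j := by linarith
      have n1 : ¬ 0 < α i := by linarith
      have n2 : ¬ 0 < α l := by linarith
      have n3 : ¬ α j < 0 := by linarith
      simp only [h, p1, p2, n1, n2, n3, iff_true, iff_false] at i1 i2 j1 j2 l1 l2
      ext m <;> simp only [Finset.mem_insert, Finset.mem_singleton] <;> have := hsub m <;> grind
    · left
      have p1 : 0 < α l := by
        have := mul_pos h e2
        rw [h3] at this
        exact pos_of_mul_pos_left this e1.le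
      have p2 : α j < 0 := by linarith
      have n1 : ¬ α i < 0 := by linarith
      have n2 : ¬ α l < 0 := by linarith
      have n3 : ¬ 0 < α j := by linarith
      simp only [h, p1, p2, n1, n2, n3, iff_true, iff_false] at i1 i2 j1 j2 l1 l2
      ext m <;> simp only [Finset.mem_insert, Finset.mem_singleton] <;> have := hsub m <;> grind

/-! ### Flips in terms of tiles -/

section Tiles

variable {A : Finset (Fin n)} {i j l : Fin n}

theorem upperTiles_eq (hij : i < j) (hjl : j < l) :
    (({i, l} : Finset (Fin n)).image fun x => (insert x A, ({i, l} ∪ {j} : Finset (Fin n)).erase x)) ∪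
      ({j} : Finset (Fin n)).image (fun x => (A, ({i, l} ∪ {j} : Finset (Fin n)).erase x)) =
    upperTiles A i j l := by
  have e1 : ({i, l} ∪ {j} : Finset (Fin n)).erase i = {j, l} := by grind
  have e2 : ({i, l} ∪ {j} : Finset (Fin n)).erase l = {i, j} := by grind
  have e3 : ({i, l} ∪ {j} : Finset (Fin n)).erase j = {i, l} := by grind
  rw [Finset.image_insert, Finset.image_singleton, Finset.image_singleton, e1, e2, e3]
  ext t
  simp only [upperTiles, Finset.mem_union, Finset.mem_insert, Finset.mem_singleton]
  tauto

theorem lowerTiles_eq (hij : i < j) (hjl : j < l) :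
    (({i, l} : Finset (Fin n)).image fun x => (A, ({i, l} ∪ {j} : Finset (Fin n)).erase x)) ∪
      ({j} : Finset (Fin n)).image (fun x => (insert x A, ({i, l} ∪ {j} : Finset (Fin n)).erase x)) =
    lowerTiles A i j l := by
  have e1 : ({i, l} ∪ {j} : Finset (Fin n)).erase i = {j, l} := by grind
  have e2 : ({i, l} ∪ {j} : Finset (Fin n)).erase l = {i, j} := by grind
  have e3 : ({i, l} ∪ {j} : Finset (Fin n)).erase j = {i, l} := by grind
  rw [Finset.image_insert, Finset.image_singleton, Finset.image_singleton, e1, e2, e3]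
  ext t
  simp only [lowerTiles, Finset.mem_union, Finset.mem_insert, Finset.mem_singleton]
  tauto

end Tiles

/-! ### Vertices and orientations of circuits on the two sides of a flip. -/

theorem RaisingFlip.mem_left {T T' : Tiling a} {A : Finset (Fin n)} {i j l : Fin n}
    (h : RaisingFlip T T' A i j l) : (A, {i, j}) ∈ T.tiles ∧ (A, {j, l}) ∈ T.tiles ∧
      (insert j A, {i, l}) ∈ T.tiles := by
  have h' : ∀ t ∈ lowerTiles A i j l, t ∈ T.tiles := fun t ht =>
    (Finset.mem_sdiff.1 (h.diff ▸ ht)).1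
  exact ⟨h' _ (by simp [lowerTiles]), h' _ (by simp [lowerTiles]), h' _ (by simp [lowerTiles])⟩

theorem RaisingFlip.mem_right {T T' : Tiling a} {A : Finset (Fin n)} {i j l : Fin n}
    (h : RaisingFlip T T' A i j l) : (insert i A, {j, l}) ∈ T'.tiles ∧
      (insert l A, {i, j}) ∈ T'.tiles ∧ (A, {i, l}) ∈ T'.tiles := by
  have h' : ∀ t ∈ upperTiles A i j l, t ∈ T'.tiles := fun t ht =>
    (Finset.mem_sdiff.1 (h.diff' ▸ ht)).1
  exact ⟨h' _ (by simp [upperTiles]), h' _ (by simp [upperTiles]), h' _ (by simp [upperTiles])⟩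

theorem mem_vertices_of_tile {T : Tiling a} {A B S : Finset (Fin n)} (h : (A, B) ∈ T.tiles)
    (h1 : A ⊆ S) (h2 : S ⊆ A ∪ B) : S ∈ T.vertices := ⟨_, h, h1, h2⟩

/-- The lower tiles contain all vertices of the cube over the hexagon except the upper interior
vertex `A ∪ {i, l}`. -/
theorem RaisingFlip.mem_vertices_left {T T' : Tiling a} {A : Finset (Fin n)} {i j l : Fin n}
    (h : RaisingFlip T T' A i j l) {S : Finset (Fin n)} (h1 : A ⊆ S) (h2 : S ⊆ A ∪ {i, j, l})
    (h3 : ¬ (i ∈ S ∧ l ∈ S ∧ j ∉ S)) : S ∈ T.vertices := by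
  obtain ⟨t1, t2, t3⟩ := h.mem_left
  by_cases hl : l ∈ S
  · by_cases hi : i ∈ S
    · exact mem_vertices_of_tile t3 (by grind) (by grind)
    · exact mem_vertices_of_tile t2 h1 (by grind)
  · exact mem_vertices_of_tile t1 h1 (by grind)

theorem RaisingFlip.mem_vertices_right {T T' : Tiling a} {A : Finset (Fin n)} {i j l : Fin n}
    (h : RaisingFlip T T' A i j l) {S : Finset (Fin n)} (h1 : A ⊆ S) (h2 : S ⊆ A ∪ {i, j, l})
    (h3 : ¬ (i ∉ S ∧ l ∉ S ∧ j ∈ S)) : S ∈ T'.vertices := by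
  obtain ⟨t1, t2, t3⟩ := h.mem_right
  by_cases hj : j ∈ S
  · by_cases hi : i ∈ S
    · exact mem_vertices_of_tile t1 (by grind) (by grind)
    · exact mem_vertices_of_tile t2 (by grind) (by grind)
  · exact mem_vertices_of_tile t3 h1 (by grind)

theorem RaisingFlip.vertices_right_subset {T T' : Tiling a} {A : Finset (Fin n)} {i j l : Fin n}
    (h : RaisingFlip T T' A i j l) {S : Finset (Fin n)} (hS : S ∈ T'.vertices) :
    S ∈ T.vertices ∨ S = insert i (insert l A) := by
  obtain ⟨t, ht, h1, h2⟩ := hS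
  obtain ⟨hij, hjl, hi, hj, hl⟩ := id h.hexagon
  have hil := hij.trans hjl
  by_cases htT : t ∈ T.tiles
  · exact Or.inl ⟨t, htT, h1, h2⟩
  have htu : t ∈ upperTiles A i j l := h.diff' ▸ Finset.mem_sdiff.2 ⟨ht, htT⟩
  simp only [upperTiles, Finset.mem_insert, Finset.mem_singleton] at htu
  by_cases hS : i ∈ S ∧ l ∈ S ∧ j ∉ S
  · right
    rcases htu with rfl | rfl | rfl <;> ext m <;> have e1 := @h1 m <;> have e2 := @h2 m <;>
      simp only [Finset.mem_union, Finset.mem_insert, Finset.mem_singleton] at * <;> grind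
  · left
    rcases htu with rfl | rfl | rfl
    · exact h.mem_vertices_left (by grind) (by grind) hS
    · exact h.mem_vertices_left (by grind) (by grind) hS
    · exact h.mem_vertices_left (by grind) (by grind) hS

theorem RaisingFlip.vertices_left_subset {T T' : Tiling a} {A : Finset (Fin n)} {i j l : Fin n}
    (h : RaisingFlip T T' A i j l) {S : Finset (Fin n)} (hS : S ∈ T.vertices) :
    S ∈ T'.vertices ∨ S = insert j A := by
  obtain ⟨t, ht, h1, h2⟩ := hS
  obtain ⟨hij, hjl, hi, hj, hl⟩ := id h.hexagon
  have hil := hij.trans hjl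
  by_cases htT : t ∈ T'.tiles
  · exact Or.inl ⟨t, htT, h1, h2⟩
  have htu : t ∈ lowerTiles A i j l := h.diff ▸ Finset.mem_sdiff.2 ⟨ht, htT⟩
  simp only [lowerTiles, Finset.mem_insert, Finset.mem_singleton] at htu
  by_cases hS : i ∉ S ∧ l ∉ S ∧ j ∈ S
  · right
    rcases htu with rfl | rfl | rfl <;> ext m <;> have e1 := @h1 m <;> have e2 := @h2 m <;>
      simp only [Finset.mem_union, Finset.mem_insert, Finset.mem_singleton] at * <;> grind
  · left
    rcases htu with rfl | rfl | rfl
    · exact h.mem_vertices_right (by grind) (by grind) hS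
    · exact h.mem_vertices_right (by grind) (by grind) hS
    · exact h.mem_vertices_right (by grind) (by grind) hS

/-- Only the vertex `A ∪ {i, l}` has to be replaced. Unless the circuit is the excluded one, some of
`i`, `j`, `l` can be added or removed without affecting the orientation of `C`, and this leads to
another vertex of the cube. -/
theorem RaisingFlip.exists_orients_left (ha : StrictMono a) {T T' : Tiling a}
    {A : Finset (Fin n)} {i j l : Fin n} (h : RaisingFlip T T' A i j l)
    {C : Finset (Fin n) × Finset (Fin n)} (hC : IsCircuit a C) (hC₁ : C ≠ ({i, l}, {j}))
    {S : Finset (Fin n)} (hS : S ∈ T'.vertices) (hSC : SetOrientsPos S C) :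
    ∃ S' ∈ T.vertices, SetOrientsPos S' C := by
  rcases h.vertices_right_subset hS with hS | rfl
  · exact ⟨S, hS, hSC⟩
  obtain ⟨hij, hjl, hi, hj, hl⟩ := id h.hexagon
  have hil := hij.trans hjl
  obtain ⟨p, q, r, hpq, hqr, rfl | rfl⟩ := hC.exists_triple ha
  · obtain ⟨h1, h2⟩ := hSC
    have hp : p ∈ insert i (insert l A) := h1 (by simp)
    have hr : r ∈ insert i (insert l A) := h1 (by simp)
    have hq : q ∉ insert i (insert l A) := by simpa using h2
    by_cases hqj : q = j
    · subst hqj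
      by_cases hpi : p = i
      · subst hpi
        have hrl : r ≠ l := by rintro rfl; exact hC₁ rfl
        refine ⟨insert p A, h.mem_vertices_left (by grind) (by grind) (by grind), ?_, ?_⟩
        · intro m hm; simp only [Finset.mem_insert, Finset.mem_singleton] at *; grind
        · simp only [Finset.disjoint_singleton_left, Finset.mem_insert] at *; grind
      · refine ⟨insert l A, h.mem_vertices_left (by grind) (by grind) (by grind), ?_, ?_⟩
        · intro m hm; simp only [Finset.mem_insert, Finset.mem_singleton] at *; grind
        · simp only [Finset.disjoint_singleton_left, Finset.mem_insert] at *; grind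
    · refine ⟨insert i (insert j (insert l A)),
        h.mem_vertices_left (by grind) (by grind) (by grind), ?_, ?_⟩
      · intro m hm; simp only [Finset.mem_insert, Finset.mem_singleton] at *; grind
      · simp only [Finset.disjoint_singleton_left, Finset.mem_insert] at *; grind
  · obtain ⟨h1, h2⟩ := hSC
    have hq : q ∈ insert i (insert l A) := h1 (by simp)
    have hp : p ∉ insert i (insert l A) := fun h => Finset.disjoint_left.1 h2 (by simp) h
    have hr : r ∉ insert i (insert l A) := fun h => Finset.disjoint_left.1 h2 (by simp) h
    refine ⟨if q = l then insert l A else insert i A, h.mem_vertices_left (by grind) (by grind)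
      (by grind), ?_, ?_⟩
    · intro m hm; simp only [Finset.mem_insert, Finset.mem_singleton] at *; grind
    · simp only [Finset.disjoint_insert_left, Finset.disjoint_singleton_left, Finset.mem_insert] at *
      grind

theorem RaisingFlip.exists_orients_right (ha : StrictMono a) {T T' : Tiling a}
    {A : Finset (Fin n)} {i j l : Fin n} (h : RaisingFlip T T' A i j l)
    {C : Finset (Fin n) × Finset (Fin n)} (hC : IsCircuit a C) (hC₁ : C ≠ ({j}, {i, l}))
    {S : Finset (Fin n)} (hS : S ∈ T.vertices) (hSC : SetOrientsPos S C) :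
    ∃ S' ∈ T'.vertices, SetOrientsPos S' C := by
  rcases h.vertices_left_subset hS with hS | rfl
  · exact ⟨S, hS, hSC⟩
  obtain ⟨hij, hjl, hi, hj, hl⟩ := id h.hexagon
  have hil := hij.trans hjl
  obtain ⟨p, q, r, hpq, hqr, rfl | rfl⟩ := hC.exists_triple ha
  · obtain ⟨h1, h2⟩ := hSC
    have hp : p ∈ insert j A := h1 (by simp)
    have hr : r ∈ insert j A := h1 (by simp)
    have hq : q ∉ insert j A := by simpa using h2
    refine ⟨if q = i then insert j (insert l A) else insert i (insert j A),
      h.mem_vertices_right (by grind) (by grind) (by grind), ?_, ?_⟩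
    · intro m hm; simp only [Finset.mem_insert, Finset.mem_singleton] at *; grind
    · simp only [Finset.disjoint_singleton_left, Finset.mem_insert] at *; grind
  · obtain ⟨h1, h2⟩ := hSC
    have hq : q ∈ insert j A := h1 (by simp)
    have hp : p ∉ insert j A := fun h => Finset.disjoint_left.1 h2 (by simp) h
    have hr : r ∉ insert j A := fun h => Finset.disjoint_left.1 h2 (by simp) h
    by_cases hqj : q = j
    · subst hqj
      by_cases hpi : p = i
      · subst hpi
        have hrl : r ≠ l := by rintro rfl; exact hC₁ rfl
        refine ⟨insert q (insert l A), h.mem_vertices_right (by grind) (by grind) (by grind),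
          ?_, ?_⟩
        · intro m hm; simp only [Finset.mem_insert, Finset.mem_singleton] at *; grind
        · simp only [Finset.disjoint_insert_left, Finset.disjoint_singleton_left,
            Finset.mem_insert] at *
          grind
      · refine ⟨insert i (insert q A), h.mem_vertices_right (by grind) (by grind) (by grind),
          ?_, ?_⟩
        · intro m hm; simp only [Finset.mem_insert, Finset.mem_singleton] at *; grind
        · simp only [Finset.disjoint_insert_left, Finset.disjoint_singleton_left,
            Finset.mem_insert] at *
          grind
    · refine ⟨A, h.mem_vertices_right (by grind) (by grind) (by grind), ?_, ?_⟩
      · intro m hm; simp only [Finset.mem_insert, Finset.mem_singleton] at *; grind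
      · simp only [Finset.disjoint_insert_left, Finset.disjoint_singleton_left,
          Finset.mem_insert] at *
        grind

theorem Tiling.sign_swap (T : Tiling a) (C : Finset (Fin n) × Finset (Fin n)) :
    T.sign C.swap = - T.sign C := by
  have h : T.OrientsPos C → ¬ T.OrientsPos C.swap := by
    rintro ⟨⟨S, hS, h⟩, _⟩ ⟨_, h'⟩
    exact h' S hS (by rwa [Prod.swap_swap])
  unfold Tiling.sign
  rw [Prod.swap_swap]
  by_cases h1 : T.OrientsPos C
  · simp [h1, h h1]
  · by_cases h2 : T.OrientsPos C.swap <;> simp [h1, h2]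

theorem Tiling.sign_congr {T T' : Tiling a} {C : Finset (Fin n) × Finset (Fin n)}
    (h : (∃ S ∈ T.vertices, SetOrientsPos S C) ↔ ∃ S ∈ T'.vertices, SetOrientsPos S C)
    (h' : (∃ S ∈ T.vertices, SetOrientsPos S C.swap) ↔
      ∃ S ∈ T'.vertices, SetOrientsPos S C.swap) : T.sign C = T'.sign C := by
  have h1 : T.OrientsPos C ↔ T'.OrientsPos C := by
    have h2 := not_congr h'
    push Not at h2
    exact and_congr h h2
  have h2 : T.OrientsPos C.swap ↔ T'.OrientsPos C.swap := by
    have h2 := not_congr h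
    push Not at h2
    unfold Tiling.OrientsPos
    rw [Prod.swap_swap]
    exact and_congr h' h2
  unfold Tiling.sign
  by_cases e1 : T.OrientsPos C
  · rw [if_pos e1, if_pos (h1.1 e1)]
  by_cases e2 : T.OrientsPos C.swap
  · rw [if_neg e1, if_neg (mt h1.2 e1), if_pos e2, if_pos (h2.1 e2)]
  · rw [if_neg e1, if_neg (mt h1.2 e1), if_neg e2, if_neg (mt h2.2 e2)]

/-- The exchange of tiles implies the sign conditions. For the circuit of the hexagon, a vertex of
the wrong orientation would yield a second tile with free indices `i` and `l`. For all other
circuits the same orientations occur before and after. -/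
theorem RaisingFlip.isFlip (ha : StrictMono a) {T T' : Tiling a} {A : Finset (Fin n)}
    {i j l : Fin n} (h : RaisingFlip T T' A i j l) : IsFlip T' T ({i, l}, {j}) A := by
  obtain ⟨hij, hjl, hi, hj, hl⟩ := id h.hexagon
  have hil := hij.trans hjl
  have s1 : T'.sign ({i, l}, {j}) = 1 := by
    refine if_pos ⟨⟨insert i (insert l A), h.mem_vertices_right (by grind) (by grind) (by grind),
      ?_, ?_⟩, ?_⟩
    · intro m hm; simp only [Finset.mem_insert, Finset.mem_singleton] at *; grind
    · simp only [Finset.disjoint_singleton_left, Finset.mem_insert] at *; grind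
    · rintro S hS ⟨e1, e2⟩
      simp only [Prod.swap, Finset.singleton_subset_iff, Finset.disjoint_insert_left,
        Finset.disjoint_singleton_left] at e1 e2
      obtain ⟨A', hA', hjA⟩ := T'.exists_tile_of_middle_mem ha hS hij hjl e2.1 e1 e2.2
      rw [T'.tile_unique ha hil hA' h.mem_right.2.2] at hjA
      exact hj hjA
  have s2 : T.sign ({j}, {i, l}) = 1 := by
    refine if_pos ⟨⟨insert j A, h.mem_vertices_left (by grind) (by grind) (by grind),
      ?_, ?_⟩, ?_⟩
    · intro m hm; simp only [Finset.mem_insert, Finset.mem_singleton] at *; grind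
    · simp only [Finset.disjoint_singleton_left, Finset.disjoint_insert_left,
        Finset.mem_insert] at *
      grind
    · rintro S hS ⟨e1, e2⟩
      simp only [Prod.swap, Finset.insert_subset_iff, Finset.singleton_subset_iff,
        Finset.disjoint_singleton_left] at e1 e2
      obtain ⟨A', hA', hjA⟩ := T.exists_tile_of_middle_notMem ha hS hij hjl e1.1 e2 e1.2
      rw [T.tile_unique ha hil hA' h.mem_left.2.2] at hjA
      simp at hjA
  refine ⟨isCircuit_triple ha hij hjl, ?_, ?_, ?_, ?_, ?_⟩
  · rw [s1, ← Tiling.sign_swap]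
    exact s2.symm
  · intro C hC h1 h2
    have h2' : C ≠ ({j}, {i, l}) := h2
    have h3 : C.swap ≠ ({i, l}, {j}) := fun e => h2 (by rw [← e, Prod.swap_swap])
    have h4 : C.swap ≠ ({j}, {i, l}) := fun e => h1 (by rw [← Prod.swap_swap C, e]; rfl)
    apply Tiling.sign_congr
    · constructor
      · rintro ⟨S, hS, h5⟩
        exact h.exists_orients_left ha hC h1 hS h5
      · rintro ⟨S, hS, h5⟩
        exact h.exists_orients_right ha hC h2' hS h5
    · constructor
      · rintro ⟨S, hS, h5⟩
        exact h.exists_orients_left ha hC.swap h3 hS h5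
      · rintro ⟨S, hS, h5⟩
        exact h.exists_orients_right ha hC.swap h4 hS h5
  · simp [hi, hj, hl]
  · rw [h.diff', ← upperTiles_eq hij hjl]
  · rw [h.diff, ← lowerTiles_eq hij hjl]


/-! ### Flips are raising flips and their inverses. -/

theorem IsFlip.symm {T T' : Tiling a} {C : Finset (Fin n) × Finset (Fin n)} {A : Finset (Fin n)}
    (h : IsFlip T T' C A) : IsFlip T' T C.swap A := by
  refine ⟨h.circuit.swap, ?_, fun C' hC' h1 h2 => (h.sign_eq C' hC' ?_ h1).symm, ?_, ?_, ?_⟩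
  · rw [Tiling.sign_swap, Tiling.sign_swap, h.sign_neg, neg_neg]
  · rintro rfl
    exact h2 (Prod.swap_swap _).symm
  · simpa only [Prod.fst_swap, Prod.snd_swap, Finset.union_comm] using h.disjoint
  · rw [h.diff₂₁, Finset.union_comm]
    simp only [Prod.fst_swap, Prod.snd_swap, Finset.union_comm C.2]
  · rw [h.diff₁₂, Finset.union_comm]
    simp only [Prod.fst_swap, Prod.snd_swap, Finset.union_comm C.2]

theorem IsFlip.exists_raisingFlip (ha : StrictMono a) {T T' : Tiling a}
    {C : Finset (Fin n) × Finset (Fin n)} {A : Finset (Fin n)} (h : IsFlip T T' C A) :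
    ∃ i j l, RaisingFlip T T' A i j l ∨ RaisingFlip T' T A i j l := by
  have key : ∀ {T T' : Tiling a} {i j l}, i < j → j < l → IsFlip T T' ({i, l}, {j}) A →
      RaisingFlip T' T A i j l := by
    intro T T' i j l hij hjl h
    have hd := h.disjoint
    simp only [Finset.disjoint_union_right, Finset.disjoint_insert_right,
      Finset.disjoint_singleton_right] at hd
    exact ⟨⟨hij, hjl, hd.1.1, hd.2, hd.1.2⟩, h.diff₂₁.trans (lowerTiles_eq hij hjl),
      h.diff₁₂.trans (upperTiles_eq hij hjl)⟩
  obtain ⟨i, j, l, hij, hjl, rfl | rfl⟩ := h.circuit.exists_triple ha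
  · exact ⟨i, j, l, Or.inr (key hij hjl h)⟩
  · exact ⟨i, j, l, Or.inl (key hij hjl h.symm)⟩

theorem FlipAtLevel.symm {T T' : Tiling a} {m : ℕ} (h : FlipAtLevel m T T') :
    FlipAtLevel m T' T := by
  obtain ⟨C, A, h, hm⟩ := h
  exact ⟨C.swap, A, h.symm, hm⟩

theorem flipAtLevel_iff (ha : StrictMono a) {T T' : Tiling a} {m : ℕ} :
    FlipAtLevel m T T' ↔ ∃ A i j l, (RaisingFlip T T' A i j l ∨ RaisingFlip T' T A i j l) ∧
      m = A.card + 1 := by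
  constructor
  · rintro ⟨C, A, h, hm⟩
    obtain ⟨i, j, l, h⟩ := h.exists_raisingFlip ha
    exact ⟨A, i, j, l, h, hm⟩
  · rintro ⟨A, i, j, l, h | h, hm⟩
    · exact ⟨_, A, (h.isFlip ha).symm, hm⟩
    · exact ⟨_, A, h.isFlip ha, hm⟩

/-! ### The complementary tiling -/

theorem one_sub_mem_cubeFace {A B : Finset (Fin n)} (hAB : Disjoint A B) {x : Fin n → ℝ} :
    1 - x ∈ cubeFace (A ∪ B)ᶜ B ↔ x ∈ cubeFace A B := by
  constructor
  · rintro ⟨h1, h2, h3⟩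
    refine ⟨fun m => ?_, fun m hm => ?_, fun m hm => ?_⟩
    · have := h1 m
      simp only [Pi.sub_apply, Pi.one_apply] at this
      constructor <;> linarith
    · have := h3 m (by simp [hm, Finset.disjoint_left.1 hAB hm])
      simp only [Pi.sub_apply, Pi.one_apply] at this
      linarith
    · have := h2 m (Finset.mem_compl.2 hm)
      simp only [Pi.sub_apply, Pi.one_apply] at this
      linarith
  · rintro ⟨h1, h2, h3⟩
    refine ⟨fun m => ?_, fun m hm => ?_, fun m hm => ?_⟩
    · have := h1 m
      simp only [Pi.sub_apply, Pi.one_apply]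
      constructor <;> linarith
    · simp [h3 m (Finset.mem_compl.1 hm)]
    · have hm' : m ∈ A := by simp only [Finset.mem_union, Finset.mem_compl] at hm; tauto
      simp [h2 m hm']

theorem one_sub_mem_cube {x : Fin n → ℝ} (hx : x ∈ cube n) : 1 - x ∈ cube n := by
  intro m
  have := hx m
  simp only [Pi.sub_apply, Pi.one_apply]
  constructor <;> linarith

/-- The tile opposite to a given tile. -/
def complTile (t : Finset (Fin n) × Finset (Fin n)) : Finset (Fin n) × Finset (Fin n) :=
  ((t.1 ∪ t.2)ᶜ, t.2)

theorem complTile_complTile {t : Finset (Fin n) × Finset (Fin n)} (h : Disjoint t.1 t.2) :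
    complTile (complTile t) = t := by
  refine Prod.ext ?_ rfl
  ext m
  have : m ∈ t.1 → m ∉ t.2 := fun h1 => Finset.disjoint_left.1 h h1
  simp only [complTile, Finset.mem_compl, Finset.mem_union]
  tauto

theorem disjoint_complTile (t : Finset (Fin n) × Finset (Fin n)) :
    Disjoint (complTile t).1 (complTile t).2 := by
  rw [Finset.disjoint_left]
  intro m hm hm'
  simp only [complTile, Finset.mem_compl, Finset.mem_union, not_or] at hm hm'
  exact hm.2 hm'

/-- The image of a tiling under the central symmetry of the zonotope. -/
def Tiling.compl (ha : StrictMono a) (T : Tiling a) : Tiling a :=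
  Tiling.ofLift a (T.tiles.image complTile)
    (by
      intro t ht
      obtain ⟨s, _, rfl⟩ := Finset.mem_image.1 ht
      exact disjoint_complTile s)
    (by
      intro t ht
      obtain ⟨s, hs, rfl⟩ := Finset.mem_image.1 ht
      exact T.card_eq_two s hs)
    (by
      intro x hx
      obtain ⟨t, ht, y, hy, hyx⟩ := T.exists_lift (one_sub_mem_cube hx)
      refine ⟨_, Finset.mem_image_of_mem _ ht, 1 - y,
        (one_sub_mem_cubeFace (T.disjoint t ht)).2 hy, ?_⟩
      rw [map_sub, hyx, map_sub, sub_sub_cancel])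
    (by
      intro s hs' t ht' x hx y hy hxy
      obtain ⟨s, hs, rfl⟩ := Finset.mem_image.1 hs'
      obtain ⟨t, ht, rfl⟩ := Finset.mem_image.1 ht'
      rw [← sub_sub_cancel 1 x] at hx
      rw [← sub_sub_cancel 1 y] at hy
      have := T.lift_unique ha hs ht ((one_sub_mem_cubeFace (T.disjoint s hs)).1 hx)
        ((one_sub_mem_cubeFace (T.disjoint t ht)).1 hy) (by rw [map_sub, map_sub, hxy])
      exact sub_right_injective this)

theorem Tiling.mem_compl_iff (ha : StrictMono a) (T : Tiling a)
    {t : Finset (Fin n) × Finset (Fin n)} (hd : Disjoint t.1 t.2) :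
    t ∈ (T.compl ha).tiles ↔ complTile t ∈ T.tiles := by
  constructor
  · intro h
    obtain ⟨s, hs, rfl⟩ := Finset.mem_image.1 h
    rwa [complTile_complTile (T.disjoint s hs)]
  · intro h
    exact Finset.mem_image.2 ⟨_, h, complTile_complTile hd⟩

theorem Tiling.compl_compl (ha : StrictMono a) (T : Tiling a) : (T.compl ha).compl ha = T := by
  have key : ∀ t : Finset (Fin n) × Finset (Fin n), Disjoint t.1 t.2 →
      (t ∈ ((T.compl ha).compl ha).tiles ↔ t ∈ T.tiles) := by
    intro t ht
    rw [Tiling.mem_compl_iff ha _ ht, Tiling.mem_compl_iff ha _ (disjoint_complTile t),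
      complTile_complTile ht]
  apply Tiling.ext
  ext t : 1
  exact ⟨fun h => (key t (Tiling.disjoint _ t h)).1 h, fun h => (key t (T.disjoint t h)).2 h⟩

theorem Tiling.compl_sdiff_compl (ha : StrictMono a) (T T' : Tiling a) :
    (T.compl ha).tiles \ (T'.compl ha).tiles = (T.tiles \ T'.tiles).image complTile := by
  ext t
  rw [Finset.mem_sdiff, Finset.mem_image]
  constructor
  · rintro ⟨h1, h2⟩
    have hd := Tiling.disjoint _ t h1
    rw [Tiling.mem_compl_iff ha _ hd] at h1 h2
    exact ⟨_, Finset.mem_sdiff.2 ⟨h1, h2⟩, complTile_complTile hd⟩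
  · rintro ⟨s, hs, rfl⟩
    obtain ⟨h1, h2⟩ := Finset.mem_sdiff.1 hs
    rw [Tiling.mem_compl_iff ha _ (disjoint_complTile s), Tiling.mem_compl_iff ha _
      (disjoint_complTile s), complTile_complTile (T.disjoint s h1)]
    exact ⟨h1, h2⟩

/-- The central symmetry exchanges upper and lower facets, so it reverses raising flips. By
`IsHexagon.card_compl` it sends level `m` to level `n - 1 - m`, and thus exchanges high and low
levels. -/
theorem RaisingFlip.compl (ha : StrictMono a) {T T' : Tiling a} {A : Finset (Fin n)}
    {i j l : Fin n} (h : RaisingFlip T T' A i j l) :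
    RaisingFlip (T'.compl ha) (T.compl ha) (A ∪ {i, j, l})ᶜ i j l := by
  obtain ⟨hij, hjl, hi, hj, hl⟩ := id h.hexagon
  have hil := hij.trans hjl
  refine ⟨⟨hij, hjl, by simp, by simp, by simp⟩, ?_, ?_⟩
  · have e1 : complTile (insert i A, {j, l}) = ((A ∪ {i, j, l})ᶜ, {j, l}) := by
      simp only [complTile]; congr 2; grind
    have e2 : complTile (insert l A, {i, j}) = ((A ∪ {i, j, l})ᶜ, {i, j}) := by
      simp only [complTile]; congr 2; grind
    have e3 : complTile (A, {i, l}) = (insert j (A ∪ {i, j, l})ᶜ, {i, l}) := by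
      simp only [complTile, Prod.mk.injEq, and_true]
      ext m
      simp only [Finset.mem_compl, Finset.mem_union, Finset.mem_insert, Finset.mem_singleton]
      grind
    rw [Tiling.compl_sdiff_compl, h.diff', upperTiles, lowerTiles, Finset.image_insert,
      Finset.image_insert, Finset.image_singleton, e1, e2, e3, Finset.insert_comm]
  · have e1 : complTile (A, {i, j}) = (insert l (A ∪ {i, j, l})ᶜ, {i, j}) := by
      simp only [complTile, Prod.mk.injEq, and_true]
      ext m
      simp only [Finset.mem_compl, Finset.mem_union, Finset.mem_insert, Finset.mem_singleton]
      grind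
    have e2 : complTile (A, {j, l}) = (insert i (A ∪ {i, j, l})ᶜ, {j, l}) := by
      simp only [complTile, Prod.mk.injEq, and_true]
      ext m
      simp only [Finset.mem_compl, Finset.mem_union, Finset.mem_insert, Finset.mem_singleton]
      grind
    have e3 : complTile (insert j A, {i, l}) = ((A ∪ {i, j, l})ᶜ, {i, l}) := by
      simp only [complTile]; congr 2; grind
    rw [Tiling.compl_sdiff_compl, h.diff, upperTiles, lowerTiles, Finset.image_insert,
      Finset.image_insert, Finset.image_singleton, e1, e2, e3, Finset.insert_comm]

theorem IsHexagon.card_compl {A : Finset (Fin n)} {i j l : Fin n} (h : IsHexagon A i j l) :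
    (A ∪ {i, j, l})ᶜ.card + A.card + 3 = n := by
  obtain ⟨hij, hjl, hi, hj, hl⟩ := h
  have h3 : ({i, j, l} : Finset (Fin n)).card = 3 := by
    rw [Finset.card_eq_three]
    exact ⟨i, j, l, hij.ne, (hij.trans hjl).ne, hjl.ne, rfl⟩
  have hd : Disjoint A {i, j, l} := by simp [hi, hj, hl]
  have h1 := Finset.card_compl_add_card (A ∪ {i, j, l})
  rw [Finset.card_union_of_disjoint hd, h3, Fintype.card_fin] at h1
  omega

/-! ### Sequences of flips at high levels -/

/-- `T'` arises from `T` by flips that raise the interior vertices of hexagons translated by sets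
with at least `m` elements. -/
def Raises (m : ℕ) : Tiling a → Tiling a → Prop :=
  Relation.ReflTransGen fun T T' => ∃ A i j l, m ≤ A.card ∧ RaisingFlip T T' A i j l

theorem Raises.mono {m m' : ℕ} (hm : m ≤ m') {T T' : Tiling a} (h : Raises m' T T') :
    Raises m T T' := by
  induction h with
  | refl => exact Relation.ReflTransGen.refl
  | tail _ h ih =>
    obtain ⟨A, i, j, l, hA, h⟩ := h
    exact ih.tail ⟨A, i, j, l, hm.trans hA, h⟩

theorem RaisingFlip.raises {m : ℕ} {T T' : Tiling a} {A : Finset (Fin n)} {i j l : Fin n}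
    (h : RaisingFlip T T' A i j l) (hm : m ≤ A.card) : Raises m T T' :=
  Relation.ReflTransGen.single ⟨A, i, j, l, hm, h⟩

theorem RaisingFlip.mem_iff_of_card_lt {T T' : Tiling a} {A : Finset (Fin n)} {i j l : Fin n}
    (h : RaisingFlip T T' A i j l) {t : Finset (Fin n) × Finset (Fin n)}
    (ht : t.1.card < A.card) : t ∈ T.tiles ↔ t ∈ T'.tiles := by
  have hins : ∀ x, A.card ≤ (insert x A).card := fun x => Finset.card_le_card (by simp)
  rcases h.mem_iff t with ⟨h, -⟩ | ⟨h, -⟩ | ⟨-, -, h⟩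
  · simp only [lowerTiles, Finset.mem_insert, Finset.mem_singleton] at h
    rcases h with rfl | rfl | rfl
    exacts [absurd ht (lt_irrefl _), absurd ht (lt_irrefl _), absurd ht (hins _).not_gt]
  · simp only [upperTiles, Finset.mem_insert, Finset.mem_singleton] at h
    rcases h with rfl | rfl | rfl
    exacts [absurd ht (hins _).not_gt, absurd ht (hins _).not_gt, absurd ht (lt_irrefl _)]
  · exact h

theorem Raises.mem_iff {m : ℕ} {T T' : Tiling a} (h : Raises m T T')
    {t : Finset (Fin n) × Finset (Fin n)} (ht : t.1.card < m) : t ∈ T.tiles ↔ t ∈ T'.tiles := by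
  induction h with
  | refl => rfl
  | tail _ h ih =>
    obtain ⟨A, i, j, l, hA, h⟩ := h
    exact ih.trans (h.mem_iff_of_card_lt (ht.trans_le hA))

theorem Tiling.rightEnd_of_tile (T : Tiling a) {A : Finset (Fin n)} {j l : Fin n} (hjl : j < l)
    (h : (A, {j, l}) ∈ T.tiles) : T.RightEnd (insert j A) l := by
  refine Or.inl ⟨j, by simp, hjl, ?_⟩
  rwa [Finset.erase_insert (T.notMem_of_tile h).1]

/-- The tiles above `A ∪ {j}` form a fan from the edge `i` to the edge `l`. If the fan is one tile,
the flip is available. Otherwise its first two tiles can be merged by induction, since their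
translation is larger; all these flips leave the tiles above `A` untouched. -/
theorem Tiling.exists_raises_raisingFlip (ha : StrictMono a) (T : Tiling a) {A : Finset (Fin n)}
    {i j l : Fin n} (hij : i < j) (hjl : j < l) (h₁ : (A, {i, j}) ∈ T.tiles)
    (h₂ : (A, {j, l}) ∈ T.tiles) :
    ∃ T' T'', Raises (A.card + 1) T T' ∧ RaisingFlip T' T'' A i j l := by
  induction hN : n - A.card using Nat.strong_induction_on generalizing T A i j l with
  | _ N ih =>
  have hjA := (T.notMem_of_tile h₁).2
  have hcard : (insert j A).card = A.card + 1 := Finset.card_insert_of_notMem hjA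
  have hlt : A.card + 1 ≤ n := by
    rw [← hcard]; simpa using Finset.card_le_univ (insert j A)
  -- Here `{i, m}` is the first tile of the fan above `A ∪ {j}`. Every merger increases `m`, until
  -- the right end `l` is reached.
  have inner : ∀ (d : ℕ) (T : Tiling a) (m : Fin n), n - (m : ℕ) = d → i < m →
      (A, {i, j}) ∈ T.tiles → (A, {j, l}) ∈ T.tiles → (insert j A, {i, m}) ∈ T.tiles →
      ∃ T' T'', Raises (A.card + 1) T T' ∧ RaisingFlip T' T'' A i j l := by
    intro d
    induction d using Nat.strong_induction_on with
    | _ d ihd =>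
    intro T m hd him h₁ h₂ h₃
    by_cases hml : m = l
    · subst hml
      obtain ⟨T'', h⟩ := T.exists_raisingFlip ha hij hjl h₁ h₂ h₃
      exact ⟨T, T'', Relation.ReflTransGen.refl, h⟩
    rcases (T.edge_of_tile h₃).2.right ha with ⟨m', hm', h₄⟩ | h₄
    · obtain ⟨T₁, T₂, hr, hf⟩ := ih (n - (insert j A).card) (by omega) T him hm' h₃ h₄ rfl
      have hiff : ∀ t : Finset (Fin n) × Finset (Fin n), t.1 = A →
          (t ∈ T.tiles ↔ t ∈ T₂.tiles) := by
        rintro t rfl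
        exact (hr.mem_iff (by omega)).trans (hf.mem_iff_of_card_lt (by omega))
      obtain ⟨T', T'', hr', hf'⟩ := ihd (n - (m' : ℕ)) (by
          have : (m : ℕ) < m' := hm'
          have := m'.2
          omega) T₂ m' rfl (him.trans hm') ((hiff _ rfl).1 h₁)
        ((hiff _ rfl).1 h₂) hf.mem_right.2.2
      refine ⟨T', T'', ?_, hf'⟩
      exact ((hr.mono (by omega)).trans (hf.raises (by omega))).trans hr'
    -- Both `m` and `l` would be the right end of the fan above `A ∪ {j}`.
    · exact absurd (h₄.unique ha (T.rightEnd_of_tile hjl h₂)) hml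
  rcases (T.edge_insert_of_tile hij.ne h₁).1.right ha with ⟨m, him, h₃⟩ | h₃
  · exact inner _ T m rfl him h₁ h₂ h₃
  · exact absurd (h₃.unique ha (T.rightEnd_of_tile hjl h₂)) (hij.trans hjl).ne

/-! ### Tilings that share a level -/

/-- No vertex with `c` elements has two adjacent tiles above it. -/
def Tiling.NoFan (T : Tiling a) (c : ℕ) : Prop :=
  ∀ A i j l, A.card = c → i < j → j < l → (A, {i, j}) ∈ T.tiles → (A, {j, l}) ∉ T.tiles

/-- Two tiles translated by `A` are replaced by one; the other exchanged tiles have one more element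
in their translation. This count makes the passage to `Tiling.NoFan` terminate. -/
theorem RaisingFlip.card_filter_lt {T T' : Tiling a} {A : Finset (Fin n)} {i j l : Fin n}
    (h : RaisingFlip T T' A i j l) :
    (T'.tiles.filter fun t => t.1.card = A.card).card <
      (T.tiles.filter fun t => t.1.card = A.card).card := by
  obtain ⟨hij, hjl, hi, hj, hl⟩ := id h.hexagon
  set F := T.tiles.filter fun t => t.1.card = A.card with hF
  have h1 : (A, {i, j}) ∈ F := Finset.mem_filter.2 ⟨h.mem_left.1, rfl⟩
  have hne : ({j, l} : Finset (Fin n)) ≠ {i, j} := by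
    intro e
    have : l ∈ ({i, j} : Finset (Fin n)) := by rw [← e]; simp
    simp [hjl.ne', (hij.trans hjl).ne'] at this
  have h2 : (A, {j, l}) ∈ F.erase (A, {i, j}) :=
    Finset.mem_erase.2 ⟨by simpa using hne, Finset.mem_filter.2 ⟨h.mem_left.2.1, rfl⟩⟩
  have hsub : (T'.tiles.filter fun t => t.1.card = A.card) ⊆
      insert (A, {i, l}) ((F.erase (A, {i, j})).erase (A, {j, l})) := by
    intro t ht
    obtain ⟨ht, hc⟩ := Finset.mem_filter.1 ht
    have hins : ∀ x, x ∉ A → (insert x A).card ≠ A.card := by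
      intro x hx
      rw [Finset.card_insert_of_notMem hx]
      omega
    rcases h.mem_iff t with ⟨-, -, h⟩ | ⟨h, -⟩ | ⟨h1, -, h⟩
    · exact absurd ht h
    · simp only [upperTiles, Finset.mem_insert, Finset.mem_singleton] at h
      rcases h with rfl | rfl | rfl
      exacts [absurd hc (hins _ hi), absurd hc (hins _ hl), by simp]
    · simp only [lowerTiles, Finset.mem_insert, Finset.mem_singleton, not_or] at h1
      simp only [Finset.mem_insert, Finset.mem_erase]
      exact Or.inr ⟨h1.2.1, h1.1, Finset.mem_filter.2 ⟨h.2 ht, hc⟩⟩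
  have h3 := (Finset.card_le_card hsub).trans (Finset.card_insert_le _ _)
  rw [Finset.card_erase_of_mem h2, Finset.card_erase_of_mem h1] at h3
  have h4 := Finset.card_pos.2 ⟨_, h2⟩
  rw [Finset.card_erase_of_mem h1] at h4
  omega

theorem Tiling.exists_raises_noFan (ha : StrictMono a) (T : Tiling a) (c : ℕ) :
    ∃ T', Raises c T T' ∧ T'.NoFan c := by
  induction hN : (T.tiles.filter fun t => t.1.card = c).card using Nat.strong_induction_on
    generalizing T with
  | _ N ih =>
  by_cases hT : T.NoFan c
  · exact ⟨T, Relation.ReflTransGen.refl, hT⟩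
  simp only [Tiling.NoFan] at hT
  push Not at hT
  obtain ⟨A, i, j, l, rfl, hij, hjl, h₁, h₂⟩ := hT
  obtain ⟨T', T'', hr, hf⟩ := T.exists_raises_raisingFlip ha hij hjl h₁ h₂
  have e : T.tiles.filter (fun t => t.1.card = A.card) =
      T'.tiles.filter fun t => t.1.card = A.card := by
    ext t
    simp only [Finset.mem_filter]
    exact and_congr_left fun ht => hr.mem_iff (by omega)
  have hlt := hf.card_filter_lt
  rw [← e, hN] at hlt
  obtain ⟨T₃, hr', h⟩ := ih _ hlt T'' rfl
  exact ⟨T₃, ((hr.mono (by omega)).trans (hf.raises le_rfl)).trans hr', h⟩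

theorem Tiling.exists_lt_of_mem (T : Tiling a) {t} (ht : t ∈ T.tiles) :
    ∃ i j, i < j ∧ t = (t.1, {i, j}) := by
  obtain ⟨i, j, hij, h⟩ := Finset.card_eq_two.1 (T.card_eq_two t ht)
  rcases lt_or_gt_of_ne hij with hij | hij
  · exact ⟨i, j, hij, Prod.ext rfl h⟩
  · exact ⟨j, i, hij, Prod.ext rfl (by rw [h, Finset.pair_comm])⟩

/-- Without fans, the tile above a set is bounded by the leftmost and the rightmost edge going up
from it. These edges are dictated by the tiles one level below and by the boundary, which the two
tilings share. -/
theorem Tiling.NoFan.mem_of_mem (ha : StrictMono a) {T T' : Tiling a} {c : ℕ} (hT : T.NoFan c)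
    (hT' : T'.NoFan c) (h : ∀ t, t.1.card + 1 = c → (t ∈ T.tiles ↔ t ∈ T'.tiles))
    {t} (ht : t ∈ T.tiles) (htc : t.1.card = c) : t ∈ T'.tiles := by
  obtain ⟨p, q, hpq, e⟩ := T.exists_lt_of_mem ht
  obtain ⟨A, B⟩ := t
  obtain rfl : B = {p, q} := congrArg Prod.snd e
  simp only at htc
  have hcard : ∀ m ∈ A, (A.erase m).card + 1 = c := fun m hm => by
    rw [Finset.card_erase_add_one hm, htc]
  have hr : T'.RightEnd A q := by
    rcases (T.edge_of_tile ht).2.right ha with ⟨m, hm, h'⟩ | ⟨m, hm, hmq, h'⟩ | h'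
    · exact absurd h' (hT A p q m htc hpq hm ht)
    · exact Or.inl ⟨m, hm, hmq, (h _ (hcard m hm)).1 h'⟩
    · exact Or.inr h'
  have hl : T'.LeftEnd A p := by
    rcases (T.edge_of_tile ht).1.left ha with ⟨m, hm, h'⟩ | ⟨m, hm, hmq, h'⟩ | h'
    · exact absurd ht (hT A m p q htc hm hpq h')
    · exact Or.inl ⟨m, hm, hmq, (h _ (hcard m hm)).1 h'⟩
    · exact Or.inr h'
  rcases (hl.edge ha).right ha with ⟨m, hm, h'⟩ | h'
  · rcases (T'.edge_of_tile h').2.right ha with ⟨m', hm', h''⟩ | h''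
    · exact absurd h'' (hT' A p m m' htc hm hm' h')
    · rwa [← h''.unique ha hr]
  · exact absurd (h'.unique ha hr) hpq.ne

theorem Tiling.card_fst_add_two_le (T : Tiling a) {t} (ht : t ∈ T.tiles) :
    t.1.card + 2 ≤ n := by
  have h := Finset.card_le_univ (t.1 ∪ t.2)
  rwa [Finset.card_union_of_disjoint (T.disjoint t ht), T.card_eq_two t ht,
    Fintype.card_fin] at h

/-- Bring both tilings to the form without fans at size `c`; they then agree there, and the argument
continues with `c + 1`, where flips no longer affect size `c`. For `c = 0` the hypothesis is empty,
so any two tilings become equal. -/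
theorem Tiling.exists_raises_agree (ha : StrictMono a) (T T' : Tiling a) (c : ℕ)
    (h : ∀ t, t.1.card + 1 = c → (t ∈ T.tiles ↔ t ∈ T'.tiles)) :
    ∃ T₁ T₁', Raises c T T₁ ∧ Raises c T' T₁' ∧
      ∀ t, c ≤ t.1.card + 1 → (t ∈ T₁.tiles ↔ t ∈ T₁'.tiles) := by
  induction hN : n - c generalizing T T' c with
  | zero =>
    refine ⟨T, T', Relation.ReflTransGen.refl, Relation.ReflTransGen.refl, fun t ht => ?_⟩
    constructor
    · intro h'; have := T.card_fst_add_two_le h'; omega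
    · intro h'; have := T'.card_fst_add_two_le h'; omega
  | succ N ih =>
    obtain ⟨T₂, hr, hT₂⟩ := T.exists_raises_noFan ha c
    obtain ⟨T₂', hr', hT₂'⟩ := T'.exists_raises_noFan ha c
    have h₂ : ∀ t, t.1.card + 1 = c → (t ∈ T₂.tiles ↔ t ∈ T₂'.tiles) := fun t ht =>
      ((hr.mem_iff (by omega)).symm.trans (h t ht)).trans (hr'.mem_iff (by omega))
    obtain ⟨T₁, T₁', hr₁, hr₁', h₁⟩ := ih T₂ T₂' (c + 1) (fun t ht =>
      ⟨fun h' => hT₂.mem_of_mem ha hT₂' h₂ h' (by omega), fun h' =>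
        hT₂'.mem_of_mem ha hT₂ (fun t ht => (h₂ t ht).symm) h' (by omega)⟩) (by omega)
    refine ⟨T₁, T₁', hr.trans (hr₁.mono (by omega)), hr'.trans (hr₁'.mono (by omega)),
      fun t ht => ?_⟩
    rcases ht.eq_or_lt with ht | ht
    · exact ((hr₁.mem_iff (by omega)).symm.trans (h₂ t ht.symm)).trans (hr₁'.mem_iff (by omega))
    · exact h₁ t ht

/-! ### Equivalence of tilings -/

theorem kEquivalence_of_flip {k m : ℕ} {T T' : Tiling a} (hm : m ≠ k) (h : FlipAtLevel m T T') :
    kEquivalence a k T T' := Relation.EqvGen.rel _ _ ⟨m, hm, h⟩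

theorem Raises.equiv (ha : StrictMono a) {k m : ℕ} {T T' : Tiling a} (h : Raises m T T')
    (hm : k ≤ m) : kEquivalence a k T T' := by
  induction h with
  | refl => exact (kEquivalence a k).refl' _
  | tail _ h ih =>
    obtain ⟨A, i, j, l, hA, h⟩ := h
    exact (kEquivalence a k).trans' ih (kEquivalence_of_flip (by omega)
      ((flipAtLevel_iff ha).2 ⟨A, i, j, l, Or.inl h, rfl⟩))

theorem Raises.equiv_compl (ha : StrictMono a) {k m : ℕ} {T T' : Tiling a}
    (h : Raises m T T') (hm : n < m + k + 2) :
    kEquivalence a k (T.compl ha) (T'.compl ha) := by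
  induction h with
  | refl => exact (kEquivalence a k).refl' _
  | tail _ h ih =>
    obtain ⟨A, i, j, l, hA, h⟩ := h
    have := h.hexagon.card_compl
    exact (kEquivalence a k).trans' ih (kEquivalence_of_flip (by omega)
      ((flipAtLevel_iff ha).2 ⟨_, i, j, l, Or.inr (h.compl ha), rfl⟩))

theorem card_complTile {t : Finset (Fin n) × Finset (Fin n)} (h : Disjoint t.1 t.2)
    (h' : t.2.card = 2) : (complTile t).1.card + t.1.card + 2 = n := by
  have h1 := Finset.card_compl_add_card (t.1 ∪ t.2)
  rw [Finset.card_union_of_disjoint h, h', Fintype.card_fin] at h1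
  simp only [complTile]
  omega

/-- The tiles translated by `k`-element sets cut the tiling into an upper and a lower part. The
upper parts are made equal by flips of level at least `k + 2`; the lower parts, seen as upper parts
of the complementary tilings, by flips of level less than `k`. -/
theorem kEquivalence_of_agree (ha : StrictMono a) {k : ℕ} (hk : k + 2 ≤ n) {T T' : Tiling a}
    (h : ∀ t, t.1.card = k → (t ∈ T.tiles ↔ t ∈ T'.tiles)) : kEquivalence a k T T' := by
  obtain ⟨T₁, T₁', hr, hr', h₁⟩ := T.exists_raises_agree ha T' (k + 1) fun t ht => h t (by omega)
  have hc : ∀ t, t.1.card + 1 ≤ n - (k + 1) →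
      (t ∈ (T₁.compl ha).tiles ↔ t ∈ (T₁'.compl ha).tiles) := by
    intro t ht
    by_cases hd : Disjoint t.1 t.2 ∧ t.2.card = 2
    · rw [Tiling.mem_compl_iff ha _ hd.1, Tiling.mem_compl_iff ha _ hd.1]
      have := card_complTile hd.1 hd.2
      exact h₁ _ (by omega)
    · exact ⟨fun h => absurd ⟨Tiling.disjoint _ t h, Tiling.card_eq_two _ t h⟩ hd,
        fun h => absurd ⟨Tiling.disjoint _ t h, Tiling.card_eq_two _ t h⟩ hd⟩
  -- A tile of size `k` has a complement of size `n - k - 2`, one less than the bound used here. So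
  -- these tiles stay fixed, and the flips have level below `k` once transported back.
  obtain ⟨T₂, T₂', hs, hs', h₂⟩ := (T₁.compl ha).exists_raises_agree ha (T₁'.compl ha)
    (n - (k + 1)) fun t ht => hc t ht.le
  have e : T₂ = T₂' := by
    apply Tiling.ext
    ext t : 1
    rcases lt_or_ge t.1.card (n - (k + 1)) with ht | ht
    · exact ((hs.mem_iff ht).symm.trans (hc t ht)).trans (hs'.mem_iff ht)
    · exact h₂ t (by omega)
  subst e
  have e1 := hs.equiv_compl ha (k := k) (by omega)
  have e2 := hs'.equiv_compl ha (k := k) (by omega)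
  rw [Tiling.compl_compl] at e1 e2
  exact (kEquivalence a k).trans'
    ((kEquivalence a k).trans' (hr.equiv ha (by omega)) e1)
    ((kEquivalence a k).symm' ((kEquivalence a k).trans' (hr'.equiv ha (by omega)) e2))

/-! ### Monotone paths -/

/-- The sum of the indices in a set, which increases along a monotone path. -/
def indexSum (S : Finset (Fin n)) : ℕ := ∑ m ∈ S, (m : ℕ)

theorem MonotoneStep.indexSum_lt {S S' : Finset (Fin n)} (h : MonotoneStep S S') :
    indexSum S < indexSum S' := by
  obtain ⟨I, i, j, hij, hi, hj, rfl, rfl⟩ := h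
  rw [indexSum, indexSum, Finset.sum_insert hi, Finset.sum_insert hj]
  exact Nat.add_lt_add_right hij _

theorem MonotoneStep.card_eq {S S' : Finset (Fin n)} (h : MonotoneStep S S') :
    S'.card = S.card := by
  obtain ⟨I, i, j, _, hi, hj, rfl, rfl⟩ := h
  rw [Finset.card_insert_of_notMem hi, Finset.card_insert_of_notMem hj]

theorem indexSum_le (S : Finset (Fin n)) : indexSum S ≤ n * n := by
  calc indexSum S ≤ ∑ _m ∈ S, n := Finset.sum_le_sum fun m _ => m.2.le
    _ = S.card * n := by rw [Finset.sum_const, smul_eq_mul]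
    _ ≤ n * n := Nat.mul_le_mul_right _ (by simpa using Finset.card_le_univ S)

/-- The first vertex of the hypertriangulations at level `K`. -/
def firstSet (n K : ℕ) : Finset (Fin n) := Finset.univ.filter fun i : Fin n => (i : ℕ) < K

/-- The last vertex of the hypertriangulations at level `K`. -/
def lastSet (n K : ℕ) : Finset (Fin n) := Finset.univ.filter fun i : Fin n => n ≤ (i : ℕ) + K

theorem not_monotoneStep_lastSet {K : ℕ} {S : Finset (Fin n)} :
    ¬ MonotoneStep (lastSet n K) S := by
  rintro ⟨I, i, j, hij, hi, hj, h, -⟩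
  have h1 : i ∈ lastSet n K := by rw [h]; simp
  have h2 : j ∉ lastSet n K := by rw [h]; simp [hij.ne', hj]
  simp only [lastSet, Finset.mem_filter, Finset.mem_univ, true_and] at h1 h2
  have : (i : ℕ) < j := hij
  omega

theorem not_monotoneStep_firstSet {K : ℕ} {S : Finset (Fin n)} :
    ¬ MonotoneStep S (firstSet n K) := by
  rintro ⟨I, i, j, hij, hi, hj, -, h⟩
  have h1 : j ∈ firstSet n K := by rw [h]; simp
  have h2 : i ∉ firstSet n K := by rw [h]; simp [hij.ne, hi]
  simp only [firstSet, Finset.mem_filter, Finset.mem_univ, true_and] at h1 h2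
  have : (i : ℕ) < j := hij
  omega

theorem exists_lt_of_ne_lastSet {S : Finset (Fin n)} (h : S ≠ lastSet n S.card) :
    ∃ p q, p < q ∧ p ∈ S ∧ q ∉ S := by
  by_contra! hcon
  apply h
  ext m
  simp only [lastSet, Finset.mem_filter, Finset.mem_univ, true_and]
  constructor
  · intro hm
    have h1 : Finset.Ici m ⊆ S := by
      intro q hq
      rcases (Finset.mem_Ici.1 hq).eq_or_lt with rfl | hq
      exacts [hm, hcon m q hq hm]
    have h2 := Finset.card_le_card h1
    rw [Fin.card_Ici] at h2
    omega
  · intro hm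
    by_contra hmS
    have h1 : S ⊆ Finset.Ioi m := by
      intro q hq
      rw [Finset.mem_Ioi]
      by_contra hqm
      rcases (not_lt.1 hqm).eq_or_lt with rfl | hqm
      exacts [hmS hq, hmS (hcon q m hqm hq)]
    have h2 := Finset.card_le_card h1
    rw [Fin.card_Ioi] at h2
    have := m.2
    omega

theorem exists_gt_of_ne_firstSet {S : Finset (Fin n)} (h : S ≠ firstSet n S.card) :
    ∃ p q, q < p ∧ p ∈ S ∧ q ∉ S := by
  by_contra! hcon
  apply h
  ext m
  simp only [firstSet, Finset.mem_filter, Finset.mem_univ, true_and]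
  constructor
  · intro hm
    have h1 : Finset.Iic m ⊆ S := by
      intro q hq
      rcases (Finset.mem_Iic.1 hq).eq_or_lt with rfl | hq
      exacts [hm, hcon m q hq hm]
    have h2 := Finset.card_le_card h1
    rw [Fin.card_Iic] at h2
    omega
  · intro hm
    by_contra hmS
    have h1 : S ⊆ Finset.Iio m := by
      intro q hq
      rw [Finset.mem_Iio]
      by_contra hqm
      rcases (not_lt.1 hqm).eq_or_lt with rfl | hqm
      exacts [hmS hq, hmS (hcon q m hqm hq)]
    have h2 := Finset.card_le_card h1
    rw [Fin.card_Iio] at h2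
    omega

/-! ### Chains of a relation. -/

section Lists

variable {α : Type*} {R : α → α → Prop}

theorem exists_rel_of_mem_isChain {x y : α} {l : List α} (h : (x :: l).IsChain R)
    (hy : y ∈ x :: l) : y = x ∨ ∃ z ∈ x :: l, R z y := by
  induction l generalizing x with
  | nil => exact Or.inl (by simpa using hy)
  | cons b l ih =>
    rw [List.isChain_cons_cons] at h
    rcases List.mem_cons.1 hy with rfl | hy
    · exact Or.inl rfl
    · rcases ih h.2 hy with rfl | ⟨z, hz, hzy⟩
      · exact Or.inr ⟨x, by simp, h.1⟩
      · exact Or.inr ⟨z, List.mem_cons_of_mem _ hz, hzy⟩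

theorem exists_infix_of_mem {l : List α} {x z : α} (hx : x ∈ l) (hl : l.getLast? = some z)
    (hxz : x ≠ z) : ∃ y L M, l = L ++ x :: y :: M := by
  obtain ⟨L, t, rfl⟩ := List.append_of_mem hx
  cases t with
  | nil => simp at hl; exact absurd hl hxz
  | cons y M => exact ⟨y, L, M, rfl⟩

/-- A deterministic path is determined by its start; since the last elements have no successors,
neither path can be a proper initial part of the other. -/
theorem isChain_unique (hR : Relator.RightUnique R) {z z' : α} (hz : ∀ y, ¬ R z y)
    (hz' : ∀ y, ¬ R z' y) {l l' : List α} (h : l.IsChain R) (h' : l'.IsChain R)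
    (hh : l.head? = l'.head?) (hl : l.getLast? = some z) (hl' : l'.getLast? = some z') :
    l = l' := by
  induction l generalizing l' with
  | nil => simp at hl
  | cons x l ih =>
    cases l' with
    | nil => simp at hl'
    | cons x' l' =>
      simp only [List.head?_cons, Option.some.injEq] at hh
      subst hh
      congr 1
      cases l with
      | nil =>
        simp only [List.getLast?_singleton, Option.some.injEq] at hl
        subst hl
        cases l' with
        | nil => rfl
        | cons y' l' => exact absurd (List.isChain_cons_cons.1 h').1 (hz _)
      | cons y l =>
        cases l' with
        | nil =>
          simp only [List.getLast?_singleton, Option.some.injEq] at hl'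
          subst hl'
          exact absurd (List.isChain_cons_cons.1 h).1 (hz' _)
        | cons y' l' =>
          obtain ⟨h1, h2⟩ := List.isChain_cons_cons.1 h
          obtain ⟨h1', h2'⟩ := List.isChain_cons_cons.1 h'
          obtain rfl := hR h1 h1'
          rw [List.getLast?_cons_cons] at hl hl'
          exact ih h2 h2' rfl hl hl'

end Lists

theorem nodup_of_isChain_monotoneStep {H : List (Finset (Fin n))}
    (h : H.IsChain MonotoneStep) : H.Nodup := by
  let r : Finset (Fin n) → Finset (Fin n) → Prop := fun S S' => indexSum S < indexSum S'
  have h1 : H.IsChain r := h.imp fun _ _ h => h.indexSum_lt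
  have : Trans r r r := ⟨fun h h' => lt_trans h h'⟩
  exact h1.pairwise.imp fun {S S'} (h : indexSum S < indexSum S') e => by
    rw [e] at h; exact lt_irrefl _ h

/-! ### Cross-sections -/

/-- The cross-section at level `K` of a tile of `T` goes from `S` to `S'`. -/
def Tiling.Step (T : Tiling a) (K : ℕ) (S S' : Finset (Fin n)) : Prop :=
  ∃ (A : Finset (Fin n)) (i j : Fin n), i < j ∧
    (A, {i, j}) ∈ T.tiles ∧ A.card + 1 = K ∧ S = insert i A ∧ S' = insert j A

theorem Tiling.Step.monotoneStep {T : Tiling a} {K : ℕ} {S S' : Finset (Fin n)}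
    (h : T.Step K S S') : MonotoneStep S S' := by
  obtain ⟨A, i, j, hij, ht, -, rfl, rfl⟩ := h
  obtain ⟨h1, h2⟩ := T.notMem_of_tile ht
  exact ⟨A, i, j, hij, h1, h2, rfl, rfl⟩

theorem Tiling.Step.card_left {T : Tiling a} {K : ℕ} {S S' : Finset (Fin n)}
    (h : T.Step K S S') : S.card = K := by
  obtain ⟨A, i, j, hij, ht, rfl, rfl, rfl⟩ := h
  exact Finset.card_insert_of_notMem (T.notMem_of_tile ht).1

theorem Tiling.Step.card_right {T : Tiling a} {K : ℕ} {S S' : Finset (Fin n)}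
    (h : T.Step K S S') : S'.card = K := h.monotoneStep.card_eq.trans h.card_left

theorem Tiling.Step.vertices {T : Tiling a} {K : ℕ} {S S' : Finset (Fin n)}
    (h : T.Step K S S') : S ∈ T.vertices ∧ S' ∈ T.vertices := by
  obtain ⟨A, i, j, hij, ht, -, rfl, rfl⟩ := h
  exact ⟨(T.edge_of_tile ht).1.vertex.2, (T.edge_of_tile ht).2.vertex.2⟩

theorem Tiling.step_rightUnique (ha : StrictMono a) (T : Tiling a) (K : ℕ) :
    Relator.RightUnique (T.Step K) := by
  rintro S S₁ S₂ ⟨A, i, j, hij, ht, -, rfl, rfl⟩ ⟨A', i', j', hij', ht', -, e, rfl⟩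
  obtain ⟨rfl, rfl, rfl⟩ := T.succ_unique ha ht ht' hij hij' e
  rfl

theorem Tiling.exists_step (ha : StrictMono a) (T : Tiling a) {K : ℕ} {S : Finset (Fin n)}
    (hS : S ∈ T.vertices) (hK : S.card = K) (hl : S ≠ lastSet n K) : ∃ S', T.Step K S S' := by
  subst hK
  obtain ⟨p, q, hpq, hp, hq⟩ := exists_lt_of_ne_lastSet hl
  obtain ⟨A, i, j, hij, rfl, ht⟩ := T.exists_succ ha hS hpq hp hq
  exact ⟨insert j A, A, i, j, hij, ht,
    (Finset.card_insert_of_notMem (T.notMem_of_tile ht).1).symm, rfl, rfl⟩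

theorem Tiling.exists_step' (ha : StrictMono a) (T : Tiling a) {K : ℕ} {S : Finset (Fin n)}
    (hS : S ∈ T.vertices) (hK : S.card = K) (hl : S ≠ firstSet n K) : ∃ S', T.Step K S' S := by
  subst hK
  obtain ⟨p, q, hpq, hp, hq⟩ := exists_gt_of_ne_firstSet hl
  obtain ⟨A, i, j, hij, rfl, ht⟩ := T.exists_pred ha hS hpq hp hq
  exact ⟨insert i A, A, i, j, hij, ht,
    (Finset.card_insert_of_notMem (T.notMem_of_tile ht).2).symm, rfl, rfl⟩

theorem card_firstSet {K : ℕ} (hK : K ≤ n) : (firstSet n K).card = K := by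
  rw [firstSet, Fin.card_filter_val_lt, min_eq_right hK]

theorem Tiling.firstSet_mem_vertices (ha : StrictMono a) (T : Tiling a) {K : ℕ} (h0 : 0 < K)
    (hK : K ≤ n) : firstSet n K ∈ T.vertices := by
  obtain ⟨t, ht, y, hy, hyx⟩ := T.exists_lift (vertexPt_mem_cube (firstSet n K))
  -- The largest element of the first set serves as the threshold that exhibits this set as a
  -- boundary vertex; it exists because `K` is positive.
  set c : Fin n := ⟨K - 1, by omega⟩ with hc
  rw [eq_of_threshold ha hy.1 hyx (-1) (a c) (fun m hm => ?_) (fun m hm => ?_) (by norm_num)] at hy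
  · exact ⟨t, ht, vertexPt_mem_cubeFace.1 hy⟩
  · rw [neg_one_mul, neg_sub, sub_pos, ha.lt_iff_lt, Fin.lt_def] at hm
    have : m ∈ firstSet n K := by
      simp only [firstSet, Finset.mem_filter, Finset.mem_univ, true_and]
      simp only [hc] at hm
      omega
    simp [vertexPt, this]
  · rw [neg_one_mul, neg_sub, sub_neg, ha.lt_iff_lt, Fin.lt_def] at hm
    have : m ∉ firstSet n K := by
      simp only [firstSet, Finset.mem_filter, Finset.mem_univ, true_and]
      simp only [hc] at hm
      omega
    simp [vertexPt, this]

/-- Successors are unique, and every vertex of size `K` can be traced back to the first set because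
index sums decrease. So a path of steps between the two ends already contains all vertices and edges
of the level. -/
theorem isCrossSection_iff (ha : StrictMono a) {T : Tiling a} {K : ℕ} (h0 : 0 < K) (hK : K ≤ n)
    {H : List (Finset (Fin n))} : IsCrossSection T K H ↔
      H.IsChain (T.Step K) ∧ H.head? = some (firstSet n K) ∧
        H.getLast? = some (lastSet n K) := by
  constructor
  · rintro ⟨⟨-, -, h1, h2⟩, -, h3⟩
    exact ⟨(List.isChain_isInfix H).imp fun S S' h => (h3 S S').1 h, h1, h2⟩
  · rintro ⟨hc, hh, hl⟩
    have hv : ∀ S ∈ H, S ∈ T.vertices ∧ S.card = K := by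
      intro S hS
      cases H with
      | nil => simp at hS
      | cons x H =>
        simp only [List.head?_cons, Option.some.injEq] at hh
        subst hh
        rcases exists_rel_of_mem_isChain hc hS with rfl | ⟨z, -, hz⟩
        · exact ⟨T.firstSet_mem_vertices ha h0 hK, card_firstSet hK⟩
        · exact ⟨hz.vertices.2, hz.card_right⟩
    have hnext : ∀ S S', S ∈ H → T.Step K S S' → [S, S'] <:+: H := by
      intro S S' hS h
      obtain ⟨y, L, M, rfl⟩ := exists_infix_of_mem hS hl
        (by rintro rfl; exact not_monotoneStep_lastSet h.monotoneStep)
      obtain rfl := T.step_rightUnique ha K h (List.isChain_append_cons_cons.1 hc).2.1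
      exact ⟨L, M, by simp⟩
    have hmem : ∀ S, S ∈ T.vertices → S.card = K → S ∈ H := by
      intro S hS hSK
      induction hN : indexSum S using Nat.strong_induction_on generalizing S with
      | _ N ih =>
      by_cases hf : S = firstSet n K
      · rw [hf]; exact List.mem_of_mem_head? hh
      obtain ⟨S', h⟩ := T.exists_step' ha hS hSK hf
      have hS' := ih _ (hN ▸ h.monotoneStep.indexSum_lt) S' h.vertices.1 h.card_left rfl
      exact (hnext S' S hS' h).subset (by simp)
    refine ⟨⟨fun S hS => (hv S hS).2, hc.imp fun _ _ h => h.monotoneStep, hh, hl⟩,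
      fun S => ⟨hv S, fun h => hmem S h.1 h.2⟩, fun S S' => ⟨fun h => ?_, fun h => ?_⟩⟩
    · exact List.isChain_pair.1 (hc.infix h)
    · have h : T.Step K S S' := h
      exact hnext S S' (hmem S h.vertices.1 h.card_left) h

theorem Tiling.exists_crossSection (ha : StrictMono a) (T : Tiling a) {K : ℕ} (h0 : 0 < K)
    (hK : K ≤ n) : ∃ H, IsCrossSection T K H := by
  have key : ∀ S, S ∈ T.vertices → S.card = K → ∃ H : List (Finset (Fin n)),
      H.IsChain (T.Step K) ∧ H.head? = some S ∧ H.getLast? = some (lastSet n K) := by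
    intro S hS hSK
    induction hN : n * n - indexSum S using Nat.strong_induction_on generalizing S with
    | _ N ih =>
    by_cases hl : S = lastSet n K
    · exact ⟨[S], by simp, rfl, by simp [hl]⟩
    obtain ⟨S', h⟩ := T.exists_step ha hS hSK hl
    have h1 := h.monotoneStep.indexSum_lt
    have h2 := indexSum_le S'
    obtain ⟨H, h3, h4, h5⟩ := ih (n * n - indexSum S') (by omega) S' h.vertices.2 h.card_right rfl
    cases H with
    | nil => simp at h4
    | cons x H =>
      simp only [List.head?_cons, Option.some.injEq] at h4
      subst h4
      exact ⟨S :: x :: H, List.isChain_cons_cons.2 ⟨h, h3⟩, rfl, by rwa [List.getLast?_cons_cons]⟩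
  obtain ⟨H, h⟩ := key _ (T.firstSet_mem_vertices ha h0 hK) (card_firstSet hK)
  exact ⟨H, (isCrossSection_iff ha h0 hK).2 h⟩

theorem IsCrossSection.isChain {T : Tiling a} {K : ℕ} {H : List (Finset (Fin n))}
    (h : IsCrossSection T K H) : H.IsChain (T.Step K) :=
  (List.isChain_isInfix H).imp fun S S' h' => (h.edges S S').1 h'

theorem IsCrossSection.unique (ha : StrictMono a) {T : Tiling a} {K : ℕ}
    {H H' : List (Finset (Fin n))} (h : IsCrossSection T K H) (h' : IsCrossSection T K H') :
    H = H' :=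
  isChain_unique (T.step_rightUnique ha K)
    (fun _ h => not_monotoneStep_lastSet h.monotoneStep)
    (fun _ h => not_monotoneStep_lastSet h.monotoneStep) h.isChain h'.isChain
    (h.hyper.2.2.1.trans h'.hyper.2.2.1.symm) h.hyper.2.2.2 h'.hyper.2.2.2

theorem IsCrossSection.congr {T T' : Tiling a} {K : ℕ} {H : List (Finset (Fin n))}
    (ha : StrictMono a) (h0 : 0 < K) (hK : K ≤ n)
    (h : IsCrossSection T K H) (hT : ∀ t, t.1.card + 1 = K → (t ∈ T.tiles → t ∈ T'.tiles)) :
    IsCrossSection T' K H := by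
  obtain ⟨h1, h2, h3⟩ := (isCrossSection_iff ha h0 hK).1 h
  refine (isCrossSection_iff ha h0 hK).2 ⟨h1.imp ?_, h2, h3⟩
  rintro S S' ⟨A, i, j, hij, ht, hA, e⟩
  exact ⟨A, i, j, hij, hT _ hA ht, hA, e⟩

/-- Two consecutive vertices recover the tile: its translation is their intersection. So the
cross-section at level `K` determines all tiles translated by sets with `K - 1` elements. -/
theorem mem_tiles_of_crossSection {T T' : Tiling a} {K : ℕ} {H : List (Finset (Fin n))}
    (h : IsCrossSection T K H) (h' : IsCrossSection T' K H) {t} (ht : t ∈ T.tiles)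
    (hK : t.1.card + 1 = K) : t ∈ T'.tiles := by
  obtain ⟨p, q, hpq, e⟩ := T.exists_lt_of_mem ht
  obtain ⟨B, D⟩ := t
  obtain rfl : D = {p, q} := congrArg Prod.snd e
  obtain ⟨hp, hq⟩ := T.notMem_of_tile ht
  obtain ⟨A, i, j, hij, ht', -, e1, e2⟩ := (h'.edges _ _).1
    ((h.edges (insert p B) (insert q B)).2 ⟨B, p, q, hpq, ht, hK, rfl, rfl⟩)
  obtain ⟨hi, hj⟩ := T'.notMem_of_tile ht'
  have hAB : B = A := by
    have h1 : insert p B ∩ insert q B = B := by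
      ext m; simp only [Finset.mem_inter, Finset.mem_insert]; grind
    have h2 : insert i A ∩ insert j A = A := by
      ext m; simp only [Finset.mem_inter, Finset.mem_insert]; grind
    rw [← h1, e1, e2, h2]
  subst hAB
  have hpi : p = i := by
    have : p ∈ insert i B := by rw [← e1]; simp
    exact (Finset.mem_insert.1 this).resolve_right hp
  have hqj : q = j := by
    have : q ∈ insert j B := by rw [← e2]; simp
    exact (Finset.mem_insert.1 this).resolve_right hq
  rwa [hpi, hqj]

/-! ### The effect of flips on cross-sections -/

theorem IsCrossSection.remove (ha : StrictMono a) {T T' : Tiling a} {K : ℕ} (h0 : 0 < K)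
    (hK : K ≤ n) {L M : List (Finset (Fin n))} {P Q R : Finset (Fin n)}
    (h : IsCrossSection T K (L ++ P :: Q :: R :: M)) (hPR : T'.Step K P R)
    (hT : ∀ S S', S ≠ Q → S' ≠ Q → T.Step K S S' → T'.Step K S S') :
    IsCrossSection T' K (L ++ P :: R :: M) := by
  obtain ⟨h1, h2, h3⟩ := (isCrossSection_iff ha h0 hK).1 h
  have hnd := nodup_of_isChain_monotoneStep h.hyper.2.1
  have hQ : Q ∉ L ++ [P] ∧ Q ∉ R :: M := by
    have e : L ++ P :: Q :: R :: M = (L ++ [P]) ++ Q :: (R :: M) := by simp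
    rw [e, List.nodup_middle, List.nodup_cons, List.mem_append, not_or] at hnd
    exact hnd.1
  have hchain : ∀ l : List (Finset (Fin n)), Q ∉ l → l.IsChain (T.Step K) →
      l.IsChain (T'.Step K) := by
    intro l hl hc
    rw [List.IsChain.iff_mem] at hc
    exact hc.imp fun S S' ⟨e1, e2, e3⟩ =>
      hT S S' (by rintro rfl; exact hl e1) (by rintro rfl; exact hl e2) e3
  rw [List.isChain_append_cons_cons, List.isChain_cons_cons] at h1
  refine (isCrossSection_iff ha h0 hK).2 ⟨?_, ?_, ?_⟩
  · exact List.isChain_append_cons_cons.2 ⟨hchain _ hQ.1 h1.1, hPR, hchain _ hQ.2 h1.2.2.2⟩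
  · rw [← h2]
    cases L <;> rfl
  · rw [← h3]
    simp [List.getLast?_append, List.getLast?_cons_cons]

theorem pair_eq_pair {p q i j : Fin n} (hpq : p < q) (hij : i < j)
    (h : ({p, q} : Finset (Fin n)) = {i, j}) : p = i ∧ q = j := by
  have h1 : p ∈ ({i, j} : Finset (Fin n)) := by rw [← h]; simp
  have h2 : q ∈ ({i, j} : Finset (Fin n)) := by rw [← h]; simp
  simp only [Finset.mem_insert, Finset.mem_singleton] at h1 h2
  grind

/-- The tiles of this size that disappear are the two whose diagonals meet in the lower interior
vertex `A ∪ {j}`. -/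
theorem RaisingFlip.step_of_card {T T' : Tiling a} {A : Finset (Fin n)} {i j l : Fin n} {K : ℕ}
    (h : RaisingFlip T T' A i j l) (hA : A.card + 1 = K) {S S' : Finset (Fin n)}
    (hS : S ≠ insert j A) (hS' : S' ≠ insert j A) (hs : T.Step K S S') : T'.Step K S S' := by
  obtain ⟨B, p, q, hpq, ht, hB, rfl, rfl⟩ := hs
  obtain ⟨hij, hjl, hi, hj, hl⟩ := id h.hexagon
  refine ⟨B, p, q, hpq, ?_, hB, rfl, rfl⟩
  by_contra hn
  rcases h.mem_iff (B, {p, q}) with ⟨hm, -⟩ | ⟨-, hm, -⟩ | ⟨-, -, hm⟩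
  · simp only [lowerTiles, Finset.mem_insert, Finset.mem_singleton, Prod.mk.injEq] at hm
    rcases hm with ⟨rfl, e⟩ | ⟨rfl, e⟩ | ⟨rfl, e⟩
    · exact hS' (by rw [(pair_eq_pair hpq hij e).2])
    · exact hS (by rw [(pair_eq_pair hpq hjl e).1])
    · rw [Finset.card_insert_of_notMem hj] at hB; omega
  · exact hm ht
  · exact hn (hm.1 ht)

theorem RaisingFlip.step_of_card' {T T' : Tiling a} {A : Finset (Fin n)} {i j l : Fin n} {K : ℕ}
    (h : RaisingFlip T T' A i j l) (hA : A.card + 2 = K) {S S' : Finset (Fin n)}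
    (hS : S ≠ insert i (insert l A)) (hS' : S' ≠ insert i (insert l A)) (hs : T'.Step K S S') :
    T.Step K S S' := by
  obtain ⟨B, p, q, hpq, ht, hB, rfl, rfl⟩ := hs
  obtain ⟨hij, hjl, hi, hj, hl⟩ := id h.hexagon
  refine ⟨B, p, q, hpq, ?_, hB, rfl, rfl⟩
  by_contra hn
  rcases h.mem_iff (B, {p, q}) with ⟨-, hm, -⟩ | ⟨hm, -⟩ | ⟨-, -, hm⟩
  · exact hn hm
  · simp only [upperTiles, Finset.mem_insert, Finset.mem_singleton, Prod.mk.injEq] at hm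
    rcases hm with ⟨rfl, e⟩ | ⟨rfl, e⟩ | ⟨rfl, e⟩
    · exact hS' (by rw [(pair_eq_pair hpq hjl e).2, Finset.insert_comm])
    · exact hS (by rw [(pair_eq_pair hpq hij e).1])
    · omega
  · exact hn (hm.2 ht)

theorem IsCrossSection.exists_triple (ha : StrictMono a) {T : Tiling a} {K : ℕ}
    {H : List (Finset (Fin n))} (h : IsCrossSection T K H) {P Q R : Finset (Fin n)}
    (h1 : T.Step K P Q) (h2 : T.Step K Q R) : ∃ L M, H = L ++ P :: Q :: R :: M := by
  have hP : P ∈ H := (h.vertices P).2 ⟨h1.vertices.1, h1.card_left⟩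
  obtain ⟨y, L, M, rfl⟩ := exists_infix_of_mem hP h.hyper.2.2.2
    (by rintro rfl; exact not_monotoneStep_lastSet h1.monotoneStep)
  have hc := h.isChain
  rw [List.isChain_append_cons_cons] at hc
  obtain rfl := T.step_rightUnique ha K h1 hc.2.1
  cases M with
  | nil =>
    have := h.hyper.2.2.2
    rw [List.getLast?_append_cons, List.getLast?_cons_cons, List.getLast?_singleton,
      Option.some.injEq] at this
    rw [this] at h2
    exact absurd h2.monotoneStep not_monotoneStep_lastSet
  | cons z M =>
    obtain rfl := T.step_rightUnique ha K h2 (List.isChain_cons_cons.1 hc.2.2).1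
    exact ⟨L, M, rfl⟩

theorem RaisingFlip.steps_upper {T T' : Tiling a} {A : Finset (Fin n)} {i j l : Fin n} {K : ℕ}
    (h : RaisingFlip T T' A i j l) (hA : A.card + 2 = K) :
    T'.Step K (insert i (insert j A)) (insert i (insert l A)) ∧
      T'.Step K (insert i (insert l A)) (insert j (insert l A)) ∧
      T.Step K (insert i (insert j A)) (insert j (insert l A)) := by
  obtain ⟨hij, hjl, hi, hj, hl⟩ := id h.hexagon
  obtain ⟨t1, t2, t3⟩ := h.mem_right
  refine ⟨⟨_, j, l, hjl, t1, ?_, ?_, ?_⟩, ⟨_, i, j, hij, t2, ?_, rfl, rfl⟩,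
    ⟨_, i, l, hij.trans hjl, h.mem_left.2.2, ?_, rfl, ?_⟩⟩
  · rw [Finset.card_insert_of_notMem hi, hA]
  · rw [Finset.insert_comm]
  · rw [Finset.insert_comm]
  · rw [Finset.card_insert_of_notMem hl, hA]
  · rw [Finset.card_insert_of_notMem hj, hA]
  · rw [Finset.insert_comm]

theorem RaisingFlip.steps_lower {T T' : Tiling a} {A : Finset (Fin n)} {i j l : Fin n} {K : ℕ}
    (h : RaisingFlip T T' A i j l) (hA : A.card + 1 = K) :
    T.Step K (insert i A) (insert j A) ∧ T.Step K (insert j A) (insert l A) ∧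
      T'.Step K (insert i A) (insert l A) := by
  obtain ⟨hij, hjl, -, -, -⟩ := id h.hexagon
  obtain ⟨t1, t2, t3⟩ := h.mem_left
  exact ⟨⟨_, i, j, hij, t1, hA, rfl, rfl⟩, ⟨_, j, l, hjl, t2, hA, rfl, rfl⟩,
    ⟨_, i, l, hij.trans hjl, h.mem_right.2.2, hA, rfl, rfl⟩⟩

theorem RaisingFlip.crossSection_congr {T T' : Tiling a} {A : Finset (Fin n)} {i j l : Fin n}
    {K : ℕ} (ha : StrictMono a) (h0 : 0 < K) (hK : K ≤ n) (h : RaisingFlip T T' A i j l)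
    (h1 : A.card + 1 ≠ K) (h2 : A.card + 2 ≠ K) {H : List (Finset (Fin n))}
    (hH : IsCrossSection T K H) : IsCrossSection T' K H := by
  obtain ⟨-, -, hi, hj, hl⟩ := id h.hexagon
  refine hH.congr ha h0 hK fun t ht htT => ?_
  rcases h.mem_iff t with ⟨hm, -⟩ | ⟨-, -, hm⟩ | ⟨-, -, hm⟩
  · simp only [lowerTiles, Finset.mem_insert, Finset.mem_singleton] at hm
    rcases hm with rfl | rfl | rfl
    · exact absurd ht h1
    · exact absurd ht h1
    · simp only [Finset.card_insert_of_notMem hj] at ht; exact absurd ht h2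
  · exact hm
  · exact hm.1 htT

/-! ### Reduction of hypertriangulations -/

/-- A step between sets with `K` elements. -/
def CardStep (K : ℕ) (S S' : Finset (Fin n)) : Prop := MonotoneStep S S' ∧ S.card = K

/-- The middle vertex of the triple violates reducedness. -/
def Violates (K : ℕ) (S₁ S₂ S₃ : Finset (Fin n)) : Prop := (S₁ ∩ S₂ ∩ S₃).card + 2 ≠ K

instance (K : ℕ) (S₁ S₂ S₃ : Finset (Fin n)) : Decidable (Violates K S₁ S₂ S₃) :=
  inferInstanceAs (Decidable (_ ≠ _))

theorem CardStep.card_inter {K : ℕ} {S S' : Finset (Fin n)} (h : CardStep K S S') :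
    (S ∩ S').card + 1 = K := by
  obtain ⟨⟨I, i, j, hij, hi, hj, rfl, rfl⟩, hK⟩ := h
  have : insert i I ∩ insert j I = I := by
    ext m; simp only [Finset.mem_inter, Finset.mem_insert]; grind
  rw [this, ← hK, Finset.card_insert_of_notMem hi]

/-- The bases `S₁ ∩ S₂` and `S₂ ∩ S₃` are subsets of the `K`-element set `S₂` with `K - 1` elements
each. If they differ, their union is `S₂` and they meet in `K - 2` elements. -/
theorem violates_iff {K : ℕ} {S₁ S₂ S₃ : Finset (Fin n)} (h₁ : CardStep K S₁ S₂)
    (h₂ : CardStep K S₂ S₃) : Violates K S₁ S₂ S₃ ↔ S₁ ∩ S₂ = S₂ ∩ S₃ := by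
  have c1 := h₁.card_inter
  have c2 := h₂.card_inter
  have e : S₁ ∩ S₂ ∩ S₃ = (S₁ ∩ S₂) ∩ (S₂ ∩ S₃) := by
    ext m; simp only [Finset.mem_inter]; tauto
  unfold Violates
  rw [e]
  constructor
  · intro h
    by_contra hne
    have h1 : (S₁ ∩ S₂) ⊂ (S₁ ∩ S₂) ∪ (S₂ ∩ S₃) := by
      refine Finset.subset_union_left.ssubset_of_ne fun e' => hne ?_
      have : S₂ ∩ S₃ ⊆ S₁ ∩ S₂ := by rw [e']; exact Finset.subset_union_right
      exact (Finset.eq_of_subset_of_card_le this (by omega)).symm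
    have h2 := Finset.card_lt_card h1
    have h3 := Finset.card_le_card
      (Finset.union_subset (Finset.inter_subset_right (s₁ := S₁) (s₂ := S₂))
        (Finset.inter_subset_left (s₁ := S₂) (s₂ := S₃)))
    have h4 := Finset.card_union_add_card_inter (S₁ ∩ S₂) (S₂ ∩ S₃)
    have h5 := h₂.2
    omega
  · intro h
    rw [← h, Finset.inter_self]
    omega

/-- Two steps `i → j → q` with a common base merge into `i → q`. The base is kept, so later tests
for violations at the neighbours have the same outcome. -/
theorem CardStep.trans_of_violates {K : ℕ} {S₁ S₂ S₃ : Finset (Fin n)} (h₁ : CardStep K S₁ S₂)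
    (h₂ : CardStep K S₂ S₃) (h : Violates K S₁ S₂ S₃) :
    CardStep K S₁ S₃ ∧ S₁ ∩ S₃ = S₁ ∩ S₂ := by
  rw [violates_iff h₁ h₂] at h
  obtain ⟨⟨I, i, j, hij, hi, hj, rfl, rfl⟩, hK⟩ := h₁
  obtain ⟨⟨J, p, q, hpq, hp, hq, e, rfl⟩, -⟩ := h₂
  have hI : insert i I ∩ insert j I = I := by
    ext m; simp only [Finset.mem_inter, Finset.mem_insert]; grind
  have hJ : insert p J ∩ insert q J = J := by
    ext m; simp only [Finset.mem_inter, Finset.mem_insert]; grind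
  rw [hI, e, hJ] at h
  subst h
  have hjp : j = p := by
    have : j ∈ insert p I := by rw [← e]; simp
    exact (Finset.mem_insert.1 this).resolve_right hj
  subst hjp
  refine ⟨⟨⟨I, i, q, hij.trans hpq, hi, hq, rfl, rfl⟩, hK⟩, ?_⟩
  rw [hI]
  ext m; simp only [Finset.mem_inter, Finset.mem_insert]; grind

/-- The result of throwing away all vertices that violate reducedness. -/
def reduce (K : ℕ) : List (Finset (Fin n)) → List (Finset (Fin n))
  | S₁ :: S₂ :: S₃ :: H =>
    if Violates K S₁ S₂ S₃ then reduce K (S₁ :: S₃ :: H) else S₁ :: reduce K (S₂ :: S₃ :: H)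
  | H => H
termination_by H => H.length

theorem reduce_of_violates {K : ℕ} {S₁ S₂ S₃ : Finset (Fin n)} {H : List (Finset (Fin n))}
    (h : Violates K S₁ S₂ S₃) :
    reduce K (S₁ :: S₂ :: S₃ :: H) = reduce K (S₁ :: S₃ :: H) := by
  rw [reduce, if_pos h]

theorem reduce_of_not_violates {K : ℕ} {S₁ S₂ S₃ : Finset (Fin n)} {H : List (Finset (Fin n))}
    (h : ¬ Violates K S₁ S₂ S₃) :
    reduce K (S₁ :: S₂ :: S₃ :: H) = S₁ :: reduce K (S₂ :: S₃ :: H) := by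
  rw [reduce, if_neg h]

theorem reduce_eq_self {K : ℕ} {H : List (Finset (Fin n))} (h : IsReduced K H) :
    reduce K H = H := by
  induction H with
  | nil => simp [reduce]
  | cons S₁ H ih =>
    match H with
    | [] => simp [reduce]
    | [S₂] => simp [reduce]
    | S₂ :: S₃ :: H =>
      rw [reduce_of_not_violates (by simpa [Violates] using h S₁ S₂ S₃ ⟨[], H, by simp⟩),
        ih fun A₁ A₂ A₃ h' => h A₁ A₂ A₃ (h'.trans (List.suffix_cons _ _).isInfix)]

theorem reduce_subset (K : ℕ) (H : List (Finset (Fin n))) : reduce K H ⊆ H := by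
  fun_induction reduce K H with
  | case1 S₁ S₂ S₃ H h ih =>
    intro S hS
    have := ih hS
    simp only [List.mem_cons] at this ⊢
    tauto
  | case2 S₁ S₂ S₃ H h ih =>
    intro S hS
    rcases List.mem_cons.1 hS with rfl | hS
    · simp
    · exact List.mem_cons_of_mem _ (ih hS)
  | case3 H h => exact List.Subset.refl _

theorem head_mem_reduce (K : ℕ) (S : Finset (Fin n)) (H : List (Finset (Fin n))) :
    S ∈ reduce K (S :: H) := by
  induction hN : H.length generalizing H with
  | zero =>
    obtain rfl := List.eq_nil_of_length_eq_zero hN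
    simp [reduce]
  | succ N ih =>
    match H with
    | [S₂] => simp [reduce]
    | S₂ :: S₃ :: H =>
      by_cases h : Violates K S S₂ S₃
      · rw [reduce_of_violates h]
        exact ih _ (by simpa using hN)
      · rw [reduce_of_not_violates h]
        simp

/-- Confluence of the reduction: the greedy procedure compares bases only, and removing a violating
vertex merely shortens a run of steps with equal base. -/
theorem reduce_remove {K : ℕ} (L : List (Finset (Fin n))) {S₁ S₂ S₃ : Finset (Fin n)}
    {M : List (Finset (Fin n))} (hc : (L ++ S₁ :: S₂ :: S₃ :: M).IsChain (CardStep K))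
    (h : Violates K S₁ S₂ S₃) :
    reduce K (L ++ S₁ :: S₂ :: S₃ :: M) = reduce K (L ++ S₁ :: S₃ :: M) := by
  induction hN : L.length generalizing L with
  | zero =>
    obtain rfl := List.eq_nil_of_length_eq_zero hN
    exact reduce_of_violates h
  | succ N ih =>
    match L with
    | [x] =>
      simp only [List.cons_append, List.nil_append, List.isChain_cons_cons] at hc ⊢
      obtain ⟨h1, h2, h3, -⟩ := hc
      obtain ⟨h13, e13⟩ := h2.trans_of_violates h3 h
      by_cases hx : Violates K x S₁ S₂
      · obtain ⟨hx2, ex2⟩ := h1.trans_of_violates h2 hx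
        have hx3 : Violates K x S₂ S₃ := by
          rw [violates_iff hx2 h3, ex2, (violates_iff h1 h2).1 hx, (violates_iff h2 h3).1 h]
        have hx' : Violates K x S₁ S₃ := by
          rw [violates_iff h1 h13, e13, (violates_iff h1 h2).1 hx]
        rw [reduce_of_violates hx, reduce_of_violates hx3, reduce_of_violates hx']
      · have hx' : ¬ Violates K x S₁ S₃ := by
          rwa [violates_iff h1 h13, e13, ← violates_iff h1 h2]
        rw [reduce_of_not_violates hx, reduce_of_violates h, reduce_of_not_violates hx']
    | x :: y :: L =>
      -- With two elements in front, the first three entries of both lists coincide, so the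
      -- procedure makes the same decision on both.
      obtain ⟨z, t, t', e, e'⟩ : ∃ z t t', L ++ S₁ :: S₂ :: S₃ :: M = z :: t ∧
          L ++ S₁ :: S₃ :: M = z :: t' := by
        cases L with
        | nil => exact ⟨_, _, _, rfl, rfl⟩
        | cons z L => exact ⟨_, _, _, rfl, rfl⟩
      have ihx := ih (x :: L)
      have ihy := ih (y :: L)
      simp only [List.cons_append, e, e', List.isChain_cons_cons, List.length_cons] at hc ihx ihy hN ⊢
      by_cases hx : Violates K x y z
      · rw [reduce_of_violates hx, reduce_of_violates hx]
        exact ihx ⟨(hc.1.trans_of_violates hc.2.1 hx).1, hc.2.2⟩ (by omega)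
      · rw [reduce_of_not_violates hx, reduce_of_not_violates hx, ihy hc.2 (by omega)]

/-- A vertex at which the base changes survives, since merging earlier steps preserves the base of
the step into it. -/
theorem mem_reduce_of_not_violates {K : ℕ} (L : List (Finset (Fin n)))
    {S₁ S₂ S₃ : Finset (Fin n)} {M : List (Finset (Fin n))}
    (hc : (L ++ S₁ :: S₂ :: S₃ :: M).IsChain (CardStep K)) (h : ¬ Violates K S₁ S₂ S₃) :
    S₂ ∈ reduce K (L ++ S₁ :: S₂ :: S₃ :: M) := by
  induction hN : L.length generalizing L S₁ with
  | zero =>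
    obtain rfl := List.eq_nil_of_length_eq_zero hN
    rw [List.nil_append, reduce_of_not_violates h]
    exact List.mem_cons_of_mem _ (head_mem_reduce _ _ _)
  | succ N ih =>
    match L with
    | [x] =>
      have ihx := ih [] (S₁ := x)
      have ihs := ih [] (S₁ := S₁)
      simp only [List.cons_append, List.nil_append, List.isChain_cons_cons] at hc ihx ihs ⊢
      obtain ⟨h1, h2, h3, h4⟩ := hc
      by_cases hx : Violates K x S₁ S₂
      · obtain ⟨hx2, ex2⟩ := h1.trans_of_violates h2 hx
        rw [reduce_of_violates hx]
        refine ihx ⟨hx2, h3, h4⟩ ?_ (by simp only [List.length_cons, List.length_nil] at hN ⊢; omega)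
        rwa [violates_iff hx2 h3, ex2, (violates_iff h1 h2).1 hx, ← violates_iff h2 h3]
      · rw [reduce_of_not_violates hx]
        exact List.mem_cons_of_mem _ (ihs ⟨h2, h3, h4⟩ h (by simp only [List.length_cons, List.length_nil] at hN ⊢; omega))
    | x :: y :: L =>
      obtain ⟨z, t, e⟩ : ∃ z t, L ++ S₁ :: S₂ :: S₃ :: M = z :: t := by
        cases L with
        | nil => exact ⟨_, _, rfl⟩
        | cons z L => exact ⟨_, _, rfl⟩
      have ihx := ih (x :: L) (S₁ := S₁)
      have ihy := ih (y :: L) (S₁ := S₁)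
      simp only [List.cons_append, e, List.isChain_cons_cons, List.length_cons] at hc ihx ihy hN ⊢
      by_cases hx : Violates K x y z
      · rw [reduce_of_violates hx]
        exact ihx ⟨(hc.1.trans_of_violates hc.2.1 hx).1, hc.2.2⟩ h (by omega)
      · rw [reduce_of_not_violates hx]
        exact List.mem_cons_of_mem _ (ihy hc.2 h (by omega))

theorem IsHypertriangulation.isChain_cardStep {K : ℕ} {H : List (Finset (Fin n))}
    (h : IsHypertriangulation K H) : H.IsChain (CardStep K) := by
  have h2 := h.2.1
  rw [List.IsChain.iff_mem] at h2
  exact h2.imp fun S S' h' => ⟨h'.2.2, h.1 S h'.1⟩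

theorem ReductionStep.isChain {K : ℕ} {H H' : List (Finset (Fin n))}
    (h : ReductionStep K H H') (hc : H.IsChain (CardStep K)) : H'.IsChain (CardStep K) := by
  obtain ⟨L, M, S₁, S₂, S₃, rfl, rfl, hv⟩ := h
  rw [List.isChain_append_cons_cons, List.isChain_cons_cons] at hc
  exact List.isChain_append_cons_cons.2
    ⟨hc.1, (hc.2.1.trans_of_violates hc.2.2.1 hv).1, hc.2.2.2⟩

theorem reduce_eq_of_reductions {K : ℕ} {H H' : List (Finset (Fin n))}
    (h : Relation.ReflTransGen (ReductionStep K) H H') (hc : H.IsChain (CardStep K)) :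
    reduce K H = reduce K H' := by
  induction h using Relation.ReflTransGen.head_induction_on with
  | refl => rfl
  | head hs _ ih =>
    refine Eq.trans ?_ (ih (hs.isChain hc))
    obtain ⟨L, M, S₁, S₂, S₃, rfl, rfl, hv⟩ := hs
    exact reduce_remove L hc hv

theorem ReducesTo.reduce_eq {K : ℕ} {H : List (Finset (Fin n))} {R : ReducedLifting a K}
    (h : ReducesTo H R) (hH : IsHypertriangulation K H) : reduce K H = R.1 :=
  (reduce_eq_of_reductions h hH.isChain_cardStep).trans (reduce_eq_self R.2.2)

/-! ### Equivalence classes and reduced hypertriangulations -/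

/-- A violating vertex is the common corner of two neighbouring tiles above a `k`-element set.
Merging them uses flips of levels above `k` only and deletes exactly this vertex from the
cross-section. In particular reductions of lifting hypertriangulations are lifting. -/
theorem exists_tiling_of_reductionStep (ha : StrictMono a) (hk : k + 2 ≤ n) {T : Tiling a}
    {H H' : List (Finset (Fin n))} (hH : IsCrossSection T (k + 1) H)
    (h : ReductionStep (k + 1) H H') :
    ∃ T', kEquivalence a k T T' ∧ IsCrossSection T' (k + 1) H' := by
  obtain ⟨L, M, S₁, S₂, S₃, rfl, rfl, hv⟩ := h
  have hc := hH.hyper.isChain_cardStep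
  rw [List.isChain_append_cons_cons, List.isChain_cons_cons] at hc
  have hv := (violates_iff hc.2.1 hc.2.2.1).1 hv
  have hs := hH.isChain
  rw [List.isChain_append_cons_cons, List.isChain_cons_cons] at hs
  obtain ⟨-, ⟨A, i, j, hij, h₁, hA, rfl, rfl⟩, ⟨B, p, l, hpl, h₂, hB, e, rfl⟩, -⟩ := hs
  obtain ⟨hi, hj⟩ := T.notMem_of_tile h₁
  obtain ⟨hp, hl⟩ := T.notMem_of_tile h₂
  have e1 : insert i A ∩ insert j A = A := by
    ext m; simp only [Finset.mem_inter, Finset.mem_insert]; grind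
  have e2 : insert p B ∩ insert l B = B := by
    ext m; simp only [Finset.mem_inter, Finset.mem_insert]; grind
  rw [e1, e, e2] at hv
  subst hv
  obtain rfl : j = p := by
    have : j ∈ insert p A := by rw [← e]; simp
    exact (Finset.mem_insert.1 this).resolve_right hj
  obtain ⟨T', T'', hr, hf⟩ := T.exists_raises_raisingFlip ha hij hpl h₁ h₂
  have hH' : IsCrossSection T' (k + 1) _ :=
    hH.congr ha (by omega) (by omega) fun t ht => (hr.mem_iff (by omega)).1
  refine ⟨T'', (kEquivalence a k).trans' (hr.equiv ha (by omega)) (kEquivalence_of_flip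
    (m := A.card + 1) (by omega) ((flipAtLevel_iff ha).2 ⟨A, i, j, l, Or.inl hf, rfl⟩)), ?_⟩
  exact hH'.remove ha (by omega) (by omega) (hf.steps_lower hA).2.2
    fun S S' => hf.step_of_card hA

theorem exists_tiling_of_reductions (ha : StrictMono a) (hk : k + 2 ≤ n) {T : Tiling a}
    {H H' : List (Finset (Fin n))} (hH : IsCrossSection T (k + 1) H)
    (h : Relation.ReflTransGen (ReductionStep (k + 1)) H H') :
    ∃ T', kEquivalence a k T T' ∧ IsCrossSection T' (k + 1) H' := by
  induction h with
  | refl => exact ⟨T, (kEquivalence a k).refl' T, hH⟩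
  | tail _ h ih =>
    obtain ⟨T', h1, h2⟩ := ih
    obtain ⟨T'', h3, h4⟩ := exists_tiling_of_reductionStep ha hk h2 h
    exact ⟨T'', (kEquivalence a k).trans' h1 h3, h4⟩

theorem exists_isReduced (K : ℕ) (H : List (Finset (Fin n))) :
    ∃ H', Relation.ReflTransGen (ReductionStep K) H H' ∧ IsReduced K H' := by
  induction hN : H.length using Nat.strong_induction_on generalizing H with
  | _ N ih =>
  by_cases hr : IsReduced K H
  · exact ⟨H, Relation.ReflTransGen.refl, hr⟩
  simp only [IsReduced] at hr
  push Not at hr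
  obtain ⟨S₁, S₂, S₃, ⟨L, M, rfl⟩, hv⟩ := hr
  obtain ⟨H', h1, h2⟩ := ih (L ++ S₁ :: S₃ :: M).length
    (by rw [← hN]; simp) (L ++ S₁ :: S₃ :: M) rfl
  exact ⟨H', Relation.ReflTransGen.head ⟨L, M, S₁, S₂, S₃, by simp, rfl, hv⟩ h1, h2⟩

/-- The reduced hypertriangulation `R` is the reduction of the cross-section of `T`. -/
def ReducesToSection (T : Tiling a) (R : ReducedLifting a (k + 1)) : Prop :=
  ∃ H, IsCrossSection T (k + 1) H ∧ ReducesTo H R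

theorem exists_reducesTo (ha : StrictMono a) (hk : k + 2 ≤ n) {T : Tiling a}
    {H : List (Finset (Fin n))} (hH : IsCrossSection T (k + 1) H) :
    ∃ R : ReducedLifting a (k + 1), ReducesTo H R := by
  obtain ⟨H', h1, h2⟩ := exists_isReduced (k + 1) H
  obtain ⟨T', -, h⟩ := exists_tiling_of_reductions ha hk hH h1
  exact ⟨⟨H', ⟨h.hyper, T', h⟩, h2⟩, h1⟩

theorem reducesToSection_iff (ha : StrictMono a) (hk : k + 2 ≤ n) {T : Tiling a}
    {H : List (Finset (Fin n))} (hH : IsCrossSection T (k + 1) H) {R : ReducedLifting a (k + 1)} :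
    ReducesToSection T R ↔ reduce (k + 1) H = R.1 := by
  constructor
  · rintro ⟨H', h1, h2⟩
    rw [hH.unique ha h1]
    exact h2.reduce_eq h1.hyper
  · intro h
    obtain ⟨R', h'⟩ := exists_reducesTo ha hk hH
    have : R' = R := Subtype.ext ((h'.reduce_eq hH.hyper).symm.trans h)
    exact ⟨H, hH, this ▸ h'⟩

theorem exists_reducesToSection (ha : StrictMono a) (hk : k + 2 ≤ n) (T : Tiling a) :
    ∃ R : ReducedLifting a (k + 1), ReducesToSection T R := by
  obtain ⟨H, hH⟩ := T.exists_crossSection ha (K := k + 1) (by omega) (by omega)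
  obtain ⟨R, hR⟩ := exists_reducesTo ha hk hH
  exact ⟨R, H, hH, hR⟩

theorem ReducesToSection.unique (ha : StrictMono a) (hk : k + 2 ≤ n) {T : Tiling a}
    {R R' : ReducedLifting a (k + 1)} (h : ReducesToSection T R) (h' : ReducesToSection T R') :
    R = R' := by
  obtain ⟨H, hH⟩ := T.exists_crossSection ha (K := k + 1) (by omega) (by omega)
  rw [reducesToSection_iff ha hk hH] at h h'
  exact Subtype.ext (h.symm.trans h')

/-- A flip of level `k + 1` removes a vertex that violates reducedness; flips of levels other than
`k` and `k + 1` do not touch this cross-section. -/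
theorem RaisingFlip.reduce_eq (ha : StrictMono a) (hk : k + 2 ≤ n) {T T' : Tiling a}
    {A : Finset (Fin n)} {i j l : Fin n} (h : RaisingFlip T T' A i j l) (hA : A.card + 1 ≠ k)
    {H H' : List (Finset (Fin n))} (hH : IsCrossSection T (k + 1) H)
    (hH' : IsCrossSection T' (k + 1) H') : reduce (k + 1) H = reduce (k + 1) H' := by
  by_cases hAk : A.card + 1 = k + 1
  · obtain ⟨s1, s2, s3⟩ := h.steps_lower hAk
    obtain ⟨L, M, rfl⟩ := hH.exists_triple ha s1 s2
    have h2 := hH.remove ha (by omega) (by omega) s3 fun S S' => h.step_of_card hAk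
    rw [hH'.unique ha h2]
    refine reduce_remove L hH.hyper.isChain_cardStep ?_
    rw [violates_iff ⟨s1.monotoneStep, s1.card_left⟩ ⟨s2.monotoneStep, s2.card_left⟩]
    obtain ⟨hij, hjl, hi, hj, hl⟩ := id h.hexagon
    ext m; simp only [Finset.mem_inter, Finset.mem_insert]; grind
  · rw [(h.crossSection_congr ha (by omega) (by omega) hAk (by omega) hH).unique ha hH']

theorem reducesToSection_congr (ha : StrictMono a) (hk : k + 2 ≤ n) {T T' : Tiling a}
    (h : kEquivalence a k T T') (R : ReducedLifting a (k + 1)) :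
    ReducesToSection T R ↔ ReducesToSection T' R := by
  induction h with
  | rel T T' h =>
    obtain ⟨m, hm, hf⟩ := h
    obtain ⟨A, i, j, l, h, rfl⟩ := (flipAtLevel_iff ha).1 hf
    obtain ⟨H, hH⟩ := T.exists_crossSection ha (K := k + 1) (by omega) (by omega)
    obtain ⟨H', hH'⟩ := T'.exists_crossSection ha (K := k + 1) (by omega) (by omega)
    rw [reducesToSection_iff ha hk hH, reducesToSection_iff ha hk hH']
    rcases h with h | h
    · rw [h.reduce_eq ha hk hm hH hH']
    · rw [h.reduce_eq ha hk hm hH' hH]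
  | refl => rfl
  | symm _ _ _ ih => exact ih.symm
  | trans _ _ _ _ _ ih ih' => exact ih.trans ih'

theorem kEquivalence_of_crossSection (ha : StrictMono a) (hk : k + 2 ≤ n) {T T' : Tiling a}
    {H : List (Finset (Fin n))} (h : IsCrossSection T (k + 1) H)
    (h' : IsCrossSection T' (k + 1) H) : kEquivalence a k T T' :=
  kEquivalence_of_agree ha hk fun _ ht =>
    ⟨fun h1 => mem_tiles_of_crossSection h h' h1 (by omega),
      fun h1 => mem_tiles_of_crossSection h' h h1 (by omega)⟩

/-- Both tilings can be flipped within their classes until their cross-section is `R` itself; then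
the tiles translated by `k`-element sets agree. -/
theorem ReducesToSection.kEquivalence (ha : StrictMono a) (hk : k + 2 ≤ n) {T T' : Tiling a}
    {R : ReducedLifting a (k + 1)} (h : ReducesToSection T R) (h' : ReducesToSection T' R) :
    kEquivalence a k T T' := by
  obtain ⟨H, h1, h2⟩ := h
  obtain ⟨H', h1', h2'⟩ := h'
  obtain ⟨T₁, h3, h4⟩ := exists_tiling_of_reductions ha hk h1 h2
  obtain ⟨T₁', h3', h4'⟩ := exists_tiling_of_reductions ha hk h1' h2'
  exact HigherSecondary.kEquivalence a k |>.trans' h3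
    ((HigherSecondary.kEquivalence a k).trans' (kEquivalence_of_crossSection ha hk h4 h4')
      ((HigherSecondary.kEquivalence a k).symm' h3'))

/-- The bijection from `k`-equivalence classes to reduced lifting hypertriangulations. -/
noncomputable def classEquiv (ha : StrictMono a) (hk : k + 2 ≤ n) :
    Quotient (kEquivalence a k) ≃ ReducedLifting a (k + 1) :=
  Equiv.ofBijective
    (Quotient.lift (fun T => (exists_reducesToSection ha hk T).choose) fun T T' h =>
      ((reducesToSection_congr ha hk h _).1 (exists_reducesToSection ha hk T).choose_spec).unique
        ha hk (exists_reducesToSection ha hk T').choose_spec)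
    (by
      constructor
      · rintro ⟨T⟩ ⟨T'⟩ h
        have h1 := (exists_reducesToSection ha hk T).choose_spec
        have h2 := (exists_reducesToSection ha hk T').choose_spec
        have h : (exists_reducesToSection ha hk T).choose =
          (exists_reducesToSection ha hk T').choose := h
        rw [h] at h1
        exact Quotient.sound (h1.kEquivalence ha hk h2)
      · intro R
        obtain ⟨⟨hR, T, hT⟩, hred⟩ := R.2
        exact ⟨Quotient.mk _ T, ((exists_reducesToSection ha hk T).choose_spec).unique ha hk
          ⟨R.1, hT, Relation.ReflTransGen.refl⟩⟩)

theorem classEquiv_eq_iff (ha : StrictMono a) (hk : k + 2 ≤ n) (T : Tiling a)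
    (R : ReducedLifting a (k + 1)) :
    classEquiv ha hk (Quotient.mk _ T) = R ↔ ReducesToSection T R := by
  have h := (exists_reducesToSection ha hk T).choose_spec
  constructor
  · rintro rfl
    exact h
  · exact fun h' => h.unique ha hk h'

/-! ### Flips between classes -/

theorem ClassFlip.symm {c c' : Quotient (kEquivalence a k)} (h : ClassFlip c c') :
    ClassFlip c' c := by
  obtain ⟨T, T', h1, h2, h⟩ := h
  exact ⟨T', T, h2, h1, h.symm⟩

theorem RaisingFlip.exists_insertsOne (ha : StrictMono a) (hk : k + 2 ≤ n) {T T' : Tiling a}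
    {A : Finset (Fin n)} {i j l : Fin n} (h : RaisingFlip T T' A i j l) (hA : A.card + 1 = k) :
    ∃ H H', IsCrossSection T (k + 1) H ∧ IsCrossSection T' (k + 1) H' ∧ InsertsOne H H' ∧
      reduce (k + 1) H ≠ reduce (k + 1) H' := by
  obtain ⟨H', hH'⟩ := T'.exists_crossSection ha (K := k + 1) (by omega) (by omega)
  have hA : A.card + 2 = k + 1 := by omega
  obtain ⟨s1, s2, s3⟩ := h.steps_upper hA
  obtain ⟨L, M, rfl⟩ := hH'.exists_triple ha s1 s2
  refine ⟨_, _, hH'.remove ha (by omega) (by omega) s3 fun S S' => h.step_of_card' hA, hH',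
    ⟨L ++ [insert i (insert j A)], insert j (insert l A) :: M, insert i (insert l A),
      by simp, by simp⟩, ?_⟩
  intro e
  have h1 : ¬ Violates (k + 1) (insert i (insert j A)) (insert i (insert l A))
      (insert j (insert l A)) := by
    rw [violates_iff ⟨s1.monotoneStep, s1.card_left⟩ ⟨s2.monotoneStep, s2.card_left⟩]
    obtain ⟨hij, hjl, hi, hj, hl⟩ := id h.hexagon
    intro e
    have : i ∈ insert i (insert l A) ∩ insert j (insert l A) := by rw [← e]; simp
    simp [hij.ne, (hij.trans hjl).ne, hi] at this
  -- The inserted vertex survives reduction on one side and does not occur at all on the other, so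
  -- the two reductions differ.
  have h2 := mem_reduce_of_not_violates L hH'.hyper.isChain_cardStep h1
  rw [← e] at h2
  have h3 := reduce_subset _ _ h2
  have hnd := nodup_of_isChain_monotoneStep hH'.hyper.2.1
  have e : ∀ P Q R : Finset (Fin n), L ++ P :: Q :: R :: M = (L ++ [P]) ++ Q :: (R :: M) := by simp
  rw [e, List.nodup_middle, List.nodup_cons] at hnd
  exact hnd.1 (by simpa using h3)

/-- The tilings may be unrelated, so a flip has to be constructed. The two steps through `S` are
diagonals of two upper facets of a hexagon. In the complementary tiling these are neighbours above
one set and can be merged; transported back, this uses flips below level `k` followed by one flip of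
level `k` that removes `S`. The result has the cross-section of `T`. -/
theorem exists_flip_of_insertion (ha : StrictMono a) (hk : k + 2 ≤ n) {T T' : Tiling a}
    {L M : List (Finset (Fin n))} {P S Q : Finset (Fin n)}
    (hT : IsCrossSection T (k + 1) (L ++ P :: Q :: M))
    (hT' : IsCrossSection T' (k + 1) (L ++ P :: S :: Q :: M))
    (hv : ¬ Violates (k + 1) P S Q) :
    ∃ T₁ T₁', kEquivalence a k T T₁ ∧ kEquivalence a k T' T₁' ∧ FlipAtLevel k T₁ T₁' := by
  have hc := hT'.hyper.isChain_cardStep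
  rw [List.isChain_append_cons_cons, List.isChain_cons_cons] at hc
  rw [violates_iff hc.2.1 hc.2.2.1] at hv
  have hs := hT'.isChain
  rw [List.isChain_append_cons_cons, List.isChain_cons_cons] at hs
  obtain ⟨-, ⟨A₁, x, y, hxy, t₁, c₁, hP, hS⟩, ⟨A₂, p, z, hpz, t₂, c₂, hS', hQ⟩, -⟩ := hs
  have hPQ := hT.hyper.2.1
  rw [List.isChain_append_cons_cons] at hPQ
  obtain ⟨I, u, v, huv, hu, hv', hP', hQ'⟩ := hPQ.2.1
  obtain ⟨hx, hy⟩ := T'.notMem_of_tile t₁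
  obtain ⟨hp, hz⟩ := T'.notMem_of_tile t₂
  -- the three sets are `A ∪ {p, x}`, `A ∪ {p, y}` and `A ∪ {x, y}`
  have hyp : y ≠ p := by
    rintro rfl
    have : A₁ = A₂ := by
      rw [← Finset.erase_insert hy, ← hS, hS', Finset.erase_insert hp]
    subst this
    apply hv
    rw [hP, hQ, hS]
    ext m; simp only [Finset.mem_inter, Finset.mem_insert]; grind
  have hmS : ∀ m, (m = y ∨ m ∈ A₁) ↔ (m = p ∨ m ∈ A₂) := fun m => by
    rw [← Finset.mem_insert, ← Finset.mem_insert, ← hS, ← hS']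
  have hmP : ∀ m, (m = x ∨ m ∈ A₁) ↔ (m = u ∨ m ∈ I) := fun m => by
    rw [← Finset.mem_insert, ← Finset.mem_insert, ← hP, ← hP']
  have hmQ : ∀ m, (m = z ∨ m ∈ A₂) ↔ (m = v ∨ m ∈ I) := fun m => by
    rw [← Finset.mem_insert, ← Finset.mem_insert, ← hQ, ← hQ']
  have hpA₁ : p ∈ A₁ := ((hmS p).2 (Or.inl rfl)).resolve_left hyp.symm
  -- As `P → Q` is a single exchange, the element added by the second step is the one removed by the
  -- first, and `P` loses `p`.
  have hup : u = p := by
    have h1 := hmP p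
    have h2 := hmQ p
    grind
  have hxz : z = x := by
    have h1 := hmP x
    have h2 := hmQ x
    have h3 := hmS x
    grind
  subst hxz hup
  set A := A₁.erase u with hA
  have e₁ : A₁ = insert u A := (Finset.insert_erase hpA₁).symm
  have huA : u ∉ A := by simp [hA]
  have hyA : y ∉ A := fun h => hy (Finset.mem_of_mem_erase h)
  have hzA : z ∉ A := fun h => hx (Finset.mem_of_mem_erase h)
  have e₂ : A₂ = insert y A := by
    ext m
    have := hmS m
    simp only [Finset.mem_insert, hA, Finset.mem_erase]
    grind
  rw [e₁] at t₁ c₁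
  rw [e₂] at t₂ c₂
  have hH : IsHexagon A u z y := ⟨hpz, hxy, huA, hzA, hyA⟩
  set A' := (A ∪ {u, z, y})ᶜ with hA'
  have hcard : A'.card + A.card + 3 = n := hH.card_compl
  have hcA : A.card + 2 = k + 1 := by rw [Finset.card_insert_of_notMem huA] at c₁; exact c₁
  have hcompl : (A' ∪ {u, z, y})ᶜ = A := by
    ext m
    simp only [hA', Finset.mem_compl, Finset.mem_union, Finset.mem_insert, Finset.mem_singleton]
    grind
  have d₁ : (A', {u, z}) ∈ (T'.compl ha).tiles := by
    rw [Tiling.mem_compl_iff ha _ (by simp [hA'])]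
    suffices e : complTile (A', {u, z}) = (insert y A, {u, z}) by rwa [e]
    simp only [complTile, Prod.mk.injEq, and_true]
    ext m
    simp only [hA', Finset.mem_compl, Finset.mem_union, Finset.mem_insert, Finset.mem_singleton]
    grind
  have d₂ : (A', {z, y}) ∈ (T'.compl ha).tiles := by
    rw [Tiling.mem_compl_iff ha _ (by simp [hA'])]
    suffices e : complTile (A', {z, y}) = (insert u A, {z, y}) by rwa [e]
    simp only [complTile, Prod.mk.injEq, and_true]
    ext m
    simp only [hA', Finset.mem_compl, Finset.mem_union, Finset.mem_insert, Finset.mem_singleton]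
    grind
  obtain ⟨X, Y, hr, hf⟩ := (T'.compl ha).exists_raises_raisingFlip ha hpz hxy d₁ d₂
  have hf' := hf.compl ha
  rw [hcompl] at hf'
  have heq := hr.equiv_compl ha (k := k) (by omega)
  rw [Tiling.compl_compl] at heq
  -- The preparatory flips exchange tiles translated by sets with fewer than `k` elements only, so
  -- the cross-section at level `k + 1` is unchanged.
  have hX : IsCrossSection (X.compl ha) (k + 1) (L ++ P :: S :: Q :: M) := by
    refine hT'.congr ha (by omega) (by omega) fun t ht htT => ?_
    have hd := T'.disjoint t htT
    have := card_complTile hd (T'.card_eq_two t htT)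
    rw [Tiling.mem_compl_iff ha _ hd, ← hr.mem_iff (by omega), Tiling.mem_compl_iff ha _
      (disjoint_complTile t), complTile_complTile hd]
    exact htT
  have eP : P = insert u (insert z A) := by rw [hP, e₁, Finset.insert_comm]
  have eS : S = insert u (insert y A) := by rw [hS, e₁, Finset.insert_comm]
  have eQ : Q = insert z (insert y A) := by rw [hQ, e₂]
  have hY : IsCrossSection (Y.compl ha) (k + 1) (L ++ P :: Q :: M) := by
    refine hX.remove ha (by omega) (by omega) ?_ fun S₁ S₂ => ?_
    · rw [eP, eQ]
      exact (hf'.steps_upper hcA).2.2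
    · rw [eS]
      exact hf'.step_of_card' hcA
  exact ⟨Y.compl ha, X.compl ha, kEquivalence_of_crossSection ha hk hT hY, heq,
    (flipAtLevel_iff ha).2 ⟨A, u, z, y, Or.inl hf', by omega⟩⟩

/-- The inserted set cannot be at an end: no step leads into the first set or out of the last one.
-/
theorem InsertsOne.exists_middle {K : ℕ} {H H' : List (Finset (Fin n))}
    (hH : IsHypertriangulation K H) (hH' : IsHypertriangulation K H') (h : InsertsOne H H') :
    ∃ L M P S Q, H = L ++ P :: Q :: M ∧ H' = L ++ P :: S :: Q :: M := by
  obtain ⟨L, M, S, rfl, rfl⟩ := h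
  obtain ⟨-, -, f1, l1⟩ := hH
  obtain ⟨-, c2, f2, l2⟩ := hH'
  rcases List.eq_nil_or_concat L with rfl | ⟨L, P, rfl⟩
  · cases M with
    | nil => simp at f1
    | cons Q M =>
      simp only [List.nil_append, List.head?_cons, Option.some.injEq] at f1 f2
      simp only [List.nil_append, List.isChain_cons_cons] at c2
      have h := c2.1
      rw [f1] at h
      exact absurd h not_monotoneStep_firstSet
  · cases M with
    | nil =>
      simp only [List.concat_eq_append, List.append_nil, List.append_assoc, List.getLast?_append,
        List.cons_append, List.nil_append, List.getLast?_cons_cons, List.getLast?_singleton,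
        Option.some_or, Option.some.injEq] at l1 l2
      simp only [List.concat_eq_append, List.append_assoc, List.cons_append, List.nil_append] at c2
      have h := (List.isChain_append_cons_cons.1 c2).2.1
      rw [l1] at h
      exact absurd h not_monotoneStep_lastSet
    | cons Q M => exact ⟨L, M, P, S, Q, by simp, by simp⟩

theorem classFlip_of_insertsOne (ha : StrictMono a) (hk : k + 2 ≤ n) {T T' : Tiling a}
    {H H' : List (Finset (Fin n))} (hT : IsCrossSection T (k + 1) H)
    (hT' : IsCrossSection T' (k + 1) H') (h : InsertsOne H H')
    (hne : reduce (k + 1) H ≠ reduce (k + 1) H') :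
    ClassFlip (Quotient.mk (kEquivalence a k) T) (Quotient.mk (kEquivalence a k) T') := by
  obtain ⟨L, M, P, S, Q, rfl, rfl⟩ := h.exists_middle hT.hyper hT'.hyper
  obtain ⟨T₁, T₁', h1, h2, h3⟩ := exists_flip_of_insertion ha hk hT hT' fun hv =>
    hne (reduce_remove L hT'.hyper.isChain_cardStep hv).symm
  exact ⟨T₁, T₁', Quotient.sound ((kEquivalence a k).symm' h1),
    Quotient.sound ((kEquivalence a k).symm' h2), h3⟩

theorem classEquiv_symm_eq (ha : StrictMono a) (hk : k + 2 ≤ n) {T : Tiling a}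
    {H : List (Finset (Fin n))} {c : Quotient (kEquivalence a k)}
    (hT : IsCrossSection T (k + 1) H) (h : ReducesTo H (classEquiv ha hk c)) :
    Quotient.mk _ T = c :=
  (classEquiv ha hk).injective ((classEquiv_eq_iff ha hk T _).2 ⟨H, hT, h⟩)

theorem ClassFlip.exists_crossSections (ha : StrictMono a) (hk : k + 2 ≤ n)
    {c c' : Quotient (kEquivalence a k)} (h : ClassFlip c c') :
    ∃ (T T' : Tiling a) (H H' : List (Finset (Fin n))), FlipAtLevel k T T' ∧
      IsCrossSection T (k + 1) H ∧ IsCrossSection T' (k + 1) H' ∧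
      (InsertsOne H H' ∨ InsertsOne H' H) ∧ H ≠ H' ∧ classEquiv ha hk c ≠ classEquiv ha hk c' ∧
      ReducesTo H (classEquiv ha hk c) ∧ ReducesTo H' (classEquiv ha hk c') := by
  obtain ⟨T, T', rfl, rfl, h⟩ := h
  have key : ∃ H H', IsCrossSection T (k + 1) H ∧ IsCrossSection T' (k + 1) H' ∧
      (InsertsOne H H' ∨ InsertsOne H' H) ∧ reduce (k + 1) H ≠ reduce (k + 1) H' := by
    obtain ⟨A, i, j, l, h | h, hA⟩ := (flipAtLevel_iff ha).1 h
    · obtain ⟨H, H', h1, h2, h3, h4⟩ := h.exists_insertsOne ha hk hA.symm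
      exact ⟨H, H', h1, h2, Or.inl h3, h4⟩
    · obtain ⟨H, H', h1, h2, h3, h4⟩ := h.exists_insertsOne ha hk hA.symm
      exact ⟨H', H, h2, h1, Or.inr h3, h4.symm⟩
  obtain ⟨H, H', h1, h2, h3, h4⟩ := key
  obtain ⟨R, hR⟩ := exists_reducesTo ha hk h1
  obtain ⟨R', hR'⟩ := exists_reducesTo ha hk h2
  rw [(classEquiv_eq_iff ha hk T R).2 ⟨H, h1, hR⟩, (classEquiv_eq_iff ha hk T' R').2 ⟨H', h2, hR'⟩]
  refine ⟨T, T', H, H', h, h1, h2, h3, fun e => h4 (by rw [e]), fun e => h4 ?_, hR, hR'⟩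
  rw [hR.reduce_eq h1.hyper, hR'.reduce_eq h2.hyper, e]

/-- A flip of a level other than `k` stays within a class, so distinct reductions leave only level
`k`. -/
theorem reducedFlip_inducedFlip_iff (ha : StrictMono a) (hk : k + 2 ≤ n)
    (c c' : Quotient (kEquivalence a k)) :
    ReducedFlip (InducedFlip a (k + 1)) (classEquiv ha hk c) (classEquiv ha hk c') ↔
      ClassFlip c c' := by
  constructor
  · rintro ⟨hne, H, H', ⟨-, T, T', m, hf, hT, hT'⟩, h1, h2⟩
    obtain rfl := classEquiv_symm_eq ha hk hT h1
    obtain rfl := classEquiv_symm_eq ha hk hT' h2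
    by_cases hm : m = k
    · exact ⟨T, T', rfl, rfl, hm ▸ hf⟩
    · exact absurd (congrArg _ (Quotient.sound (kEquivalence_of_flip hm hf))) hne
  · intro h
    obtain ⟨T, T', H, H', hf, hT, hT', -, hne, hne', h1, h2⟩ := h.exists_crossSections ha hk
    exact ⟨hne', H, H', ⟨hne, T, T', k, hf, hT, hT'⟩, h1, h2⟩

/-- Since the reductions differ, the inserted set does not violate reducedness between its
neighbours, which is what `exists_flip_of_insertion` needs. -/
theorem reducedFlip_insertionFlip_iff (ha : StrictMono a) (hk : k + 2 ≤ n)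
    (c c' : Quotient (kEquivalence a k)) :
    ReducedFlip (InsertionFlip a (k + 1)) (classEquiv ha hk c) (classEquiv ha hk c') ↔
      ClassFlip c c' := by
  constructor
  · rintro ⟨hne, H, H', ⟨⟨hH, T, hT⟩, ⟨hH', T', hT'⟩, h⟩, h1, h2⟩
    have hred : reduce (k + 1) H ≠ reduce (k + 1) H' := fun e =>
      hne (Subtype.ext ((h1.reduce_eq hH).symm.trans (e.trans (h2.reduce_eq hH'))))
    obtain rfl := classEquiv_symm_eq ha hk hT h1
    obtain rfl := classEquiv_symm_eq ha hk hT' h2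
    rcases h with h | h
    · exact classFlip_of_insertsOne ha hk hT hT' h hred
    · exact (classFlip_of_insertsOne ha hk hT' hT h hred.symm).symm
  · intro h
    obtain ⟨T, T', H, H', hf, hT, hT', hins, -, hne', h1, h2⟩ := h.exists_crossSections ha hk
    exact ⟨hne', H, H', ⟨⟨hT.hyper, T, hT⟩, ⟨hT'.hyper, T', hT'⟩, hins⟩, h1, h2⟩

end HigherSecondary
theorem mainTheorem6 (n k : ℕ) (hk : k + 2 ≤ n) (a : Fin n → ℝ) (ha : StrictMono a) :
    ∃ Φ : Quotient (HigherSecondary.kEquivalence a k) ≃ HigherSecondary.ReducedLifting a (k + 1),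
      (∀ (T : HigherSecondary.Tiling a) (R : HigherSecondary.ReducedLifting a (k + 1)),
        Φ (Quotient.mk (HigherSecondary.kEquivalence a k) T) = R ↔
          ∃ H, HigherSecondary.IsCrossSection T (k + 1) H ∧ HigherSecondary.ReducesTo H R) ∧
      (∀ c c' : Quotient (HigherSecondary.kEquivalence a k),
        HigherSecondary.ReducedFlip (HigherSecondary.InducedFlip a (k + 1)) (Φ c) (Φ c') ↔
          HigherSecondary.ClassFlip c c') ∧
      (∀ c c' : Quotient (HigherSecondary.kEquivalence a k),
        HigherSecondary.ReducedFlip (HigherSecondary.InsertionFlip a (k + 1)) (Φ c) (Φ c') ↔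
          HigherSecondary.ClassFlip c c') :=
  ⟨HigherSecondary.classEquiv ha hk, HigherSecondary.classEquiv_eq_iff ha hk,
    HigherSecondary.reducedFlip_inducedFlip_iff ha hk,
    HigherSecondary.reducedFlip_insertionFlip_iff ha hk⟩
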